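/- **Setting.** Let $S$, $A$, $B$ be Borel spaces, and for $t\ge 0$, $x\in S$ let $A(t,x)\subset A$, $B(t,x)\subset B$ be measurable sets such that $K=\{(t,x,a,b): t\ge 0,\ a\in A(t,x),\ b\in B(t,x)\}$ is Borel. Let $q(\cdot\mid t,x,a,b)$, $(t,x,a,b)\in K$, be a (finite) signed kernel on $S$ with $q(D\mid t,x,a,b)\ge 0$ if $x\notin D$, $q(S\mid t,x,a,b)=0$ and $\sup_{t,a,b} q(t,x,a,b)<\infty$ for every $x$, where $q(t,x,a,b):=-q(\{x\}\mid t,x,a,b)$. Let $\phi:S\times\mathbb R\to S$ be a measurable flow: $\phi(x,0)=x$, $\phi(x,s+t)=\phi(\phi(x,s),t)$, $t\mapsto\phi(x,t)$ continuous. Let $c:K\to\mathbb R$ and $g:[0,\infty)\times S\to\mathbb R$ be measurable, and fix $T>0$ and $\lambda\in(0,1]$. A Markov strategy of player 1 (player 2) is a transition probability $\pi^1(da\mid x,t)$ on $A$ (resp. $\pi^2(db\mid x,t)$ on $B$) with $\pi^1(A(t,x)\mid x,t)=1$ (resp. $\pi^2(B(t,x)\mid x,t)=1$). For such $\pi^1,\pi^2$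 write $q^\pi(\cdot\mid t,x)$ and $c^\pi(t,x)$ for the integrals of $q(\cdot\mid t,x,a,b)$ and $c(t,x,a,b)$ against $\pi^1(da\mid x,t)\,\pi^2(db\mid x,t)$. Let $P^{\pi^1,\pi^2}_{(s,x)}$ be the law of the piecewise deterministic process $\xi$ that starts from $T_0=s$, $X_0=x$, moves along the flow, $\xi_t=\phi(X_n,t-T_n)$ for $T_n\le t<T_{n+1}$, and satisfies, given $(T_n,X_n)=(u,y)$, $$P(T_{n+1}\in dz,\,X_{n+1}\in dx')=e^{-\int_u^z q^\pi(v,\phi(y,v-u))\,dv}\;q^\pi\big(dx'\setminus\{\phi(y,z-u)\}\mid z,\phi(y,z-u)\big)\,dz ,\qquad z>u,$$ with $q^\pi(v,y):=-q^\pi(\{y\}\mid v,y)$, the missing mass being the probability of no further jump. After $\lim_n T_n$ the process stays in a cemetery, where all costs are zero. Put $$J^{\pi^1,\pi^2}(s,x)=E^{\pi^1,\pi^2}_{(s,x)}\Big[\exp\Big(\lambda\int_s^T c^\pi(v,\xi_v)\,dv+\lambda g(T,\xi_T)\Big)\Big],\qquad (s,x)\in[0,T]\times S.$$ **Assumption 1.**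 There are a measurable $V:S\to[1,\infty)$ and constants $\rho_1,b_1\ge 0$, $M_2\ge 1$ such that (i) $\int_S V(\phi(y,t))\,q(dy\mid s,x,a,b)\le\rho_1V(\phi(x,t))+b_1$ for $(s,x,a,b)\in K$, $t\ge 0$; (ii) there are measurable sets $S_n\uparrow S$ with $\sup_{(t,x,a,b)\in K,\,x\in S_n}q(t,x,a,b)<\infty$ for each $n$ and $\lim_n\inf_{x\notin S_n}V(\phi(x,t))=\infty$ for all $t\ge 0$; (iii) $e^{2(T+1)|c(t,x,a,b)|}\le M_2V(\phi(x,T-t))$ and $e^{2(T+1)|g(t,x)|}\le M_2V(\phi(x,T-t))$ for $(t,x,a,b)\in K$, $t\le T$. **Assumption 2.** There are a measurable $V_1:S\to[1,\infty)$ and constants $\kappa,\rho_2,b_2>0$, $M_3\ge 1$ such that (i) $q(s,x,a,b)\le\kappa V(\phi(x,T-s))$ for $(s,x,a,b)\in K$, $s\le T$, and $V^2\le M_3V_1$; (ii) $\int_S V_1^2(\phi(y,t))\,q(dy\mid s,x,a,b)\le\rho_2V_1^2(\phi(x,t))+b_2$ for $(s,x,a,b)\in K$, $s\le T$, $t\in[0,T-s]$.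 (The integrals in (i) of Assumption 1 and (ii) of Assumption 2 are supposed to exist.) **The class $\mathbb B^{ac}_{V,V_1}$.** It consists of the measurable $\varphi:[0,T]\times S\to\mathbb R$ such that $\sup_{(t,x)}|\varphi(t,x)|/V(\phi(x,T-t))<\infty$; for all $(s,x)\in[0,T]\times S$ the function $t\mapsto\varphi(s+t,\phi(x,t))$ is absolutely continuous on $[0,T-s]$; and, with $$L^\phi\varphi(t,x)=\lim_{h\to 0}\frac{\varphi(t+h,\phi(x,h))-\varphi(t,x)}{h},$$ there is a constant $C$ with $|L^\phi\varphi(t,x)|\le CV_1(\phi(x,T-t))$ for almost every time along every flow line, that is, for all $(s,x)\in[0,T]\times S$ the bound holds at $(s+t,\phi(x,t))$ for Lebesgue-a.e. $t\in[0,T-s]$. **Theorem 3.2.** Suppose Assumptions 1 and 2 hold, and let $(\pi^1,\pi^2)$ be any pair of Markov strategies. Then for all $(s,x)\in[0,T]\times S$ the cost $J^{\pi^1,\pi^2}(s,x)$ is well defined: $P^{\pi^1,\pi^2}_{(s,x)}$-a.s. $\xi_t\in S$ for all $t\in[s,T]$ and $v\mapsto c^\pi(v,\xi_v)$ is integrable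 on $[s,T]$, and the expectation is finite. Moreover $J^{\pi^1,\pi^2}\in\mathbb B^{ac}_{V,V_1}$, and $\varphi=J^{\pi^1,\pi^2}$ is the unique $\varphi\in\mathbb B^{ac}_{V,V_1}$ that satisfies $$L^\phi\varphi(t,x)+\lambda\,c^\pi(t,x)\,\varphi(t,x)+\int_S\varphi(t,y)\,q^\pi(dy\mid t,x)=0$$ for almost every time along every flow line in $[0,T]\times S$, together with $\varphi(T,x)=e^{\lambda g(T,x)}$ for all $x\in S$. -/

import Mathlib

open MeasureTheory ProbabilityTheory Set Filter Topology
open scoped ENNReal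

noncomputable section

namespace PDMG

/-! ### Signed transition rates -/

section SignedRates

variable {S : Type*} [MeasurableSpace S]

/-- `q` is a conservative signed rate out of the state `x`: nonnegative on the measurable sets
that do not contain `x`, and of total mass zero. -/
structure IsRate (q : SignedMeasure S) (x : S) : Prop where
  nonneg : ∀ D, MeasurableSet D → x ∉ D → 0 ≤ q D
  conservative : q univ = 0

theorem IsRate.zero_le_restrict [MeasurableSingletonClass S] {q : SignedMeasure S} {x : S}
    (h : IsRate q x) : 0 ≤[({x}ᶜ : Set S)] q := by
  apply VectorMeasure.restrict_le_restrict_of_subset_le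
  intro D hD hsub
  exact h.nonneg D hD fun hx => hsub hx rfl

/-- The jump measure `D ↦ q (D \ {x})` of a conservative signed rate `q` out of `x`. -/
def jumpMeasure [MeasurableSingletonClass S] (q : SignedMeasure S) (x : S) (h : IsRate q x) :
    Measure S :=
  q.toMeasureOfZeroLE {x}ᶜ (measurableSet_singleton x).compl h.zero_le_restrict

theorem jumpMeasure_apply [MeasurableSingletonClass S] {q : SignedMeasure S} {x : S}
    (h : IsRate q x) {D : Set S} (hD : MeasurableSet D) :
    jumpMeasure q x h D = ENNReal.ofReal (q (D \ {x})) := by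
  have h0 : 0 ≤ q (D \ {x}) :=
    h.nonneg _ (hD.diff (measurableSet_singleton x)) (fun hx => hx.2 rfl)
  have he : ({x}ᶜ ∩ D : Set S) = D \ {x} := by ext; simp [and_comm]
  rw [jumpMeasure, SignedMeasure.toMeasureOfZeroLE_apply _ _ _ hD,
    ← ENNReal.ofReal_coe_nnreal]
  simp [he]

instance [MeasurableSingletonClass S] (q : SignedMeasure S) (x : S) (h : IsRate q x) :
    IsFiniteMeasure (jumpMeasure q x h) := by
  unfold jumpMeasure; infer_instance

theorem IsRate.apply_compl [MeasurableSingletonClass S] {q : SignedMeasure S} {x : S}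
    (h : IsRate q x) : q {x}ᶜ = - q {x} := by
  have := VectorMeasure.of_add_of_sdiff (v := q) (measurableSet_singleton x) MeasurableSet.univ
    (subset_univ _)
  rw [h.conservative, ← compl_eq_univ_sdiff] at this
  linarith

/-- A conservative rate is its jump measure minus its total rate times the Dirac mass. -/
theorem IsRate.eq_sub [MeasurableSingletonClass S] {q : SignedMeasure S} {x : S}
    (h : IsRate q x) {D : Set S} (hD : MeasurableSet D) :
    q D = (jumpMeasure q x h).real D - (- q {x}) * (Measure.dirac x).real D := by
  have h0 : 0 ≤ q (D \ {x}) :=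
    h.nonneg _ (hD.diff (measurableSet_singleton x)) (fun hx => hx.2 rfl)
  rw [measureReal_def, jumpMeasure_apply h hD, ENNReal.toReal_ofReal h0, measureReal_def,
    Measure.dirac_apply' _ hD]
  by_cases hx : x ∈ D
  · have := VectorMeasure.of_add_of_sdiff (v := q) (measurableSet_singleton x) hD
      (singleton_subset_iff.2 hx)
    simp [hx]; linarith
  · simp [hx]

/-- A measurably parametrized signed measure evaluates measurably on the sections of a
measurable set. -/
theorem measurable_section {P : Type*} [MeasurableSpace P] {G : P → SignedMeasure S}
    (hG : ∀ D, MeasurableSet D → Measurable fun p => G p D) {E : Set (P × S)}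
    (hE : MeasurableSet E) : Measurable fun p => G p (Prod.mk p ⁻¹' E) := by
  have hm : ∀ {E : Set (P × S)} (p : P), MeasurableSet E → MeasurableSet (Prod.mk p ⁻¹' E) :=
    fun p h => measurable_prodMk_left h
  induction E, hE using MeasurableSpace.induction_on_inter generateFrom_prod.symm
    isPiSystem_prod with
  | empty => simp
  | basic t ht =>
    obtain ⟨a, ha, b, hb, rfl⟩ := ht
    have : (fun p => G p (Prod.mk p ⁻¹' (a ×ˢ b))) = a.indicator fun p => G p b := by
      ext p
      by_cases hp : p ∈ a <;> simp [hp, mk_preimage_prod_right, mk_preimage_prod_right_eq_empty]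
    rw [this]
    exact (hG b hb).indicator ha
  | compl t ht ih =>
    have : (fun p => G p (Prod.mk p ⁻¹' tᶜ)) = fun p => G p univ - G p (Prod.mk p ⁻¹' t) := by
      ext p
      have := VectorMeasure.of_add_of_sdiff (v := G p) (hm p ht) MeasurableSet.univ (subset_univ _)
      rw [preimage_compl, compl_eq_univ_sdiff]
      linarith
    rw [this]
    exact (hG _ MeasurableSet.univ).sub ih
  | iUnion f hd hf ih =>
    have hs : ∀ p, HasSum (fun i => G p (Prod.mk p ⁻¹' f i)) (G p (Prod.mk p ⁻¹' ⋃ i, f i)) := by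
      intro p
      rw [preimage_iUnion]
      exact (G p).m_iUnion (fun i => hm p (hf i)) (fun i j hij => (hd hij).preimage _)
    exact measurable_of_tendsto_metrizable
      (fun n => Finset.measurable_sum (Finset.range n) fun i _ => ih i)
      (tendsto_pi_nhds.2 fun p => (hs p).tendsto_sum_nat)

end SignedRates

/-! ### The law of the first point of a given hazard -/

section Hazard

theorem exp_neg_eq_lintegral (y : ℝ≥0∞) :
    EReal.exp (-(y : EReal)) = ∫⁻ r in Ioi (0 : ℝ),
      {r : ℝ | y ≤ ENNReal.ofReal r}.indicator (fun r => ENNReal.ofReal (Real.exp (-r))) r := by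
  induction y with
  | top => simp
  | coe y =>
    have h1 : ∫⁻ r in Ioi (0 : ℝ), {r : ℝ | (y : ℝ≥0∞) ≤ ENNReal.ofReal r}.indicator
        (fun r => ENNReal.ofReal (Real.exp (-r))) r
        = ∫⁻ r in Ioi (0 : ℝ), (Ici (y : ℝ)).indicator
        (fun r => ENNReal.ofReal (Real.exp (-r))) r := by
      refine setLIntegral_congr_fun measurableSet_Ioi fun r hr => ?_
      have : (y : ℝ≥0∞) ≤ ENNReal.ofReal r ↔ (y : ℝ) ≤ r := by
        rw [← ENNReal.ofReal_coe_nnreal, ENNReal.ofReal_le_ofReal_iff (le_of_lt hr)]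
      simp [indicator, this]
    have h2 : (Ici (y : ℝ) ∩ Ioi 0 : Set ℝ) =ᵐ[volume] Ioi (y : ℝ) := by
      rcases eq_or_lt_of_le y.2 with h | h
      · have h' : (y : ℝ) = 0 := h.symm
        have h3 : (Ici (y : ℝ) ∩ Ioi 0 : Set ℝ) = Ioi (y : ℝ) := by
          rw [h', inter_eq_self_of_subset_right Ioi_subset_Ici_self]
        exact Filter.EventuallyEq.of_eq h3
      · have h3 : (Ici (y : ℝ) ∩ Ioi 0 : Set ℝ) = Ici (y : ℝ) :=
          inter_eq_self_of_subset_left (Ici_subset_Ioi.2 h)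
        exact (Filter.EventuallyEq.of_eq h3).trans Ioi_ae_eq_Ici.symm
    rw [h1, lintegral_indicator measurableSet_Ici, Measure.restrict_restrict measurableSet_Ici,
      setLIntegral_congr h2, ← ofReal_integral_eq_lintegral_ofReal
        (integrableOn_exp_neg_Ioi _) (ae_of_all _ fun r => (Real.exp_pos _).le),
      integral_exp_neg_Ioi]
    rw [← EReal.exp_coe]; rfl

theorem setLIntegral_le_of_cum (h : ℝ → ℝ≥0∞) (u : ℝ) (y : ℝ≥0∞) :
    ∫⁻ z in {z | u < z ∧ ∫⁻ v in Ioc u z, h v ≤ y}, h z ≤ y := by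
  set E := {z | u < z ∧ ∫⁻ v in Ioc u z, h v ≤ y} with hE
  let I : ℚ → Set ℝ := fun q => if (q : ℝ) ∈ E then Ioc u q else ∅
  have hdown : ∀ z ∈ E, ∀ w, u < w → w ≤ z → w ∈ E := fun z hz w hw hwz =>
    ⟨hw, (lintegral_mono_set (Ioc_subset_Ioc_right hwz)).trans hz.2⟩
  have hsub : (E \ ⋃ q, I q).Subsingleton := by
    have key : ∀ z ∈ E \ ⋃ q, I q, ∀ w ∈ E \ ⋃ q, I q, ¬ z < w := by
      intro z hz w hw hzw
      obtain ⟨q, hq1, hq2⟩ := exists_rat_btwn hzw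
      refine hz.2 (mem_iUnion.2 ⟨q, ?_⟩)
      have hqE : (q : ℝ) ∈ E := hdown w hw.1 q (hz.1.1.trans hq1) hq2.le
      simp only [I, if_pos hqE]
      exact ⟨hz.1.1, hq1.le⟩
    intro z hz w hw
    exact le_antisymm (not_lt.1 (key w hw z hz)) (not_lt.1 (key z hz w hw))
  have hdir : Directed (· ⊆ ·) I := by
    intro a b
    rcases le_total a b with hab | hab
    · by_cases hb : (b : ℝ) ∈ E
      · refine ⟨b, ?_, subset_rfl⟩
        simp only [I, if_pos hb]
        split_ifs
        · exact Ioc_subset_Ioc_right (by exact_mod_cast hab)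
        · simp
      · exact ⟨a, subset_rfl, by simp [I, hb]⟩
    · by_cases hb : (a : ℝ) ∈ E
      · refine ⟨a, subset_rfl, ?_⟩
        simp only [I, if_pos hb]
        split_ifs
        · exact Ioc_subset_Ioc_right (by exact_mod_cast hab)
        · simp
      · exact ⟨b, by simp [I, hb], subset_rfl⟩
  have hI : ∫⁻ z in ⋃ q, I q, h z ≤ y := by
    have hm : ∀ q, MeasurableSet (I q) := fun q => by
      simp only [I]; split_ifs <;> simp
    rw [← withDensity_apply _ (MeasurableSet.iUnion hm), hdir.measure_iUnion]
    refine iSup_le fun q => ?_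
    rw [withDensity_apply _ (hm q)]
    simp only [I]
    split_ifs with hq
    · exact hq.2
    · simp
  calc ∫⁻ z in E, h z ≤ ∫⁻ z in (⋃ q, I q) ∪ (E \ ⋃ q, I q), h z :=
        lintegral_mono_set (by rw [union_sdiff_self]; exact subset_union_right)
    _ ≤ (∫⁻ z in ⋃ q, I q, h z) + ∫⁻ z in E \ ⋃ q, I q, h z := lintegral_union_le _ _ _
    _ ≤ y + 0 := by
        refine add_le_add hI (le_of_eq ?_)
        rw [Measure.restrict_eq_zero.2 (hsub.measure_zero _), lintegral_zero_measure]
    _ = y := add_zero y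

theorem lintegral_exp_neg_mul_le_one (h : ℝ → ℝ≥0∞) (hh : Measurable h) (u : ℝ) :
    ∫⁻ z in Ioi u, EReal.exp (-((∫⁻ v in Ioc u z, h v : ℝ≥0∞) : EReal)) * h z ≤ 1 := by
  set H : ℝ → ℝ≥0∞ := fun z => ∫⁻ v in Ioc u z, h v with hH
  have hHm : Measurable H := Monotone.measurable fun a b hab =>
    lintegral_mono_set (Ioc_subset_Ioc_right hab)
  have hset : MeasurableSet {w : ℝ × ℝ | H w.1 ≤ ENNReal.ofReal w.2} :=
    measurableSet_le (by fun_prop) (by fun_prop)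
  have hmeas : Measurable fun w : ℝ × ℝ => {r : ℝ | H w.1 ≤ ENNReal.ofReal r}.indicator
      (fun r => ENNReal.ofReal (Real.exp (-r))) w.2 * h w.1 := by
    refine Measurable.mul ?_ (by fun_prop)
    exact Measurable.indicator (f := fun w : ℝ × ℝ => ENNReal.ofReal (Real.exp (-w.2)))
      (by fun_prop) hset
  calc ∫⁻ z in Ioi u, EReal.exp (-(H z : EReal)) * h z
      = ∫⁻ z in Ioi u, ∫⁻ r in Ioi (0 : ℝ), {r : ℝ | H z ≤ ENNReal.ofReal r}.indicator
          (fun r => ENNReal.ofReal (Real.exp (-r))) r * h z := by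
        refine lintegral_congr fun z => ?_
        rw [exp_neg_eq_lintegral, lintegral_mul_const]
        exact Measurable.indicator (by fun_prop) (measurableSet_le (by fun_prop) (by fun_prop))
    _ = ∫⁻ r in Ioi (0 : ℝ), ∫⁻ z in Ioi u, {r : ℝ | H z ≤ ENNReal.ofReal r}.indicator
          (fun r => ENNReal.ofReal (Real.exp (-r))) r * h z :=
        lintegral_lintegral_swap hmeas.aemeasurable
    _ ≤ ∫⁻ r in Ioi (0 : ℝ), ENNReal.ofReal (Real.exp (-r) * r ^ ((2 : ℝ) - 1)) := by
        refine setLIntegral_mono' measurableSet_Ioi fun r hr => ?_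
        have hs : MeasurableSet {z | H z ≤ ENNReal.ofReal r} :=
          measurableSet_le hHm measurable_const
        have : ∀ z, {r : ℝ | H z ≤ ENNReal.ofReal r}.indicator
            (fun r => ENNReal.ofReal (Real.exp (-r))) r * h z =
            ENNReal.ofReal (Real.exp (-r)) * {z | H z ≤ ENNReal.ofReal r}.indicator h z := by
          intro z
          by_cases hz : H z ≤ ENNReal.ofReal r <;> simp [indicator, hz]
        simp only [this]
        rw [lintegral_const_mul _ (hh.indicator hs), lintegral_indicator hs,
          Measure.restrict_restrict hs, ENNReal.ofReal_mul (Real.exp_pos _).le]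
        gcongr
        have h2 := setLIntegral_le_of_cum h u (ENNReal.ofReal r)
        have h3 : {z | H z ≤ ENNReal.ofReal r} ∩ Ioi u =
            {z | u < z ∧ ∫⁻ v in Ioc u z, h v ≤ ENNReal.ofReal r} := by
          ext z; simp [hH, and_comm]
        rw [h3]
        refine h2.trans_eq ?_
        norm_num
    _ = 1 := by
        rw [← ofReal_integral_eq_lintegral_ofReal (Real.GammaIntegral_convergent (by norm_num))
          ((ae_restrict_iff' measurableSet_Ioi).2 (ae_of_all _ fun r (hr : 0 < r) => by positivity)),
          ← Real.Gamma_eq_integral (by norm_num)]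
        simp

end Hazard

/-! ### The game model -/

/-- The set `K` of quadruples `(t, x, a, b)` with `t ≥ 0` and admissible actions `a`, `b`. -/
def admissibleSet {S A B : Type*} (actA : ℝ → S → Set A) (actB : ℝ → S → Set B) :
    Set (ℝ × S × A × B) :=
  {k | 0 ≤ k.1 ∧ k.2.2.1 ∈ actA k.1 k.2.1 ∧ k.2.2.2 ∈ actB k.1 k.2.1}

/-- The data of a two-person piecewise deterministic Markov game with state space `S` and action
spaces `A`, `B`. All conditions concern nonnegative times and admissible actions only. -/
structure Game (S A B : Type*) [TopologicalSpace S] [MeasurableSpace S] [MeasurableSpace A]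
    [MeasurableSpace B] where
  /-- admissible actions of player 1 -/
  actA : ℝ → S → Set A
  /-- admissible actions of player 2 -/
  actB : ℝ → S → Set B
  measurableSet_actA : ∀ t x, 0 ≤ t → MeasurableSet (actA t x)
  measurableSet_actB : ∀ t x, 0 ≤ t → MeasurableSet (actB t x)
  measurableSet_adm : MeasurableSet (admissibleSet actA actB)
  /-- the transition rates `q(· | t, x, a, b)` -/
  q : ℝ → S → A → B → SignedMeasure S
  measurable_q : ∀ D, MeasurableSet D →
    Measurable fun k : admissibleSet actA actB => q k.1.1 k.1.2.1 k.1.2.2.1 k.1.2.2.2 D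
  q_nonneg : ∀ t x a b, (t, x, a, b) ∈ admissibleSet actA actB →
    ∀ D, MeasurableSet D → x ∉ D → 0 ≤ q t x a b D
  q_conservative : ∀ t x a b, (t, x, a, b) ∈ admissibleSet actA actB → q t x a b univ = 0
  q_stable : ∀ x, ∃ C : ℝ, ∀ t a b, (t, x, a, b) ∈ admissibleSet actA actB →
    - q t x a b {x} ≤ C
  /-- the flow `φ(x, t)` -/
  flow : S → ℝ → S
  measurable_flow : Measurable fun p : S × ℝ => flow p.1 p.2
  flow_add : ∀ x s t, flow x (s + t) = flow (flow x s) t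
  flow_zero : ∀ x, flow x 0 = x
  continuous_flow : ∀ x, Continuous (flow x)
  /-- the running cost rate -/
  c : ℝ → S → A → B → ℝ
  measurable_c : Measurable fun k : admissibleSet actA actB =>
    c k.1.1 k.1.2.1 k.1.2.2.1 k.1.2.2.2
  /-- the terminal cost -/
  g : ℝ → S → ℝ
  measurable_g : Measurable fun p : Ici (0 : ℝ) × S => g p.1 p.2

/-- A (randomized) Markov strategy `π(da | x, t)` of a player with admissible action sets `act`:
a transition probability, evaluated at `(t, x)`, that is carried by the admissible actions. -/
structure MarkovStrategy {S C : Type*} [MeasurableSpace S] [MeasurableSpace C]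
    (act : ℝ → S → Set C) where
  /-- the underlying kernel -/
  kernel : Kernel (ℝ × S) C
  isMarkov : IsMarkovKernel kernel
  carried : ∀ t x, 0 ≤ t → kernel (t, x) (act t x) = 1

attribute [instance] MarkovStrategy.isMarkov

namespace Game

section Rates

variable {S A B : Type*} [TopologicalSpace S] [MeasurableSpace S] [MeasurableSpace A]
  [MeasurableSpace B] (M : Game S A B)

/-- The set `K` of admissible quadruples. -/
abbrev K : Set (ℝ × S × A × B) := admissibleSet M.actA M.actB

theorem measurable_jumpPoint :
    Measurable fun w : (ℝ × S) × ℝ => ((w.2, M.flow w.1.2 (w.2 - w.1.1)) : ℝ × S) :=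
  measurable_snd.prodMk (M.measurable_flow.comp
    (g := fun p : S × ℝ => M.flow p.1 p.2) (f := fun w : (ℝ × S) × ℝ => (w.1.2, w.2 - w.1.1))
    (by fun_prop))

/-- The transition rate evaluated at `D`, extended by zero outside `K`. -/
def qAt (D : Set S) (k : ℝ × S × A × B) : ℝ :=
  M.K.indicator (fun k => M.q k.1 k.2.1 k.2.2.1 k.2.2.2 D) k

theorem measurable_qAt {D : Set S} (hD : MeasurableSet D) : Measurable (M.qAt D) := by
  refine measurable_of_restrict_of_restrict_compl M.measurableSet_adm ?_ ?_
  · have : M.K.domRestrict (M.qAt D) =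
        fun k : M.K => M.q k.1.1 k.1.2.1 k.1.2.2.1 k.1.2.2.2 D := by
      ext k; simp [qAt, k.2]
    rw [this]; exact M.measurable_q D hD
  · have : M.Kᶜ.domRestrict (M.qAt D) = fun _ => 0 := by
      ext k; exact indicator_of_notMem k.2 (fun k => M.q k.1 k.2.1 k.2.2.1 k.2.2.2 D)
    rw [this]; exact measurable_const

variable [MeasurableSingletonClass S]

theorem exists_abs_qAt_le (x : S) : ∃ C : ℝ, 0 ≤ C ∧ ∀ (t : ℝ) (a : A) (b : B) (f : ℕ → Set S),
    (∀ i, MeasurableSet (f i)) → Pairwise (fun i j => Disjoint (f i) (f j)) → ∀ s : Finset ℕ,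
      ∑ i ∈ s, |M.qAt (f i) (t, x, a, b)| ≤ C := by
  obtain ⟨C, hC⟩ := M.q_stable x
  refine ⟨2 * max C 0, by positivity, fun t a b f hf hd s => ?_⟩
  by_cases hk : (t, x, a, b) ∈ M.K
  swap
  · simp [qAt, hk]
  have hr : IsRate (M.q t x a b) x := ⟨M.q_nonneg t x a b hk, M.q_conservative t x a b hk⟩
  set m := jumpMeasure (M.q t x a b) x hr with hm
  set r := - M.q t x a b {x} with hrdef
  have hrC : r ≤ max C 0 := (hC t a b hk).trans (le_max_left _ _)
  have hr0 : 0 ≤ r := by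
    rw [hrdef, ← hr.apply_compl]
    exact hr.nonneg _ (measurableSet_singleton x).compl (by simp)
  have hmu : m.real univ = r := by
    have := hr.eq_sub MeasurableSet.univ
    rw [hr.conservative] at this
    simp at this
    rw [hm]; linarith
  have key : ∀ i, |M.qAt (f i) (t, x, a, b)| ≤ m.real (f i) + r * (Measure.dirac x).real (f i) := by
    intro i
    have h1 : M.qAt (f i) (t, x, a, b) = M.q t x a b (f i) := by simp [qAt, hk]
    rw [h1, hr.eq_sub (hf i)]
    refine (abs_sub _ _).trans_eq ?_
    rw [abs_of_nonneg measureReal_nonneg, abs_of_nonneg (mul_nonneg hr0 measureReal_nonneg)]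
  have hsum : ∀ (n : Measure S) [IsFiniteMeasure n], ∑ i ∈ s, n.real (f i) ≤ n.real univ := by
    intro n _
    rw [← measureReal_biUnion_finset (fun i _ j _ hij => hd hij) (fun i _ => hf i)]
    exact measureReal_mono (subset_univ _)
  calc ∑ i ∈ s, |M.qAt (f i) (t, x, a, b)|
      ≤ ∑ i ∈ s, (m.real (f i) + r * (Measure.dirac x).real (f i)) :=
        Finset.sum_le_sum fun i _ => key i
    _ = ∑ i ∈ s, m.real (f i) + r * ∑ i ∈ s, (Measure.dirac x).real (f i) := by
        rw [Finset.sum_add_distrib, Finset.mul_sum]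
    _ ≤ m.real univ + r * (Measure.dirac x).real univ := by
        gcongr <;> exact hsum _
    _ ≤ 2 * max C 0 := by
        rw [hmu]; simp; linarith

theorem integrable_qAt (t : ℝ) (x : S) {D : Set S} (hD : MeasurableSet D) (μ : Measure A)
    (ν : Measure B) [IsFiniteMeasure μ] [IsFiniteMeasure ν] :
    Integrable (fun p : A × B => M.qAt D (t, x, p.1, p.2)) (μ.prod ν) := by
  obtain ⟨C, -, hC⟩ := M.exists_abs_qAt_le x
  refine Integrable.of_bound (C := C) ?_ (ae_of_all _ fun p => ?_)
  · exact ((M.measurable_qAt hD).comp (by fun_prop)).aestronglyMeasurable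
  · have := hC t p.1 p.2 (fun i => if i = 0 then D else ∅)
      (fun i => by split_ifs <;> simp [hD])
      (fun i j hij => by
        by_cases hi : i = 0
        · have : j ≠ 0 := fun h => hij (hi.trans h.symm)
          simp [this]
        · simp [hi]) {0}
    simpa using this

/-- The transition rate `q(D | t, x, μ, ν) = ∫ ∫ q(D | t, x, a, b) μ(da) ν(db)` under randomized
actions, where the integral runs over the admissible pairs `(a, b)`. -/
def mixedRate (t : ℝ) (x : S) (μ : Measure A) (ν : Measure B) [IsFiniteMeasure μ]
    [IsFiniteMeasure ν] : SignedMeasure S where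
  measureOf' D := ∫ p, M.qAt D (t, x, p.1, p.2) ∂(μ.prod ν)
  empty' := by simp [qAt]
  not_measurable' D hD := by
    simp [qAt, VectorMeasure.not_measurable _ hD]
  m_iUnion' f hf hd := by
    obtain ⟨C, hC0, hC⟩ := M.exists_abs_qAt_le x
    have h1 : ∀ p : A × B, HasSum (fun i => M.qAt (f i) (t, x, p.1, p.2))
        (M.qAt (⋃ i, f i) (t, x, p.1, p.2)) := by
      intro p
      by_cases hk : (t, x, p.1, p.2) ∈ M.K
      · simpa [qAt, hk] using (M.q t x p.1 p.2).m_iUnion hf hd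
      · simp [qAt, hk]
    have h2 := hasSum_integral_of_summable_integral_norm
      (F := fun i (p : A × B) => M.qAt (f i) (t, x, p.1, p.2)) (μ := μ.prod ν)
      (fun i => M.integrable_qAt t x (hf i) μ ν) (by
        refine summable_of_sum_le (c := C * (μ.prod ν).real univ)
          (fun i => integral_nonneg fun _ => norm_nonneg _) (fun s => ?_)
        rw [← integral_finsetSum _ fun i _ => (M.integrable_qAt t x (hf i) μ ν).norm]
        refine (integral_mono (integrable_finsetSum _ fun i _ =>
          (M.integrable_qAt t x (hf i) μ ν).norm) (integrable_const C)
          (fun p => hC t p.1 p.2 f hf hd s)).trans_eq ?_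
        simp [mul_comm])
    convert! h2 using 1
    exact integral_congr_ae (ae_of_all _ fun p => ((h1 p).tsum_eq).symm)

theorem mixedRate_apply (t : ℝ) (x : S) (μ : Measure A) (ν : Measure B) [IsFiniteMeasure μ]
    [IsFiniteMeasure ν] (D : Set S) :
    M.mixedRate t x μ ν D = ∫ p, M.qAt D (t, x, p.1, p.2) ∂(μ.prod ν) := rfl

theorem isRate_mixedRate (t : ℝ) (x : S) (μ : Measure A) (ν : Measure B) [IsFiniteMeasure μ]
    [IsFiniteMeasure ν] : IsRate (M.mixedRate t x μ ν) x where
  nonneg D hD hx := integral_nonneg fun p =>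
    indicator_apply_nonneg fun hk => M.q_nonneg _ _ _ _ hk D hD hx
  conservative := by
    rw [mixedRate_apply]
    refine integral_eq_zero_of_ae (ae_of_all _ fun p => ?_)
    by_cases hk : (t, x, p.1, p.2) ∈ M.K
    · simpa [qAt, hk] using M.q_conservative _ _ _ _ hk
    · simp [qAt, hk]

/-- The cost rate `c(t, x, μ, ν) = ∫ ∫ c(t, x, a, b) μ(da) ν(db)` under randomized actions, where
the integral runs over the admissible pairs `(a, b)`. -/
def mixedCost (t : ℝ) (x : S) (μ : Measure A) (ν : Measure B) : ℝ :=
  ∫ p, M.K.indicator (fun k => M.c k.1 k.2.1 k.2.2.1 k.2.2.2) (t, x, p.1, p.2) ∂(μ.prod ν)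

end Rates

/-! ### The controlled process -/

section Controlled

variable {S A B : Type*} [TopologicalSpace S] [MeasurableSpace S] [MeasurableEq S]
  [MeasurableSpace A] [MeasurableSpace B] (M : Game S A B)
  (π₁ : MarkovStrategy M.actA) (π₂ : MarkovStrategy M.actB)

/-- The signed rate `q(· | t, x, π¹(· | x, t), π²(· | x, t))`. -/
def stratRate (t : ℝ) (x : S) : SignedMeasure S :=
  M.mixedRate t x (π₁.kernel (t, x)) (π₂.kernel (t, x))

/-- The cost rate `c(t, x, π¹(· | x, t), π²(· | x, t))`. -/
def stratCost (t : ℝ) (x : S) : ℝ :=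
  M.mixedCost t x (π₁.kernel (t, x)) (π₂.kernel (t, x))

theorem isRate_stratRate (t : ℝ) (x : S) : IsRate (M.stratRate π₁ π₂ t x) x :=
  M.isRate_mixedRate _ _ _ _

theorem measurable_stratRate {D : Set S} (hD : MeasurableSet D) :
    Measurable fun p : ℝ × S => M.stratRate π₁ π₂ p.1 p.2 D := by
  have h : StronglyMeasurable fun z : (ℝ × S) × A × B => M.qAt D (z.1.1, z.1.2, z.2.1, z.2.2) :=
    ((M.measurable_qAt hD).comp (by fun_prop)).stronglyMeasurable
  have := (h.integral_kernel_prod_right (κ := π₁.kernel ×ₖ π₂.kernel)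
    (f := fun p y => M.qAt D (p.1, p.2, y.1, y.2))).measurable
  simpa only [Kernel.prod_apply, stratRate, mixedRate_apply] using this

/-- The jump kernel `(t, x) ↦ q(· \ {x} | t, x, π¹(· | x, t), π²(· | x, t))`. -/
def jumpKernel : Kernel (ℝ × S) S where
  toFun p := jumpMeasure (M.stratRate π₁ π₂ p.1 p.2) p.2 (M.isRate_stratRate π₁ π₂ p.1 p.2)
  measurable' := by
    refine Measure.measurable_of_measurable_coe _ fun D hD => ?_
    simp only [jumpMeasure_apply _ hD]
    refine ENNReal.measurable_ofReal.comp ?_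
    have hE : MeasurableSet {z : (ℝ × S) × S | z.2 ∈ D ∧ ¬ z.2 = z.1.2} :=
      (measurable_snd hD).inter
        (measurableSet_eq_fun measurable_snd (measurable_snd.comp measurable_fst)).compl
    exact measurable_section (fun D hD => M.measurable_stratRate π₁ π₂ hD) hE

theorem jumpKernel_apply (t : ℝ) (x : S) {D : Set S} (hD : MeasurableSet D) :
    M.jumpKernel π₁ π₂ (t, x) D = ENNReal.ofReal (M.stratRate π₁ π₂ t x (D \ {x})) :=
  jumpMeasure_apply (M.isRate_stratRate π₁ π₂ t x) hD

instance (p : ℝ × S) : IsFiniteMeasure (M.jumpKernel π₁ π₂ p) :=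
  inferInstanceAs (IsFiniteMeasure (jumpMeasure _ _ (M.isRate_stratRate π₁ π₂ p.1 p.2)))

instance : IsSFiniteKernel (M.jumpKernel π₁ π₂) := by
  set κ := M.jumpKernel π₁ π₂ with hκ
  have hm : ∀ n : ℕ, MeasurableSet {p | ⌊(κ p univ).toReal⌋₊ = n} := fun n =>
    (Nat.measurable_floor.comp (κ.measurable_coe MeasurableSet.univ).ennreal_toReal)
      (measurableSet_singleton n)
  classical
  refine ⟨fun n => Kernel.piecewise (hm n) κ 0, fun n => ?_, ?_⟩
  · refine ⟨⟨ENNReal.ofReal (n + 1), ENNReal.ofReal_lt_top, fun p => ?_⟩⟩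
    rw [Kernel.piecewise_apply]
    split_ifs with h
    · rw [← ENNReal.ofReal_toReal (measure_ne_top (κ p) univ)]
      refine ENNReal.ofReal_le_ofReal ?_
      have := Nat.lt_floor_add_one (κ p univ).toReal
      rw [mem_ofPred_eq] at h
      rw [h] at this
      exact this.le
    · simp
  · ext p s hs
    rw [Kernel.sum_apply, Measure.sum_apply _ hs, tsum_eq_single ⌊(κ p univ).toReal⌋₊]
    · simp [Kernel.piecewise_apply]
    · intro n hn
      simp [Kernel.piecewise_apply, hn.symm]

/-- The cumulated jump rate `∫_u^z q(v, φ(y, v - u), π¹, π²) dv` along the flow line that is at `y`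
at time `u`, for `p = (u, y)`. -/
def cumRate (p : ℝ × S) (z : ℝ) : ℝ≥0∞ :=
  ∫⁻ v in Ioc p.1 z, M.jumpKernel π₁ π₂ (v, M.flow p.2 (v - p.1)) univ

/-- The probability `exp (- ∫_u^z q(v, φ(y, v - u), π¹, π²) dv)` of no jump in `(u, z]` if the
process is at `y` at time `u`, for `p = (u, y)`. -/
def survival (p : ℝ × S) (z : ℝ) : ℝ≥0∞ :=
  EReal.exp (- (M.cumRate π₁ π₂ p z : EReal))

theorem measurable_survival :
    Measurable fun w : (ℝ × S) × ℝ => M.survival π₁ π₂ w.1 w.2 := by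
  have h1 : Measurable fun w : ((ℝ × S) × ℝ) × ℝ =>
      (Ioc w.1.1.1 w.1.2).indicator
        (fun v => M.jumpKernel π₁ π₂ (v, M.flow w.1.1.2 (v - w.1.1.1)) univ) w.2 := by
    have h2 : Measurable fun w : ((ℝ × S) × ℝ) × ℝ =>
        M.jumpKernel π₁ π₂ (w.2, M.flow w.1.1.2 (w.2 - w.1.1.1)) univ :=
      ((M.jumpKernel π₁ π₂).measurable_coe MeasurableSet.univ).comp
        (measurable_snd.prodMk (M.measurable_flow.comp (g := fun p : S × ℝ => M.flow p.1 p.2)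
          (f := fun w : ((ℝ × S) × ℝ) × ℝ => (w.1.1.2, w.2 - w.1.1.1)) (by fun_prop)))
    have h3 : MeasurableSet {w : ((ℝ × S) × ℝ) × ℝ | w.1.1.1 < w.2 ∧ w.2 ≤ w.1.2} :=
      MeasurableSet.inter (s₁ := {w : ((ℝ × S) × ℝ) × ℝ | w.1.1.1 < w.2})
        (s₂ := {w : ((ℝ × S) × ℝ) × ℝ | w.2 ≤ w.1.2})
        (measurableSet_lt (measurable_fst.comp (measurable_fst.comp measurable_fst))
          measurable_snd)
        (measurableSet_le measurable_snd (measurable_snd.comp measurable_fst))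
    exact h2.indicator h3
  have h4 : Measurable fun w : (ℝ × S) × ℝ => M.cumRate π₁ π₂ w.1 w.2 := by
    have := h1.lintegral_prod_right' (ν := volume)
    simpa only [cumRate, lintegral_indicator measurableSet_Ioc] using this
  exact EReal.measurable_exp.comp (h4.coe_ereal_ennreal.neg)

/-- The law on `(u, ∞) × S` of the next jump time and the post-jump state if the process is at `y`
at time `u`, for `p = (u, y)`: it has the density
`exp (- ∫_u^z q(v, φ(y, v - u), π¹, π²) dv) q(dx' \ {φ(y, z - u)} | z, φ(y, z - u), π¹, π²) dz`.
The missing mass is the probability that no further jump occurs. -/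
def nextJump : Kernel (ℝ × S) (ℝ × S) :=
  Kernel.withDensity
    (Kernel.const (ℝ × S) (volume : Measure ℝ) ⊗ₖ
      (M.jumpKernel π₁ π₂).comap (fun w : (ℝ × S) × ℝ => (w.2, M.flow w.1.2 (w.2 - w.1.1)))
        M.measurable_jumpPoint)
    (fun p w => (Ioi p.1).indicator (M.survival π₁ π₂ p) w.1)

theorem measurable_nextJump_density :
    Measurable (Function.uncurry fun (p w : ℝ × S) =>
      (Ioi p.1).indicator (M.survival π₁ π₂ p) w.1) := by
  have h : Measurable fun z : (ℝ × S) × (ℝ × S) => M.survival π₁ π₂ z.1 z.2.1 :=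
    (M.measurable_survival π₁ π₂).comp
      (g := fun w : (ℝ × S) × ℝ => M.survival π₁ π₂ w.1 w.2)
      (f := fun z : (ℝ × S) × (ℝ × S) => (z.1, z.2.1)) (by fun_prop)
  have hs : MeasurableSet {z : (ℝ × S) × (ℝ × S) | z.1.1 < z.2.1} :=
    measurableSet_lt (measurable_fst.comp measurable_fst) (measurable_fst.comp measurable_snd)
  exact h.indicator hs

theorem nextJump_apply (p : ℝ × S) {E : Set (ℝ × S)} (hE : MeasurableSet E) :
    M.nextJump π₁ π₂ p E = ∫⁻ z in Ioi p.1, M.survival π₁ π₂ p z *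
      M.jumpKernel π₁ π₂ (z, M.flow p.2 (z - p.1)) (Prod.mk z ⁻¹' E) := by
  have hd : Measurable fun w : ℝ × S => (Ioi p.1).indicator (M.survival π₁ π₂ p) w.1 :=
    (M.measurable_nextJump_density π₁ π₂).comp measurable_prodMk_left
  rw [nextJump, Kernel.withDensity_apply' _ (M.measurable_nextJump_density π₁ π₂),
    ← lintegral_indicator hE, Kernel.lintegral_compProd _ _ _ (hd.indicator hE),
    ← lintegral_indicator measurableSet_Ioi]
  simp only [Kernel.const_apply, Kernel.comap_apply]
  refine lintegral_congr fun z => ?_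
  have h1 : ∀ y : S, E.indicator (fun w : ℝ × S => (Ioi p.1).indicator (M.survival π₁ π₂ p) w.1)
      (z, y) = (Ioi p.1).indicator (M.survival π₁ π₂ p) z *
        (Prod.mk z ⁻¹' E).indicator (fun _ => 1) y := by
    intro y
    by_cases hy : (z, y) ∈ E <;> simp [indicator, hy]
  simp only [h1]
  rw [lintegral_const_mul _ (measurable_const.indicator (measurable_prodMk_left hE)),
    lintegral_indicator_const (measurable_prodMk_left hE), one_mul]
  by_cases hz : z ∈ Ioi p.1 <;> simp [hz]

theorem nextJump_le_one (p : ℝ × S) : M.nextJump π₁ π₂ p univ ≤ 1 := by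
  rw [M.nextJump_apply π₁ π₂ p MeasurableSet.univ]
  have hm : Measurable fun z : ℝ => M.jumpKernel π₁ π₂ (z, M.flow p.2 (z - p.1)) univ :=
    ((M.jumpKernel π₁ π₂).measurable_coe MeasurableSet.univ).comp
      (M.measurable_jumpPoint.comp (measurable_prodMk_left (x := p)))
  simpa only [preimage_univ] using! lintegral_exp_neg_mul_le_one _ hm p.1

/-- One step of the embedded chain `(T_n, X_n)`; the extra point stands for `(∞, Δ)`, that is,
"no further jump". -/
def step : Kernel ((ℝ × S) ⊕ Unit) ((ℝ × S) ⊕ Unit) where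
  toFun := Sum.elim
    (fun p => (M.nextJump π₁ π₂ p).map Sum.inl +
      (1 - M.nextJump π₁ π₂ p univ) • Measure.dirac (Sum.inr ()))
    (fun _ => Measure.dirac (Sum.inr ()))
  measurable' := by
    refine Measurable.sumElim ?_ measurable_const
    refine Measure.measurable_of_measurable_coe _ fun D hD => ?_
    simp only [Measure.add_apply, Measure.smul_apply, smul_eq_mul,
      Measure.map_apply measurable_inl hD]
    exact ((M.nextJump π₁ π₂).measurable_coe (measurable_inl hD)).add
      ((measurable_const.sub ((M.nextJump π₁ π₂).measurable_coe MeasurableSet.univ)).mul_const _)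

instance : IsMarkovKernel (M.step π₁ π₂) := by
  refine ⟨fun z => ⟨?_⟩⟩
  cases z with
  | inl p =>
    change ((M.nextJump π₁ π₂ p).map Sum.inl + (1 - M.nextJump π₁ π₂ p univ) •
      Measure.dirac (Sum.inr ()) : Measure ((ℝ × S) ⊕ Unit)) univ = 1
    rw [Measure.add_apply, Measure.map_apply measurable_inl MeasurableSet.univ]
    simpa using add_tsub_cancel_of_le (M.nextJump_le_one π₁ π₂ p)
  | inr _ =>
    change (Measure.dirac (Sum.inr ()) : Measure ((ℝ × S) ⊕ Unit)) univ = 1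
    simp

/-- The step kernel, viewed as a function of the whole history of the embedded chain. -/
def historyStep (n : ℕ) : Kernel (Π _ : Finset.Iic n, (ℝ × S) ⊕ Unit) ((ℝ × S) ⊕ Unit) :=
  (M.step π₁ π₂).comap (fun h => h ⟨n, Finset.mem_Iic.2 le_rfl⟩) (measurable_pi_apply _)

instance (n : ℕ) : IsMarkovKernel (M.historyStep π₁ π₂ n) := by
  unfold historyStep; infer_instance

/-- The law `P_{(s,x)}` under the Markov strategies `π¹`, `π²` of the sequence `(T_n, X_n)` of
jump times and post-jump states of the process that starts at time `T_0 = s` from `X_0 = x`. -/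
def law (s : ℝ) (x : S) : Measure (ℕ → (ℝ × S) ⊕ Unit) :=
  Kernel.traj (X := fun _ => (ℝ × S) ⊕ Unit) (M.historyStep π₁ π₂) 0 fun _ => Sum.inl (s, x)

instance (s : ℝ) (x : S) : IsProbabilityMeasure (M.law π₁ π₂ s x) := by
  unfold law; infer_instance

end Controlled

section Cost

variable {S A B : Type*} [TopologicalSpace S] [MeasurableSpace S] [MeasurableEq S]
  [MeasurableSpace A] [MeasurableSpace B] (M : Game S A B)

/-- The jump time `T_n` of a sequence of jump times and post-jump states (`∞` for the extra
point). -/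
def jumpTime (ω : ℕ → (ℝ × S) ⊕ Unit) (n : ℕ) : WithTop ℝ :=
  Sum.elim (fun p => (p.1 : WithTop ℝ)) (fun _ => ⊤) (ω n)

open Classical in
/-- The state process: `ξ_t = φ(X_n, t - T_n)` if `T_n ≤ t < T_{n+1}`, and the cemetery `none` if
there is no such `n`. -/
def state (ω : ℕ → (ℝ × S) ⊕ Unit) (t : ℝ) : Option S :=
  if h : ∃ n, jumpTime ω n ≤ t ∧ (t : WithTop ℝ) < jumpTime ω (n + 1) then
    Sum.elim (fun p => some (M.flow p.2 (t - p.1))) (fun _ => none) (ω (Nat.find h))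
  else none

variable (π₁ : MarkovStrategy M.actA) (π₂ : MarkovStrategy M.actB)

/-- The cost rate along a path, `c(t, ξ_t, π¹(· | ξ_t, t), π²(· | ξ_t, t))`, which vanishes at the
cemetery. -/
def pathCost (ω : ℕ → (ℝ × S) ⊕ Unit) (t : ℝ) : ℝ :=
  (M.state ω t).elim 0 fun x => M.stratCost π₁ π₂ t x

/-- The exponential cost `exp (λ ∫_s^T c(v, ξ_v, π¹, π²) dv + λ g(T, ξ_T))` of a path. -/
def expCost (T lam s : ℝ) (ω : ℕ → (ℝ × S) ⊕ Unit) : ℝ :=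
  Real.exp (lam * (∫ v in s..T, M.pathCost π₁ π₂ ω v) +
    lam * (M.state ω T).elim 0 fun x => M.g T x)

/-- The risk-sensitive cost `J^{π¹,π²}(s, x)` on the horizon `[s, T]`. -/
def riskCost (T lam s : ℝ) (x : S) : ℝ :=
  ∫ ω, M.expCost π₁ π₂ T lam s ω ∂(M.law π₁ π₂ s x)

/-- `J^{π¹,π²}(s, x)` is well defined: almost surely the process has not exploded up to time `T`
and its running cost is integrable on `[s, T]`, and the exponential cost has a finite mean. -/
def CostWellDefined (T lam s : ℝ) (x : S) : Prop :=
  (∀ᵐ ω ∂(M.law π₁ π₂ s x), (∀ t ∈ Icc s T, (M.state ω t).isSome) ∧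
    IntervalIntegrable (M.pathCost π₁ π₂ ω) volume s T) ∧
  Integrable (M.expCost π₁ π₂ T lam s) (M.law π₁ π₂ s x)

end Cost

/-! ### Standing assumptions -/

section Assumptions

variable {S A B : Type*} [TopologicalSpace S] [MeasurableSpace S]
  [MeasurableSpace A] [MeasurableSpace B] (M : Game S A B)

/-- The drift and growth condition on the transition rates and the costs, with weight `V`. -/
structure DriftCondition (T : ℝ) (V : S → ℝ) : Prop where
  measurable : Measurable V
  one_le : ∀ x, 1 ≤ V x
  drift : ∃ ρ b : ℝ, 0 ≤ ρ ∧ 0 ≤ b ∧ ∀ s x a c, (s, x, a, c) ∈ M.K → ∀ t, 0 ≤ t →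
    (M.q s x a c).Integrable (fun y => V (M.flow y t)) ∧
    ∫ᵛ y, V (M.flow y t) ∂<•(M.q s x a c) ≤ ρ * V (M.flow x t) + b
  exhaustion : ∃ Sn : ℕ → Set S, (∀ n, MeasurableSet (Sn n)) ∧ Monotone Sn ∧
    (⋃ n, Sn n) = univ ∧
    (∀ n, ∃ C : ℝ, ∀ t x a b, (t, x, a, b) ∈ M.K → x ∈ Sn n → - M.q t x a b {x} ≤ C) ∧
    ∀ t, 0 ≤ t → ∀ C : ℝ, ∃ N, ∀ n, N ≤ n → ∀ x, x ∉ Sn n → C ≤ V (M.flow x t)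
  cost : ∃ M₂ : ℝ, 1 ≤ M₂ ∧ ∀ t x a b, (t, x, a, b) ∈ M.K → t ≤ T →
    Real.exp (2 * (T + 1) * |M.c t x a b|) ≤ M₂ * V (M.flow x (T - t)) ∧
    Real.exp (2 * (T + 1) * |M.g t x|) ≤ M₂ * V (M.flow x (T - t))

/-- The condition relating the weight `V`, the transition rates and the second weight `V₁`. -/
structure SecondDriftCondition (T : ℝ) (V V₁ : S → ℝ) : Prop where
  measurable : Measurable V₁
  one_le : ∀ x, 1 ≤ V₁ x
  rate_le : ∃ κ : ℝ, 0 < κ ∧ ∀ s x a b, (s, x, a, b) ∈ M.K → s ≤ T →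
    - M.q s x a b {x} ≤ κ * V (M.flow x (T - s))
  sq_le : ∃ M₃ : ℝ, 1 ≤ M₃ ∧ ∀ x, V x ^ 2 ≤ M₃ * V₁ x
  drift : ∃ ρ b : ℝ, 0 < ρ ∧ 0 < b ∧ ∀ s x a c, (s, x, a, c) ∈ M.K → s ≤ T →
    ∀ t ∈ Icc 0 (T - s),
    (M.q s x a c).Integrable (fun y => V₁ (M.flow y t) ^ 2) ∧
    ∫ᵛ y, V₁ (M.flow y t) ^ 2 ∂<•(M.q s x a c) ≤ ρ * V₁ (M.flow x t) ^ 2 + b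

end Assumptions

/-! ### Function spaces and the differential equation -/

section Equation

variable {S A B : Type*} [TopologicalSpace S] [MeasurableSpace S]
  [MeasurableSpace A] [MeasurableSpace B] (M : Game S A B)

/-- `P` holds along every flow line in `[0, T] × S`, except for a Lebesgue null set of times which
may depend on the flow line. -/
def AEFlow (T : ℝ) (P : ℝ → S → Prop) : Prop :=
  ∀ s ∈ Icc 0 T, ∀ x, ∀ᵐ t ∂(volume.restrict (Icc 0 (T - s))), P (s + t) (M.flow x t)

/-- The derivative along the flow,
`L^φ u (s, x) = lim_{h → 0} (u(s + h, φ(x, h)) - u(s, x)) / h`, with an arbitrary value where the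
limit does not exist. -/
def Lflow (u : ℝ → S → ℝ) (s : ℝ) (x : S) : ℝ :=
  deriv (fun h => u (s + h) (M.flow x h)) 0

/-- The functions on `[0, T] × S` that are measurable, `W`-bounded, and absolutely continuous
along the flow lines. (Values outside `[0, T] × S` are irrelevant.) -/
structure MemBac (T : ℝ) (W : S → ℝ) (u : ℝ → S → ℝ) : Prop where
  measurable : Measurable fun p : Icc (0 : ℝ) T × S => u p.1 p.2
  bounded : ∃ C : ℝ, ∀ t ∈ Icc 0 T, ∀ x, |u t x| ≤ C * W (M.flow x (T - t))
  absCont : ∀ s ∈ Icc 0 T, ∀ x,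
    AbsolutelyContinuousOnInterval (fun t => u (s + t) (M.flow x t)) 0 (T - s)

/-- The functions `u` of the previous space with weight `V` such that `L^φ u` is essentially
`V₁`-bounded. -/
structure MemBac₂ (T : ℝ) (V V₁ : S → ℝ) (u : ℝ → S → ℝ) : Prop extends M.MemBac T V u where
  derivBounded : ∃ C : ℝ, M.AEFlow T fun t x => |M.Lflow u t x| ≤ C * V₁ (M.flow x (T - t))

/-- `u` solves, along the flow lines for almost every time,
`L^φ u(t, x) + λ c(t, x, π¹, π²) u(t, x) + ∫ u(t, y) q(dy | t, x, π¹, π²) = 0`, with the terminal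
condition `u(T, x) = exp (λ g(T, x))`. -/
def IsSolution [MeasurableEq S] (π₁ : MarkovStrategy M.actA) (π₂ : MarkovStrategy M.actB)
    (T lam : ℝ) (u : ℝ → S → ℝ) : Prop :=
  (M.AEFlow T fun t x => M.Lflow u t x + lam * M.stratCost π₁ π₂ t x * u t x +
    ∫ᵛ y, u t y ∂<•(M.stratRate π₁ π₂ t x) = 0) ∧
  ∀ x, u T x = Real.exp (lam * M.g T x)

end Equation

end Game

end PDMG

end

open MeasureTheory ProbabilityTheory Set Filter Topology
open scoped ENNReal

noncomputable section

namespace PDMG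

/-! ### Signed rates as jump measures, and drift inequalities for powers of a weight -/

section JumpMeasure

variable {S : Type*} [MeasurableSpace S] [MeasurableSingletonClass S] {q : SignedMeasure S} {x : S}

/-! The motion between jumps is deterministic, and the position `M.endpoint T p` at time `T` of the
flow line through `p` is the same for all points of that line. Hence every weight `V(φ(x, T - t))`
is a constant along a flow line; this is what makes the weights of the theorem manageable.

For `p = (s, x)` put `β = λ c - r` along the line, with `r` the total jump rate, and `E(v) = exp
∫_s^v β`, which is discount times survival probability. Conditioning on the first jump gives `J(p) =
E(T) exp(λ g(T, endpoint)) + ∫_s^T E(v) ∫ J(v, y) m(dy) dv`, with `m` the jump measure at the point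
of the line at time `v`. Since a signed rate is its jump measure minus `r` times a Dirac mass, this
is the variation of constants form (`IsMild`) of the differential equation. A `V`-bounded mild
solution is absolutely continuous along the lines and solves the equation (`IsMild.memBac₂`,
`IsMild.isSolution`), and conversely a solution in the class is mild (`IsSolution.isMild`). It
remains to show that `J` is well defined, `V`-bounded and mild, and that mild solutions are unique.

Bounds come from the barrier `exp(a (T - t)) w ^ (p₀ + c₁ (T - t))`, `w` being the weight at the
endpoint. A drift inequality for a weight passes to its powers with exponent at most one, and the
growing exponent pays for a cost rate of size `c₀ + c₁ log w`; so the barrier is a supersolution of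
the first-jump equation (`LineBounds.barrier_supersolution`). The cost assumption yields `c₁ = 1 /
(2 (T + 1))` and a terminal cost of order `V ^ (1/2)`, so that the exponent runs from `1/2` to less
than `1` and `J ≤ C V` follows by induction on the number of jumps.

The comparison principle `LineBounds.eq_zero_of_le_jumpOp` says that a subsolution `w` of the
homogeneous equation vanishes if it is `o(H)` for large `V`, for some supersolution `H`. The
positive part of `w - ε H` lives where `V` is bounded; there the jump rate is bounded as well, and
iterating over `n` jumps produces a factor `1 / n!`. It is used twice. With `λ = 0` and `H` a
multiple of `V`, it shows that time `T` is almost surely passed after finitely many jumps. With `H ≥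
V₁ ≥ V² / M₃`, it shows that two mild solutions, whose difference is at most `C V`, coincide.

On the probabilistic side, the law of the embedded chain satisfies the Markov property at its first
step (`chainLaw_eq_bind`), and the exponential cost is almost surely the limit of recursively
defined discounted sums over the jumps (`pathSum`). Monotone convergence then turns the Markov
property into the first-jump equation. -/

theorem jumpMeasure_le_variation (h : IsRate q x) : jumpMeasure q x h ≤ q.variation := by
  refine Measure.le_iff.2 fun D hD => ?_
  rw [jumpMeasure_apply h hD]
  calc ENNReal.ofReal (q (D \ {x})) ≤ ‖q (D \ {x})‖ₑ := Real.ofReal_le_enorm _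
    _ ≤ q.variation (D \ {x}) := VectorMeasure.enorm_measure_le_variation _ _
    _ ≤ q.variation D := measure_mono sdiff_subset

theorem IsRate.rate_nonneg (h : IsRate q x) : 0 ≤ - q {x} := by
  rw [← h.apply_compl]
  exact h.nonneg _ (measurableSet_singleton x).compl (by simp)

theorem jumpMeasure_univ (h : IsRate q x) : jumpMeasure q x h univ = ENNReal.ofReal (- q {x}) := by
  rw [jumpMeasure_apply h MeasurableSet.univ, ← compl_eq_univ_sdiff, h.apply_compl]

theorem IsRate.eq_toSignedMeasure_sub (h : IsRate q x) :
    q = (jumpMeasure q x h).toSignedMeasure -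
      (- q {x}) • (Measure.dirac x).toSignedMeasure := by
  ext D hD
  rw [h.eq_sub hD]
  simp [Measure.toSignedMeasure_apply_measurable hD]

theorem IsRate.integral_eq (h : IsRate q x) {u : S → ℝ} (hu : Integrable u (jumpMeasure q x h)) :
    ∫ᵛ y, u y ∂<•q = ∫ y, u y ∂(jumpMeasure q x h) - (- q {x}) * u x := by
  conv_lhs => rw [h.eq_toSignedMeasure_sub]
  have h1 : (jumpMeasure q x h).toSignedMeasure.Integrable u := by
    simpa [VectorMeasure.Integrable] using hu
  have h2 : (Measure.dirac x).toSignedMeasure.Integrable u := by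
    simpa [VectorMeasure.Integrable] using integrable_dirac (by simp)
  rw [VectorMeasure.integral_sub_vectorMeasure h1 (h2.smul_vectorMeasure _),
    VectorMeasure.integral_smul_vectorMeasure]
  simp

/-- Passing from the signed rate to its jump measure puts back the mass removed at `x`, whence the
additional term, total rate times `u x`. -/
theorem IsRate.lintegral_le (h : IsRate q x) {u : S → ℝ} (hu0 : ∀ y, 0 ≤ u y)
    (hu : q.Integrable u) {d : ℝ} (hd : ∫ᵛ y, u y ∂<•q ≤ d) (hd0 : 0 ≤ d) :
    ∫⁻ y, ENNReal.ofReal (u y) ∂(jumpMeasure q x h) ≤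
      ENNReal.ofReal d + jumpMeasure q x h univ * ENNReal.ofReal (u x) := by
  -- Integrability for a signed measure means integrability for its variation, which dominates the
  -- jump measure.
  have h1 : Integrable u (jumpMeasure q x h) := hu.mono_measure (jumpMeasure_le_variation h)
  rw [← ofReal_integral_eq_lintegral_ofReal h1 (ae_of_all _ hu0), jumpMeasure_univ,
    ← ENNReal.ofReal_mul h.rate_nonneg, ← ENNReal.ofReal_add hd0
      (mul_nonneg h.rate_nonneg (hu0 x))]
  rw [h.integral_eq h1] at hd
  exact ENNReal.ofReal_le_ofReal (by linarith)

/-- A drift inequality for `u` passes to its powers with exponent at most one. -/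
theorem lintegral_rpow_le_of_drift {S : Type*} [MeasurableSpace S] {μ : Measure S} {u : S → ℝ}
    (hu : Measurable u)
    (hu1 : ∀ y, 1 ≤ u y) {w ρ b p : ℝ} (hw : 1 ≤ w) (hρ : 0 ≤ ρ) (hb : 0 ≤ b) (hp0 : 0 ≤ p)
    (hp1 : p ≤ 1) (hd : ∫⁻ y, ENNReal.ofReal (u y) ∂μ ≤
      ENNReal.ofReal (ρ * w + b) + μ univ * ENNReal.ofReal w) :
    ∫⁻ y, ENNReal.ofReal (u y ^ p) ∂μ ≤
      (ENNReal.ofReal (ρ + b) + μ univ) * ENNReal.ofReal (w ^ p) := by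
  have hw0 : 0 < w := by linarith
  -- The concave function `r ↦ r ^ p` lies below its tangent at `w`. The slope is chosen so that the
  -- coefficient of `μ univ` becomes exactly `w ^ p`.
  have hpt : ∀ y, u y ^ p ≤ (1 - p) * w ^ p + p * w ^ (p - 1) * u y := by
    intro y
    have h0 : 0 < u y := by linarith [hu1 y]
    have h1 := Real.geom_mean_le_arith_mean2_weighted hp0 (by linarith : 0 ≤ 1 - p) h0.le hw0.le
      (by ring)
    have h2 : u y ^ p = w ^ (p - 1) * (u y ^ p * w ^ (1 - p)) := by
      rw [mul_left_comm, ← Real.rpow_add hw0]; simp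
    have h3 : w ^ p = w ^ (p - 1) * w := by
      rw [Real.rpow_sub_one hw0.ne']; field_simp
    rw [h2, h3]
    calc w ^ (p - 1) * (u y ^ p * w ^ (1 - p)) ≤ w ^ (p - 1) * (p * u y + (1 - p) * w) := by
          gcongr
      _ = _ := by ring
  have hA : 0 ≤ (1 - p) * w ^ p := mul_nonneg (by linarith) (by positivity)
  have hB : 0 ≤ p * w ^ (p - 1) := by positivity
  calc ∫⁻ y, ENNReal.ofReal (u y ^ p) ∂μ
      ≤ ∫⁻ y, (ENNReal.ofReal ((1 - p) * w ^ p) +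
          ENNReal.ofReal (p * w ^ (p - 1)) * ENNReal.ofReal (u y)) ∂μ := by
        refine lintegral_mono fun y => ?_
        rw [← ENNReal.ofReal_mul hB, ← ENNReal.ofReal_add hA
          (mul_nonneg hB (by linarith [hu1 y]))]
        exact ENNReal.ofReal_le_ofReal (hpt y)
    _ = ENNReal.ofReal ((1 - p) * w ^ p) * μ univ +
          ENNReal.ofReal (p * w ^ (p - 1)) * ∫⁻ y, ENNReal.ofReal (u y) ∂μ := by
        rw [lintegral_add_left measurable_const, lintegral_const,
          lintegral_const_mul _ (by fun_prop)]
    _ ≤ ENNReal.ofReal ((1 - p) * w ^ p) * μ univ +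
          ENNReal.ofReal (p * w ^ (p - 1)) *
            (ENNReal.ofReal (ρ * w + b) + μ univ * ENNReal.ofReal w) := by gcongr
    _ = ENNReal.ofReal (p * w ^ (p - 1) * (ρ * w + b)) +
          ENNReal.ofReal ((1 - p) * w ^ p + p * w ^ (p - 1) * w) * μ univ := by
        rw [ENNReal.ofReal_mul hB, ENNReal.ofReal_add hA (by positivity),
          ENNReal.ofReal_mul hB]
        ring
    _ ≤ ENNReal.ofReal ((ρ + b) * w ^ p) + ENNReal.ofReal (w ^ p) * μ univ := by
        have h3 : w ^ p = w ^ (p - 1) * w := by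
          rw [Real.rpow_sub_one hw0.ne']; field_simp
        have h4 : 0 < w ^ (p - 1) := by positivity
        refine add_le_add (ENNReal.ofReal_le_ofReal ?_)
          (mul_le_mul_left (ENNReal.ofReal_le_ofReal ?_) _)
        · rw [h3]
          have : p * (ρ * w + b) ≤ (ρ + b) * w := by
            calc p * (ρ * w + b) ≤ 1 * (ρ * w + b) := by gcongr
              _ ≤ (ρ + b) * w := by nlinarith
          calc p * w ^ (p - 1) * (ρ * w + b) = w ^ (p - 1) * (p * (ρ * w + b)) := by ring
            _ ≤ w ^ (p - 1) * ((ρ + b) * w) := by gcongr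
            _ = _ := by ring
        · rw [h3]; exact le_of_eq (by ring)
    _ = _ := by rw [ENNReal.ofReal_mul (by positivity)]; ring

end JumpMeasure

namespace Game

/-! ### Rates and costs under randomized strategies -/

section MixedRates

variable {S A B : Type*} [TopologicalSpace S] [MeasurableSpace S]
  [MeasurableSpace A] [MeasurableSpace B] (M : Game S A B)

theorem isRate_q {k : ℝ × S × A × B} (hk : k ∈ M.K) :
    IsRate (M.q k.1 k.2.1 k.2.2.1 k.2.2.2) k.2.1 :=
  ⟨M.q_nonneg _ _ _ _ hk, M.q_conservative _ _ _ _ hk⟩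

section
variable [MeasurableSingletonClass S]

open Classical in
/-- The jump measure at an admissible quadruple, extended by zero. -/
def pureJump (k : ℝ × S × A × B) : Measure S :=
  if h : k ∈ M.K then jumpMeasure _ _ (M.isRate_q h) else 0

theorem pureJump_apply (k : ℝ × S × A × B) {D : Set S} (hD : MeasurableSet D) :
    M.pureJump k D = ENNReal.ofReal (M.qAt (D \ {k.2.1}) k) := by
  unfold pureJump qAt
  split_ifs with h
  · rw [jumpMeasure_apply _ hD, indicator_of_mem h]
  · simp [indicator_of_notMem h]

theorem qAt_diff_nonneg (k : ℝ × S × A × B) {D : Set S} (hD : MeasurableSet D) :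
    0 ≤ M.qAt (D \ {k.2.1}) k :=
  indicator_apply_nonneg fun hk => M.q_nonneg _ _ _ _ hk _ (hD.diff (measurableSet_singleton _))
    fun hx => hx.2 rfl

theorem measurable_pureJump_section (t : ℝ) (x : S) :
    Measurable fun p : A × B => M.pureJump (t, x, p.1, p.2) := by
  refine Measure.measurable_of_measurable_coe _ fun D hD => ?_
  simp only [M.pureJump_apply _ hD]
  exact ENNReal.measurable_ofReal.comp
    ((M.measurable_qAt (hD.diff (measurableSet_singleton x))).comp (by fun_prop))

end

theorem measurable_terminal {T : ℝ} (hT : 0 ≤ T) : Measurable (M.g T) :=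
  M.measurable_g.comp (g := fun p : Ici (0 : ℝ) × S => M.g p.1 p.2)
    (f := fun x => ((⟨T, hT⟩ : Ici (0 : ℝ)), x)) (by fun_prop)

variable (π₁ : MarkovStrategy M.actA) (π₂ : MarkovStrategy M.actB)

/-- All conditions of the model hold on `K` only; both strategies are carried by admissible actions,
so the zero extensions in `qAt` and `mixedCost` are invisible at nonnegative times. -/
theorem ae_mem_K {t : ℝ} (ht : 0 ≤ t) (x : S) :
    ∀ᵐ p ∂((π₁.kernel (t, x)).prod (π₂.kernel (t, x))), (t, x, p.1, p.2) ∈ M.K := by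
  have h1 : ∀ᵐ a ∂(π₁.kernel (t, x)), a ∈ M.actA t x :=
    (mem_ae_iff_prob_eq_one (M.measurableSet_actA t x ht)).2 (π₁.carried t x ht)
  have h2 : ∀ᵐ b ∂(π₂.kernel (t, x)), b ∈ M.actB t x :=
    (mem_ae_iff_prob_eq_one (M.measurableSet_actB t x ht)).2 (π₂.carried t x ht)
  filter_upwards [Measure.quasiMeasurePreserving_fst.ae h1,
    Measure.quasiMeasurePreserving_snd.ae h2] with p hp1 hp2
  exact ⟨ht, hp1, hp2⟩

theorem exists_mem_K (π₁ : MarkovStrategy M.actA) (π₂ : MarkovStrategy M.actB) {t : ℝ}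
    (ht : 0 ≤ t) (x : S) : ∃ a b, (t, x, a, b) ∈ M.K := by
  obtain ⟨p, hp⟩ := (M.ae_mem_K π₁ π₂ ht x).exists
  exact ⟨p.1, p.2, hp⟩

theorem measurable_stratCost : Measurable fun p : ℝ × S => M.stratCost π₁ π₂ p.1 p.2 := by
  have hc : Measurable (M.K.indicator fun k => M.c k.1 k.2.1 k.2.2.1 k.2.2.2) := by
    refine measurable_of_restrict_of_restrict_compl M.measurableSet_adm ?_ ?_
    · have : M.K.domRestrict (M.K.indicator fun k => M.c k.1 k.2.1 k.2.2.1 k.2.2.2) =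
          fun k : M.K => M.c k.1.1 k.1.2.1 k.1.2.2.1 k.1.2.2.2 := by
        ext k; simp [k.2]
      rw [this]; exact M.measurable_c
    · have : M.Kᶜ.domRestrict (M.K.indicator fun k => M.c k.1 k.2.1 k.2.2.1 k.2.2.2) =
          fun _ => 0 := by
        ext k; exact indicator_of_notMem k.2 _
      rw [this]; exact measurable_const
  have h : StronglyMeasurable fun z : (ℝ × S) × A × B =>
      M.K.indicator (fun k => M.c k.1 k.2.1 k.2.2.1 k.2.2.2) (z.1.1, z.1.2, z.2.1, z.2.2) :=
    (hc.comp (by fun_prop)).stronglyMeasurable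
  have := (h.integral_kernel_prod_right (κ := π₁.kernel ×ₖ π₂.kernel)
    (f := fun p y => M.K.indicator (fun k => M.c k.1 k.2.1 k.2.2.1 k.2.2.2)
      (p.1, p.2, y.1, y.2))).measurable
  simpa only [Kernel.prod_apply, stratCost, mixedCost] using this

theorem abs_stratCost_le {t : ℝ} (ht : 0 ≤ t) (x : S) {C : ℝ}
    (hC : ∀ a b, (t, x, a, b) ∈ M.K → |M.c t x a b| ≤ C) : |M.stratCost π₁ π₂ t x| ≤ C := by
  have h : ∀ᵐ p ∂((π₁.kernel (t, x)).prod (π₂.kernel (t, x))),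
      ‖M.K.indicator (fun k => M.c k.1 k.2.1 k.2.2.1 k.2.2.2) (t, x, p.1, p.2)‖ ≤ C := by
    filter_upwards [M.ae_mem_K π₁ π₂ ht x] with p hp
    rw [indicator_of_mem hp]
    exact hC _ _ hp
  simpa using! norm_integral_le_of_norm_le_const h

variable [MeasurableEq S]

/-- As a mixture of the jump measures of pure actions, the jump kernel inherits by integration every
linear bound that holds for all admissible actions. -/
theorem jumpKernel_eq_bind (t : ℝ) (x : S) :
    M.jumpKernel π₁ π₂ (t, x) = ((π₁.kernel (t, x)).prod (π₂.kernel (t, x))).bind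
      fun p => M.pureJump (t, x, p.1, p.2) := by
  ext D hD
  rw [Measure.bind_apply hD (M.measurable_pureJump_section t x).aemeasurable,
    jumpKernel_apply _ _ _ _ _ hD]
  simp only [M.pureJump_apply _ hD]
  rw [← ofReal_integral_eq_lintegral_ofReal
    (M.integrable_qAt t x (hD.diff (measurableSet_singleton x)) _ _)
    (ae_of_all _ fun p => M.qAt_diff_nonneg (t, x, p.1, p.2) hD)]
  rfl

theorem lintegral_jumpKernel (t : ℝ) (x : S) {f : S → ℝ≥0∞} (hf : Measurable f) :
    ∫⁻ y, f y ∂(M.jumpKernel π₁ π₂ (t, x)) =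
      ∫⁻ p, ∫⁻ y, f y ∂(M.pureJump (t, x, p.1, p.2))
        ∂((π₁.kernel (t, x)).prod (π₂.kernel (t, x))) := by
  rw [jumpKernel_eq_bind, Measure.lintegral_bind (M.measurable_pureJump_section t x).aemeasurable
    hf.aemeasurable]

theorem jumpKernel_univ (t : ℝ) (x : S) :
    M.jumpKernel π₁ π₂ (t, x) univ = ∫⁻ p, M.pureJump (t, x, p.1, p.2) univ
        ∂((π₁.kernel (t, x)).prod (π₂.kernel (t, x))) := by
  have := M.lintegral_jumpKernel π₁ π₂ t x (f := fun _ => 1) measurable_const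
  simpa using this

/-- The total jump rate under the strategies. -/
def rate (t : ℝ) (x : S) : ℝ := (M.jumpKernel π₁ π₂ (t, x)).real univ

theorem rate_nonneg (t : ℝ) (x : S) : 0 ≤ M.rate π₁ π₂ t x := measureReal_nonneg

theorem ofReal_rate (t : ℝ) (x : S) :
    ENNReal.ofReal (M.rate π₁ π₂ t x) = M.jumpKernel π₁ π₂ (t, x) univ := by
  simp [rate]

theorem measurable_rate : Measurable fun p : ℝ × S => M.rate π₁ π₂ p.1 p.2 :=
  ((M.jumpKernel π₁ π₂).measurable_coe MeasurableSet.univ).ennreal_toReal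

/-- From here on the signed rate is replaced by a positive kernel and a killing term `rate * u`. -/
theorem integral_stratRate {t : ℝ} {x : S} {u : S → ℝ}
    (hu : Integrable u (M.jumpKernel π₁ π₂ (t, x))) :
    ∫ᵛ y, u y ∂<•(M.stratRate π₁ π₂ t x) =
      ∫ y, u y ∂(M.jumpKernel π₁ π₂ (t, x)) - M.rate π₁ π₂ t x * u x := by
  have h := M.isRate_stratRate π₁ π₂ t x
  have h1 : M.rate π₁ π₂ t x = - M.stratRate π₁ π₂ t x {x} := by
    change (jumpMeasure _ _ h).real univ = _
    rw [measureReal_def, jumpMeasure_univ, ENNReal.toReal_ofReal h.rate_nonneg]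
  rw [h1]
  exact h.integral_eq hu

theorem jumpKernel_univ_le {t : ℝ} (ht : 0 ≤ t) (x : S) {C : ℝ}
    (hC : ∀ a b, (t, x, a, b) ∈ M.K → - M.q t x a b {x} ≤ C) :
    M.jumpKernel π₁ π₂ (t, x) univ ≤ ENNReal.ofReal C := by
  rw [jumpKernel_univ]
  refine (lintegral_mono_ae (g := fun _ => ENNReal.ofReal C) ?_).trans_eq (by simp)
  filter_upwards [M.ae_mem_K π₁ π₂ ht x] with p hp
  rw [pureJump, dif_pos hp, jumpMeasure_univ]
  exact ENNReal.ofReal_le_ofReal (hC _ _ hp)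

theorem lintegral_jumpKernel_le {t : ℝ} (ht : 0 ≤ t) (x : S) {u : S → ℝ} (hum : Measurable u)
    (hu0 : ∀ y, 0 ≤ u y) {d : ℝ} (hd0 : 0 ≤ d)
    (hd : ∀ a b, (t, x, a, b) ∈ M.K → (M.q t x a b).Integrable u ∧
      ∫ᵛ y, u y ∂<•(M.q t x a b) ≤ d) :
    ∫⁻ y, ENNReal.ofReal (u y) ∂(M.jumpKernel π₁ π₂ (t, x)) ≤
      ENNReal.ofReal d + M.jumpKernel π₁ π₂ (t, x) univ * ENNReal.ofReal (u x) := by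
  rw [lintegral_jumpKernel _ _ _ _ _ (by fun_prop), jumpKernel_univ]
  have hm : Measurable fun p : A × B => M.pureJump (t, x, p.1, p.2) univ :=
    (Measure.measurable_coe MeasurableSet.univ).comp (M.measurable_pureJump_section t x)
  calc _ ≤ ∫⁻ p, (ENNReal.ofReal d + M.pureJump (t, x, p.1, p.2) univ * ENNReal.ofReal (u x))
        ∂((π₁.kernel (t, x)).prod (π₂.kernel (t, x))) := by
        refine lintegral_mono_ae ?_
        filter_upwards [M.ae_mem_K π₁ π₂ ht x] with p hp
        rw [pureJump, dif_pos hp]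
        exact (M.isRate_q hp).lintegral_le hu0 (hd _ _ hp).1 (hd _ _ hp).2 hd0
    _ = _ := by
        rw [lintegral_add_left measurable_const, lintegral_mul_const _ hm]
        simp

end MixedRates

end Game

end PDMG

end

noncomputable section

namespace PDMG

/-! ### Variation of constants for absolutely continuous functions -/

section AbsolutelyContinuous

variable {f g β k : ℝ → ℝ} {a b : ℝ}

theorem absolutelyContinuousOnInterval_congr (hf : AbsolutelyContinuousOnInterval f a b)
    (hfg : ∀ t ∈ uIcc a b, g t = f t) : AbsolutelyContinuousOnInterval g a b := by
  rw [absolutelyContinuousOnInterval_iff] at hf ⊢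
  intro ε hε
  obtain ⟨δ, hδ, h⟩ := hf ε hε
  refine ⟨δ, hδ, fun E hE hlt => ?_⟩
  refine lt_of_eq_of_lt (Finset.sum_congr rfl fun i hi => ?_) (h E hE hlt)
  rw [hfg _ (hE.1 i hi).1, hfg _ (hE.1 i hi).2]

/-- An absolutely continuous function is bounded on the interval, and `exp` is Lipschitz below any
bound. -/
theorem absolutelyContinuousOnInterval_exp (hf : AbsolutelyContinuousOnInterval f a b) :
    AbsolutelyContinuousOnInterval (fun t => Real.exp (f t)) a b := by
  obtain ⟨C, hC⟩ := hf.exists_bound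
  have key : ∀ x ∈ uIcc a b, ∀ y ∈ uIcc a b,
      dist (Real.exp (f x)) (Real.exp (f y)) ≤ Real.exp C * dist (f x) (f y) := by
    have h1 : ∀ x ∈ uIcc a b, ∀ y, Real.exp (f x) - Real.exp (f y) ≤
        Real.exp C * |f x - f y| := by
      intro x hx y
      have h2 : Real.exp (f y) = Real.exp (f x) * Real.exp (f y - f x) := by
        rw [← Real.exp_add]; congr 1; ring
      have h3 := Real.add_one_le_exp (f y - f x)
      have h4 : Real.exp (f x) ≤ Real.exp C := Real.exp_le_exp.2 ((le_abs_self _).trans (hC x hx))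
      calc Real.exp (f x) - Real.exp (f y) = Real.exp (f x) * (1 - Real.exp (f y - f x)) := by
            rw [h2]; ring
        _ ≤ Real.exp (f x) * |f x - f y| := by
            gcongr
            linarith [le_abs_self (f x - f y)]
        _ ≤ _ := by gcongr
    intro x hx y hy
    rw [Real.dist_eq, Real.dist_eq, abs_le]
    constructor
    · have := h1 y hy x
      rw [abs_sub_comm] at this
      linarith
    · exact h1 x hx y
  rw [absolutelyContinuousOnInterval_iff] at hf ⊢
  intro ε hε
  obtain ⟨δ, hδ, h⟩ := hf (ε / Real.exp C) (by positivity)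
  refine ⟨δ, hδ, fun E hE hlt => ?_⟩
  calc _ ≤ ∑ i ∈ Finset.range E.1, Real.exp C * dist (f (E.2 i).1) (f (E.2 i).2) :=
        Finset.sum_le_sum fun i hi => key _ (hE.1 i hi).1 _ (hE.1 i hi).2
    _ = Real.exp C * ∑ i ∈ Finset.range E.1, dist (f (E.2 i).1) (f (E.2 i).2) := by
        rw [Finset.mul_sum]
    _ < Real.exp C * (ε / Real.exp C) := by
        gcongr
        exact h E hE hlt
    _ = ε := by field_simp

theorem absolutelyContinuousOnInterval_comp_add (hf : AbsolutelyContinuousOnInterval f a b)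
    (c : ℝ) : AbsolutelyContinuousOnInterval (fun t => f (c + t)) (a - c) (b - c) := by
  rw [absolutelyContinuousOnInterval_iff] at hf ⊢
  intro ε hε
  obtain ⟨δ, hδ, h⟩ := hf ε hε
  refine ⟨δ, hδ, fun E hE hlt => ?_⟩
  refine h (E.1, fun i => (c + (E.2 i).1, c + (E.2 i).2)) ⟨fun i hi => ?_, ?_⟩ (by simpa using hlt)
  · have h1 := hE.1 i hi
    simp only [mem_uIcc] at h1 ⊢
    grind
  · intro i hi j hj hij
    have h2 := hE.2 hi hj hij
    simp only [Function.onFun, Set.disjoint_left, mem_uIoc] at h2 ⊢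
    intro v hv hv'
    exact @h2 (v - c) (by grind) (by grind)

/-- The exponential of the primitive of `β` that vanishes at `a`. -/
def expInt (β : ℝ → ℝ) (a t : ℝ) : ℝ := Real.exp (∫ v in a..t, β v)

theorem expInt_pos (β : ℝ → ℝ) (a t : ℝ) : 0 < expInt β a t := Real.exp_pos _

theorem expInt_self (β : ℝ → ℝ) (a : ℝ) : expInt β a a = 1 := by simp [expInt]

theorem absolutelyContinuousOnInterval_expInt (hβ : IntervalIntegrable β volume a b) :
    AbsolutelyContinuousOnInterval (expInt β a) a b :=
  absolutelyContinuousOnInterval_exp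
    (hβ.absolutelyContinuousOnInterval_intervalIntegral (by simp))

theorem ae_hasDerivAt_expInt (hβ : IntervalIntegrable β volume a b) :
    ∀ᵐ t, t ∈ uIcc a b → HasDerivAt (expInt β a) (β t * expInt β a t) t := by
  filter_upwards [hβ.ae_hasDerivAt_integral] with t ht hmem
  have := (ht hmem a (by simp)).exp
  rwa [mul_comm] at this

/-- The integrand is almost everywhere the derivative of `expInt β a`, and absolute continuity gives
the fundamental theorem of calculus for a merely integrable `β`. -/
theorem integral_mul_expInt (hβ : IntervalIntegrable β volume a b) :
    ∫ t in a..b, β t * expInt β a t = expInt β a b - 1 := by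
  rw [← expInt_self β a, ← (absolutelyContinuousOnInterval_expInt hβ).integral_deriv_eq_sub]
  refine intervalIntegral.integral_congr_ae ?_
  filter_upwards [ae_hasDerivAt_expInt hβ] with t ht hmem
  exact (ht (uIoc_subset_uIcc hmem)).deriv.symm

theorem expInt_mul_expInt {c : ℝ} (hβ : IntervalIntegrable β volume a b) (hc : c ∈ uIcc a b) :
    expInt β a c * expInt β c b = expInt β a b := by
  rw [expInt, expInt, expInt, ← Real.exp_add, intervalIntegral.integral_add_adjacent_intervals]
  · exact hβ.mono_set (uIcc_subset_uIcc_left hc)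
  · exact hβ.mono_set (uIcc_subset_uIcc_right hc)

theorem intervalIntegrable_expInt_mul (hβ : IntervalIntegrable β volume a b)
    (hk : IntervalIntegrable k volume a b) :
    IntervalIntegrable (fun t => expInt β a t * k t) volume a b :=
  hk.continuousOn_mul (absolutelyContinuousOnInterval_expInt hβ).continuousOn

theorem ae_hasDerivAt_integral_left (hk : IntervalIntegrable k volume a b) :
    ∀ᵐ t, t ∈ uIcc a b → HasDerivAt (fun x => ∫ v in x..b, k v) (- k t) t := by
  filter_upwards [hk.ae_hasDerivAt_integral] with t ht hmem
  have := (ht hmem b (by simp)).neg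
  refine this.congr_of_eventuallyEq (Eventually.of_forall fun x => ?_)
  simp [intervalIntegral.integral_symm x b]

/-- Variation of constants: a solution of the integrated equation is absolutely continuous and
solves the differential equation. -/
theorem absolutelyContinuousOnInterval_of_duhamel (hβ : IntervalIntegrable β volume a b)
    (hk : IntervalIntegrable k volume a b) (hab : a ≤ b) {c : ℝ}
    (hf : ∀ t ∈ Icc a b, expInt β a t * f t = c + ∫ v in t..b, expInt β a v * k v) :
    AbsolutelyContinuousOnInterval f a b ∧
      ∀ᵐ t, t ∈ Icc a b → HasDerivAt f (- (β t * f t + k t)) t := by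
  have hβ' : IntervalIntegrable (fun t => - β t) volume a b := hβ.neg
  have hEk := intervalIntegrable_expInt_mul hβ hk
  have hinv : ∀ t, expInt (fun t => - β t) a t * expInt β a t = 1 := by
    intro t
    rw [expInt, expInt, ← Real.exp_add, intervalIntegral.integral_neg]
    simp
  set F : ℝ → ℝ := fun t => expInt (fun t => - β t) a t *
    (c + ∫ v in t..b, expInt β a v * k v) with hF
  have hfF : ∀ t ∈ Icc a b, f t = F t := by
    intro t ht
    rw [hF]
    simp only
    rw [← hf t ht, ← mul_assoc, hinv, one_mul]
  have hI : AbsolutelyContinuousOnInterval (fun t => c + ∫ v in t..b, expInt β a v * k v) a b := by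
    have h1 : AbsolutelyContinuousOnInterval (fun _ : ℝ => c) a b :=
      (LipschitzWith.const c).lipschitzOnWith.absolutelyContinuousOnInterval
    refine absolutelyContinuousOnInterval_congr (h1.fun_sub
      (hEk.absolutelyContinuousOnInterval_intervalIntegral (c := b) (by simp))) fun t _ => ?_
    rw [intervalIntegral.integral_symm b t]
    ring
  constructor
  · refine absolutelyContinuousOnInterval_congr
      ((absolutelyContinuousOnInterval_expInt hβ').fun_mul hI) fun t ht => ?_
    rw [uIcc_of_le hab] at ht
    exact hfF t ht
  · have ha : ∀ᵐ t : ℝ, t ≠ a := by simp [ae_iff, measure_singleton]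
    have hb : ∀ᵐ t : ℝ, t ≠ b := by simp [ae_iff, measure_singleton]
    filter_upwards [ae_hasDerivAt_expInt hβ', ae_hasDerivAt_integral_left hEk, ha, hb]
      with t h1 h2 ha hb ht
    have hmem : t ∈ uIcc a b := by rwa [uIcc_of_le hab]
    have hev : f =ᶠ[𝓝 t] F := by
      filter_upwards [Ioo_mem_nhds (lt_of_le_of_ne ht.1 (Ne.symm ha)) (lt_of_le_of_ne ht.2 hb)]
        with v hv
      exact hfF v (Ioo_subset_Icc_self hv)
    refine HasDerivAt.congr_of_eventuallyEq ?_ hev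
    rw [hfF t ht]
    have h3 := (h1 hmem).mul ((h2 hmem).const_add c)
    convert! h3 using 1
    have := hinv t
    rw [hF]
    linear_combination k t * this

/-- Variation of constants: an absolutely continuous solution of the differential equation solves
the integrated equation. -/
theorem duhamel_of_ae_deriv (hβ : IntervalIntegrable β volume a b)
    (hf : AbsolutelyContinuousOnInterval f a b)
    (hd : ∀ᵐ t, t ∈ uIcc a b → deriv f t = - (β t * f t + k t)) :
    f a = expInt β a b * f b + ∫ t in a..b, expInt β a t * k t := by
  have h1 := ((absolutelyContinuousOnInterval_expInt hβ).fun_mul hf).integral_deriv_eq_sub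
  have h2 : ∫ t in a..b, deriv (fun t => expInt β a t * f t) t =
      ∫ t in a..b, - (expInt β a t * k t) := by
    refine intervalIntegral.integral_congr_ae ?_
    filter_upwards [ae_hasDerivAt_expInt hβ, hf.ae_differentiableAt, hd] with t h1 h2 h3 hmem
    have hm := uIoc_subset_uIcc hmem
    refine ((h1 hm).mul (h2 hm).hasDerivAt).deriv.trans ?_
    rw [h3 hm]
    ring
  rw [h2, intervalIntegral.integral_neg, expInt_self] at h1
  linarith

end AbsolutelyContinuous

end PDMG

end

noncomputable section

namespace PDMG

namespace Game

variable {S A B : Type*} [TopologicalSpace S] [MeasurableSpace S]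
  [MeasurableSpace A] [MeasurableSpace B] (M : Game S A B)

/-! ### Discount, survival and jump operator along flow lines -/

section FlowLines

/-- The position at time `T` of the flow line through `p = (t, x)`. -/
def endpoint (T : ℝ) (p : ℝ × S) : S := M.flow p.2 (T - p.1)

theorem measurable_endpoint (T : ℝ) : Measurable (M.endpoint T) :=
  M.measurable_flow.comp (g := fun p : S × ℝ => M.flow p.1 p.2)
    (f := fun p : ℝ × S => (p.2, T - p.1)) (by fun_prop)

/-- The flow property makes the endpoint an invariant of the flow line; all weights are therefore
constant in the integrals over time. -/
theorem endpoint_line (T : ℝ) (p : ℝ × S) (v : ℝ) :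
    M.endpoint T (v, M.flow p.2 (v - p.1)) = M.endpoint T p := by
  simp only [endpoint]
  rw [← M.flow_add]
  congr 1
  ring

variable (π₁ : MarkovStrategy M.actA) (π₂ : MarkovStrategy M.actB)

/-- The cost rate along the flow line through `p`. -/
def lineCost (p : ℝ × S) (v : ℝ) : ℝ := M.stratCost π₁ π₂ v (M.flow p.2 (v - p.1))

theorem measurable_lineCost : Measurable fun w : (ℝ × S) × ℝ => M.lineCost π₁ π₂ w.1 w.2 :=
  (M.measurable_stratCost π₁ π₂).comp (g := fun p : ℝ × S => M.stratCost π₁ π₂ p.1 p.2)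
    M.measurable_jumpPoint

theorem measurable_lineCost_right (p : ℝ × S) : Measurable (M.lineCost π₁ π₂ p) := by
  simpa only [Function.comp_def] using
    (M.measurable_lineCost π₁ π₂).comp (measurable_prodMk_left (x := p))

/-- The factor `exp (λ ∫ c)` accumulated along the flow line through `p` up to time `z`. -/
def discount (lam : ℝ) (p : ℝ × S) (z : ℝ) : ℝ≥0∞ :=
  ENNReal.ofReal (Real.exp (lam * ∫ v in Ioc p.1 z, M.lineCost π₁ π₂ p v))

theorem measurable_discount (lam : ℝ) :
    Measurable fun w : (ℝ × S) × ℝ => M.discount π₁ π₂ lam w.1 w.2 := by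
  have h1 : Measurable fun w : ((ℝ × S) × ℝ) × ℝ =>
      (Ioc w.1.1.1 w.1.2).indicator (fun v => M.lineCost π₁ π₂ w.1.1 v) w.2 := by
    have h2 : Measurable fun w : ((ℝ × S) × ℝ) × ℝ => M.lineCost π₁ π₂ w.1.1 w.2 :=
      (M.measurable_lineCost π₁ π₂).comp
        (g := fun w : (ℝ × S) × ℝ => M.lineCost π₁ π₂ w.1 w.2)
        (f := fun w : ((ℝ × S) × ℝ) × ℝ => (w.1.1, w.2)) (by fun_prop)
    have h3 : MeasurableSet {w : ((ℝ × S) × ℝ) × ℝ | w.1.1.1 < w.2 ∧ w.2 ≤ w.1.2} :=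
      (measurableSet_lt (f := fun w : ((ℝ × S) × ℝ) × ℝ => w.1.1.1) (g := fun w => w.2)
        (by fun_prop) (by fun_prop)).inter
        (measurableSet_le (f := fun w : ((ℝ × S) × ℝ) × ℝ => w.2) (g := fun w => w.1.2)
          (by fun_prop) (by fun_prop))
    exact h2.indicator h3
  have h4 : Measurable fun w : (ℝ × S) × ℝ => ∫ v in Ioc w.1.1 w.2, M.lineCost π₁ π₂ w.1 v := by
    have := (h1.stronglyMeasurable.integral_prod_right' (ν := volume)).measurable
    simpa only [integral_indicator measurableSet_Ioc] using this
  exact (Real.measurable_exp.comp (h4.const_mul lam)).ennreal_ofReal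

variable [MeasurableEq S]

/-- The jump rate along the flow line through `p`. -/
def lineRate (p : ℝ × S) (v : ℝ) : ℝ := M.rate π₁ π₂ v (M.flow p.2 (v - p.1))

theorem measurable_lineRate : Measurable fun w : (ℝ × S) × ℝ => M.lineRate π₁ π₂ w.1 w.2 :=
  by simpa only [Function.comp_def, lineRate] using
    (M.measurable_rate π₁ π₂).comp M.measurable_jumpPoint

theorem measurable_lineRate_right (p : ℝ × S) : Measurable (M.lineRate π₁ π₂ p) := by
  simpa only [Function.comp_def] using
    (M.measurable_lineRate π₁ π₂).comp (measurable_prodMk_left (x := p))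

theorem lineRate_nonneg (p : ℝ × S) (v : ℝ) : 0 ≤ M.lineRate π₁ π₂ p v := M.rate_nonneg _ _ _ _

/-- Integration of `u(z, ·)` against the jump kernel at time `z` on the flow line through `p`. -/
def lineJump (u : ℝ × S → ℝ≥0∞) (p : ℝ × S) (z : ℝ) : ℝ≥0∞ :=
  ∫⁻ y, u (z, y) ∂(M.jumpKernel π₁ π₂ (z, M.flow p.2 (z - p.1)))

theorem measurable_lineJump {u : ℝ × S → ℝ≥0∞} (hu : Measurable u) :
    Measurable fun w : (ℝ × S) × ℝ => M.lineJump π₁ π₂ u w.1 w.2 := by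
  have h : Measurable fun w : ((ℝ × S) × ℝ) × S => u (w.1.2, w.2) := hu.comp (by fun_prop)
  have := h.lintegral_kernel_prod_right' (f := fun w : ((ℝ × S) × ℝ) × S => u (w.1.2, w.2))
    (κ := (M.jumpKernel π₁ π₂).comap (fun w : (ℝ × S) × ℝ => (w.2, M.flow w.1.2 (w.2 - w.1.1)))
      M.measurable_jumpPoint)
  simpa only [Kernel.comap_apply] using! this

/-- The expectation of the discounted value of `u` at the first jump, on the event that this jump
happens up to time `T`. -/
def jumpOp (T lam : ℝ) (u : ℝ × S → ℝ≥0∞) (p : ℝ × S) : ℝ≥0∞ :=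
  ∫⁻ z in Ioc p.1 T, M.discount π₁ π₂ lam p z * M.survival π₁ π₂ p z * M.lineJump π₁ π₂ u p z

theorem measurable_lineWeight (lam : ℝ) : Measurable fun w : (ℝ × S) × ℝ =>
    M.discount π₁ π₂ lam w.1 w.2 * M.survival π₁ π₂ w.1 w.2 :=
  (M.measurable_discount π₁ π₂ lam).mul (M.measurable_survival π₁ π₂)

theorem measurable_jumpOp_integrand (lam : ℝ) {v : ℝ × S → ℝ≥0∞} (hv : Measurable v)
    (p : ℝ × S) : Measurable fun z => M.discount π₁ π₂ lam p z * M.survival π₁ π₂ p z *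
      M.lineJump π₁ π₂ v p z :=
  Measurable.comp (g := fun w : (ℝ × S) × ℝ => M.discount π₁ π₂ lam w.1 w.2 *
      M.survival π₁ π₂ w.1 w.2 * M.lineJump π₁ π₂ v w.1 w.2) (f := fun z => (p, z))
    ((M.measurable_lineWeight π₁ π₂ lam).mul (M.measurable_lineJump π₁ π₂ hv))
    measurable_prodMk_left

theorem jumpOp_mono {T lam : ℝ} {u v : ℝ × S → ℝ≥0∞} {p : ℝ × S}
    (h : ∀ z ∈ Ioc p.1 T, ∀ y, u (z, y) ≤ v (z, y)) :
    M.jumpOp π₁ π₂ T lam u p ≤ M.jumpOp π₁ π₂ T lam v p := by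
  refine setLIntegral_mono' measurableSet_Ioc fun z hz => ?_
  gcongr
  exact lintegral_mono fun y => h z hz y

/-- One measurable summand suffices for additivity. This lets the comparison principle treat
subsolutions without a measurability assumption. -/
theorem jumpOp_add {T lam : ℝ} (u : ℝ × S → ℝ≥0∞) {v : ℝ × S → ℝ≥0∞} (hv : Measurable v)
    (p : ℝ × S) : M.jumpOp π₁ π₂ T lam (fun q => u q + v q) p =
      M.jumpOp π₁ π₂ T lam u p + M.jumpOp π₁ π₂ T lam v p := by
  have hm := M.measurable_jumpOp_integrand π₁ π₂ lam hv p
  rw [jumpOp, jumpOp, jumpOp, ← lintegral_add_right _ hm]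
  refine lintegral_congr fun z => ?_
  rw [lineJump, lineJump, lineJump,
    lintegral_add_right _ (g := fun y => v (z, y)) (hv.comp measurable_prodMk_left), mul_add]

theorem jumpOp_const_mul {T lam : ℝ} {v : ℝ × S → ℝ≥0∞} (hv : Measurable v) (c : ℝ≥0∞)
    (p : ℝ × S) : M.jumpOp π₁ π₂ T lam (fun q => c * v q) p =
      c * M.jumpOp π₁ π₂ T lam v p := by
  have hm := M.measurable_jumpOp_integrand π₁ π₂ lam hv p
  rw [jumpOp, jumpOp, ← lintegral_const_mul _ hm]
  refine lintegral_congr fun z => ?_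
  rw [lineJump, lineJump,
    lintegral_const_mul _ (f := fun y => v (z, y)) (hv.comp measurable_prodMk_left)]
  ring

/-- Bounds, in terms of the weight `V`, for the jump rate and the cost rate under the strategies. -/
structure LineBounds (T : ℝ) (V : S → ℝ) (κ k₀ k₁ : ℝ) : Prop where
  one_le : ∀ x, 1 ≤ V x
  rate_le : ∀ t ∈ Icc 0 T, ∀ x, M.rate π₁ π₂ t x ≤ κ * V (M.flow x (T - t))
  cost_le : ∀ t ∈ Icc 0 T, ∀ x,
    |M.stratCost π₁ π₂ t x| ≤ k₀ + k₁ * Real.log (V (M.flow x (T - t)))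
  const_nonneg : 0 ≤ κ ∧ 0 ≤ k₀ ∧ 0 ≤ k₁

namespace LineBounds

variable {M π₁ π₂} {T lam : ℝ} {V : S → ℝ} {κ k₀ k₁ : ℝ}

theorem lineRate_le (h : M.LineBounds π₁ π₂ T V κ k₀ k₁) (p : ℝ × S) {v : ℝ} (hv : v ∈ Icc 0 T) :
    M.lineRate π₁ π₂ p v ≤ κ * V (M.endpoint T p) := by
  have h1 := h.rate_le v hv (M.flow p.2 (v - p.1))
  have h2 : M.flow (M.flow p.2 (v - p.1)) (T - v) = M.endpoint T p := M.endpoint_line T p v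
  rwa [h2] at h1

theorem abs_lineCost_le (h : M.LineBounds π₁ π₂ T V κ k₀ k₁) (p : ℝ × S) {v : ℝ}
    (hv : v ∈ Icc 0 T) :
    |M.lineCost π₁ π₂ p v| ≤ k₀ + k₁ * Real.log (V (M.endpoint T p)) := by
  have h1 := h.cost_le v hv (M.flow p.2 (v - p.1))
  have h2 : M.flow (M.flow p.2 (v - p.1)) (T - v) = M.endpoint T p := M.endpoint_line T p v
  rwa [h2] at h1

theorem intervalIntegrable_of_bounded {f : ℝ → ℝ} {a b C : ℝ} (hf : Measurable f)
    (hC : ∀ v ∈ Icc a b, |f v| ≤ C) (hab : a ≤ b) : IntervalIntegrable f volume a b := by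
  rw [intervalIntegrable_iff_integrableOn_Ioc_of_le hab]
  exact Measure.integrableOn_of_bounded (M := C) (by simp) hf.aestronglyMeasurable
    ((ae_restrict_iff' measurableSet_Ioc).2
      (ae_of_all _ fun v hv => hC v (Ioc_subset_Icc_self hv)))

theorem intervalIntegrable_lineRate (h : M.LineBounds π₁ π₂ T V κ k₀ k₁) (p : ℝ × S) {a b : ℝ}
    (ha : 0 ≤ a) (hb : b ≤ T) (hab : a ≤ b) :
    IntervalIntegrable (M.lineRate π₁ π₂ p) volume a b := by
  refine intervalIntegrable_of_bounded (M.measurable_lineRate_right π₁ π₂ p)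
    (C := κ * V (M.endpoint T p)) (fun v hv => ?_) hab
  rw [abs_of_nonneg (M.lineRate_nonneg π₁ π₂ p v)]
  exact h.lineRate_le p ⟨ha.trans hv.1, hv.2.trans hb⟩

theorem intervalIntegrable_lineCost (h : M.LineBounds π₁ π₂ T V κ k₀ k₁) (p : ℝ × S) {a b : ℝ}
    (ha : 0 ≤ a) (hb : b ≤ T) (hab : a ≤ b) :
    IntervalIntegrable (M.lineCost π₁ π₂ p) volume a b :=
  intervalIntegrable_of_bounded
    (M.measurable_lineCost_right π₁ π₂ p)
    (fun _ hv => h.abs_lineCost_le p ⟨ha.trans hv.1, hv.2.trans hb⟩) hab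

/-- The rate is bounded along the line up to time `T`, so the exponent in the extended reals is
finite and equals an ordinary integral. -/
theorem survival_eq (h : M.LineBounds π₁ π₂ T V κ k₀ k₁) {p : ℝ × S} (hp : 0 ≤ p.1) {z : ℝ}
    (hz : z ∈ Icc p.1 T) : M.survival π₁ π₂ p z =
      ENNReal.ofReal (Real.exp (- ∫ v in p.1..z, M.lineRate π₁ π₂ p v)) := by
  have h1 : M.cumRate π₁ π₂ p z = ENNReal.ofReal (∫ v in p.1..z, M.lineRate π₁ π₂ p v) := by
    rw [intervalIntegral.integral_of_le hz.1, ofReal_integral_eq_lintegral_ofReal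
      ((intervalIntegrable_iff_integrableOn_Ioc_of_le hz.1).1
        (h.intervalIntegrable_lineRate p hp hz.2 hz.1))
      (ae_of_all _ fun v => M.lineRate_nonneg π₁ π₂ p v)]
    simp only [lineRate, ofReal_rate, cumRate]
  have h2 : 0 ≤ ∫ v in p.1..z, M.lineRate π₁ π₂ p v :=
    intervalIntegral.integral_nonneg hz.1 fun v _ => M.lineRate_nonneg π₁ π₂ p v
  rw [survival, h1, EReal.coe_ennreal_ofReal, max_eq_left h2, ← EReal.coe_neg, EReal.exp_coe]

/-- The exponential rate of the discounted survival probability. -/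
def _root_.PDMG.Game.lineExponent (M : Game S A B) (π₁ : MarkovStrategy M.actA)
    (π₂ : MarkovStrategy M.actB) (lam : ℝ) (p : ℝ × S) (v : ℝ) : ℝ :=
  lam * M.lineCost π₁ π₂ p v - M.lineRate π₁ π₂ p v

theorem intervalIntegrable_lineExponent (h : M.LineBounds π₁ π₂ T V κ k₀ k₁) (lam : ℝ)
    (p : ℝ × S) {a b : ℝ} (ha : 0 ≤ a) (hb : b ≤ T) (hab : a ≤ b) :
    IntervalIntegrable (M.lineExponent π₁ π₂ lam p) volume a b :=
  ((h.intervalIntegrable_lineCost p ha hb hab).const_mul lam).sub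
    (h.intervalIntegrable_lineRate p ha hb hab)

theorem weight_eq (h : M.LineBounds π₁ π₂ T V κ k₀ k₁) (lam : ℝ) {p : ℝ × S} (hp : 0 ≤ p.1)
    {z : ℝ} (hz : z ∈ Icc p.1 T) : M.discount π₁ π₂ lam p z * M.survival π₁ π₂ p z =
      ENNReal.ofReal (expInt (M.lineExponent π₁ π₂ lam p) p.1 z) := by
  rw [h.survival_eq hp hz, discount, ← ENNReal.ofReal_mul (Real.exp_pos _).le, ← Real.exp_add,
    expInt, ← intervalIntegral.integral_of_le hz.1]
  simp only [lineExponent]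
  rw [intervalIntegral.integral_sub
    ((h.intervalIntegrable_lineCost p hp hz.2 hz.1).const_mul lam)
    (h.intervalIntegrable_lineRate p hp hz.2 hz.1), intervalIntegral.integral_const_mul,
    sub_eq_add_neg]

end LineBounds

end FlowLines

/-! ### The barrier as a supersolution -/

section Comparison

variable (π₁ : MarkovStrategy M.actA) (π₂ : MarkovStrategy M.actB)

/-- The barrier `exp (a (T - t)) W(φ(x, T - t)) ^ (p₀ + c₁ (T - t))`. -/
def barrier (T : ℝ) (W : S → ℝ) (a p₀ c₁ : ℝ) (q : ℝ × S) : ℝ≥0∞ :=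
  ENNReal.ofReal (Real.exp (a * (T - q.1)) * W (M.endpoint T q) ^ (p₀ + c₁ * (T - q.1)))

theorem measurable_barrier (T : ℝ) {W : S → ℝ} (hW : Measurable W) (a p₀ c₁ : ℝ) :
    Measurable (M.barrier T W a p₀ c₁) := by
  have h1 : Measurable fun q : ℝ × S => W (M.endpoint T q) := hW.comp (M.measurable_endpoint T)
  exact ((by fun_prop : Measurable fun q : ℝ × S => Real.exp (a * (T - q.1))).mul
    (h1.pow (by fun_prop))).ennreal_ofReal

variable [MeasurableEq S] {M π₁ π₂} {T lam : ℝ} {V : S → ℝ} {κ k₀ k₁ : ℝ}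

/-- The barrier is a supersolution of the first-jump equation. -/
theorem LineBounds.barrier_supersolution (h : M.LineBounds π₁ π₂ T V κ k₀ k₁) {W : S → ℝ}
    (hWm : Measurable W) (hW1 : ∀ x, 1 ≤ W x) {ρ b c₀ c₁ p₀ : ℝ} (hρ : 0 ≤ ρ) (hb : 0 ≤ b)
    (hc₁ : 0 ≤ c₁) (hp₀ : 0 ≤ p₀) (hp₁ : p₀ + c₁ * T ≤ 1)
    (hd : ∀ t ∈ Icc 0 T, ∀ x, ∫⁻ y, ENNReal.ofReal (W (M.flow y (T - t)))
      ∂(M.jumpKernel π₁ π₂ (t, x)) ≤ ENNReal.ofReal (ρ * W (M.flow x (T - t)) + b) +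
        M.jumpKernel π₁ π₂ (t, x) univ * ENNReal.ofReal (W (M.flow x (T - t))))
    (hc : ∀ t ∈ Icc 0 T, ∀ x,
      lam * M.stratCost π₁ π₂ t x ≤ c₀ + c₁ * Real.log (W (M.flow x (T - t))))
    {p : ℝ × S} (hp : p.1 ∈ Icc 0 T) :
    M.discount π₁ π₂ lam p T * M.survival π₁ π₂ p T *
        ENNReal.ofReal (W (M.endpoint T p) ^ p₀) +
      M.jumpOp π₁ π₂ T lam (M.barrier T W (ρ + b + c₀) p₀ c₁) p ≤
        M.barrier T W (ρ + b + c₀) p₀ c₁ p := by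
  set a := ρ + b + c₀ with ha
  set w := W (M.endpoint T p) with hw
  have hw1 : 1 ≤ w := hW1 _
  have hw0 : 0 < w := by linarith
  set L := Real.log w with hL
  set hf : ℝ → ℝ := fun t => Real.exp (a * (T - t)) * w ^ (p₀ + c₁ * (T - t)) with hhf
  have hf_pos : ∀ t, 0 < hf t := fun t => by positivity
  -- On the line the barrier is the scalar function `hf`, with logarithmic derivative `-(a + c₁ L)`.
  -- Thus `γ` is the exponent of the discounted, killed barrier.
  set γ : ℝ → ℝ := fun v => M.lineExponent π₁ π₂ lam p v - (a + c₁ * L) with hγ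
  have hβ := h.intervalIntegrable_lineExponent lam p hp.1 le_rfl hp.2
  have hγi : IntervalIntegrable γ volume p.1 T := hβ.sub intervalIntegrable_const
  have hEh : ∀ t ∈ Icc p.1 T,
      expInt (M.lineExponent π₁ π₂ lam p) p.1 t * hf t = hf p.1 * expInt γ p.1 t := by
    intro t ht
    have hβt := h.intervalIntegrable_lineExponent lam p hp.1 ht.2 ht.1
    simp only [hhf, hγ, expInt]
    rw [intervalIntegral.integral_sub hβt intervalIntegrable_const,
      intervalIntegral.integral_const, Real.rpow_def_of_pos hw0, Real.rpow_def_of_pos hw0,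
      ← Real.exp_add, ← Real.exp_add, ← Real.exp_add, ← Real.exp_add, smul_eq_mul]
    congr 1
    ring
  have hbar : ∀ t y, M.barrier T W a p₀ c₁ (t, y) = ENNReal.ofReal (Real.exp (a * (T - t))) *
      ENNReal.ofReal (W (M.flow y (T - t)) ^ (p₀ + c₁ * (T - t))) := by
    intro t y
    rw [barrier, ENNReal.ofReal_mul (Real.exp_pos _).le]
    rfl
  have hbarp : M.barrier T W a p₀ c₁ p = ENNReal.ofReal (hf p.1) := rfl
  -- The choice `a = ρ + b + c₀` makes `c₀ + c₁ L` absorb the running cost and leaves `ρ + b` for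
  -- the drift.
  have hγle : ∀ t ∈ Icc p.1 T, M.lineRate π₁ π₂ p t + (ρ + b) ≤ - γ t := by
    intro t ht
    have h1 := hc t ⟨hp.1.trans ht.1, ht.2⟩ (M.flow p.2 (t - p.1))
    have h2 : M.flow (M.flow p.2 (t - p.1)) (T - t) = M.endpoint T p := M.endpoint_line T p t
    rw [h2] at h1
    simp only [hγ, lineExponent, lineCost]
    linarith
  -- At time `t` the exponent of the barrier lies in `[0, 1]`, so the drift inequality applies to
  -- that power of `W`.
  have hJ : ∀ t ∈ Ioc p.1 T, M.lineJump π₁ π₂ (M.barrier T W a p₀ c₁) p t ≤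
      ENNReal.ofReal ((M.lineRate π₁ π₂ p t + (ρ + b)) * hf t) := by
    intro t ht
    have ht0 : t ∈ Icc 0 T := ⟨hp.1.trans ht.1.le, ht.2⟩
    have h2 : M.flow (M.flow p.2 (t - p.1)) (T - t) = M.endpoint T p := M.endpoint_line T p t
    have hWf : Measurable fun y => W (M.flow y (T - t)) :=
      hWm.comp (M.measurable_flow.comp (g := fun p : S × ℝ => M.flow p.1 p.2)
        (f := fun y => (y, T - t)) (by fun_prop))
    have hq0 : 0 ≤ p₀ + c₁ * (T - t) := by have := ht.2; nlinarith
    have hq1 : p₀ + c₁ * (T - t) ≤ 1 := by have := ht0.1; nlinarith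
    have h3 := hd t ht0 (M.flow p.2 (t - p.1))
    rw [h2] at h3
    have h4 := lintegral_rpow_le_of_drift hWf (fun y => hW1 _) hw1 hρ hb hq0 hq1 h3
    rw [lineJump]
    simp only [hbar]
    rw [lintegral_const_mul _ (hWf.pow_const _).ennreal_ofReal]
    calc _ ≤ ENNReal.ofReal (Real.exp (a * (T - t))) *
        ((ENNReal.ofReal (ρ + b) + M.jumpKernel π₁ π₂ (t, M.flow p.2 (t - p.1)) univ) *
          ENNReal.ofReal (w ^ (p₀ + c₁ * (T - t)))) := by gcongr
      _ = _ := by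
        rw [← ofReal_rate, ← ENNReal.ofReal_add (by positivity) (M.rate_nonneg _ _ _ _),
          ← ENNReal.ofReal_mul (by have := M.rate_nonneg π₁ π₂ t (M.flow p.2 (t - p.1)); positivity),
          ← ENNReal.ofReal_mul (Real.exp_pos _).le]
        congr 1
        simp only [hhf, lineRate]
        ring
  have hγE : IntegrableOn (fun t => hf p.1 * (- γ t * expInt γ p.1 t)) (Ioc p.1 T) := by
    rw [← intervalIntegrable_iff_integrableOn_Ioc_of_le hp.2]
    refine ((intervalIntegrable_expInt_mul hγi hγi.neg).const_mul (hf p.1)).congr ?_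
    exact fun t _ => by simp [mul_comm]
  -- The upper bound for the jump integrand is an exact derivative. Its integral and the terminal
  -- term add up to `hf p.1`, the value of the barrier at `p`.
  have hint : ∫ t in Ioc p.1 T, hf p.1 * (- γ t * expInt γ p.1 t) =
      hf p.1 * (1 - expInt γ p.1 T) := by
    rw [← intervalIntegral.integral_of_le hp.2, intervalIntegral.integral_const_mul]
    have := integral_mul_expInt hγi
    simp only [neg_mul, intervalIntegral.integral_neg, this]
    ring
  have hrnn : ∀ t, 0 ≤ M.lineRate π₁ π₂ p t + (ρ + b) := fun t => by
    have := M.lineRate_nonneg π₁ π₂ p t; positivity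
  have hnn : ∀ t ∈ Ioc p.1 T, 0 ≤ hf p.1 * (- γ t * expInt γ p.1 t) := fun t ht =>
    mul_nonneg (hf_pos _).le (mul_nonneg ((hrnn t).trans (hγle t (Ioc_subset_Icc_self ht)))
      (expInt_pos _ _ _).le)
  have hjump : M.jumpOp π₁ π₂ T lam (M.barrier T W a p₀ c₁) p ≤
      ENNReal.ofReal (hf p.1 * (1 - expInt γ p.1 T)) := by
    rw [← hint, ofReal_integral_eq_lintegral_ofReal hγE
      ((ae_restrict_iff' measurableSet_Ioc).2 (ae_of_all _ hnn))]
    refine setLIntegral_mono' measurableSet_Ioc fun t ht => ?_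
    have ht' := Ioc_subset_Icc_self ht
    rw [h.weight_eq lam hp.1 ht']
    calc _ ≤ ENNReal.ofReal (expInt (M.lineExponent π₁ π₂ lam p) p.1 t) *
          ENNReal.ofReal ((M.lineRate π₁ π₂ p t + (ρ + b)) * hf t) := by
          gcongr; exact hJ t ht
      _ = ENNReal.ofReal (hf p.1 * ((M.lineRate π₁ π₂ p t + (ρ + b)) * expInt γ p.1 t)) := by
          rw [← ENNReal.ofReal_mul (expInt_pos _ _ _).le]
          congr 1
          linear_combination (M.lineRate π₁ π₂ p t + (ρ + b)) * hEh t ht'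
      _ ≤ _ := by
          refine ENNReal.ofReal_le_ofReal (mul_le_mul_of_nonneg_left ?_ (hf_pos _).le)
          exact mul_le_mul_of_nonneg_right (hγle t ht') (expInt_pos _ _ _).le
  have hend : M.discount π₁ π₂ lam p T * M.survival π₁ π₂ p T *
        ENNReal.ofReal (w ^ p₀) = ENNReal.ofReal (hf p.1 * expInt γ p.1 T) := by
    have hTm : T ∈ Icc p.1 T := ⟨hp.2, le_rfl⟩
    rw [h.weight_eq lam hp.1 hTm, ← ENNReal.ofReal_mul (expInt_pos _ _ _).le, ← hEh T hTm]
    simp [hhf]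
  have hγ1 : expInt γ p.1 T ≤ 1 := by
    have h0 : 0 ≤ ∫ t in Ioc p.1 T, hf p.1 * (- γ t * expInt γ p.1 t) :=
      setIntegral_nonneg measurableSet_Ioc hnn
    rw [hint] at h0
    linarith [nonneg_of_mul_nonneg_right h0 (hf_pos _)]
  rw [hend, hbarp]
  calc _ ≤ ENNReal.ofReal (hf p.1 * expInt γ p.1 T) +
        ENNReal.ofReal (hf p.1 * (1 - expInt γ p.1 T)) := by gcongr
    _ = ENNReal.ofReal (hf p.1) := by
        rw [← ENNReal.ofReal_add (mul_nonneg (hf_pos _).le (expInt_pos _ _ _).le)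
          (mul_nonneg (hf_pos _).le (by linarith))]
        congr 1
        ring

end Comparison

end Game

end PDMG

end

/-! ### Comparison principle for the first-jump equation -/

noncomputable section

namespace PDMG

theorem lintegral_Ioc_pow_div_factorial (D : ℝ) (hD : 0 ≤ D) {s T : ℝ} (hs : s ≤ T) (n : ℕ) :
    ∫⁻ z in Ioc s T, ENNReal.ofReal (D * ((T - z) ^ n / n.factorial)) =
      ENNReal.ofReal (D * ((T - s) ^ (n + 1) / (n + 1).factorial)) := by
  rw [← ofReal_integral_eq_lintegral_ofReal]
  · rw [← intervalIntegral.integral_of_le hs]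
    congr 1
    rw [intervalIntegral.integral_const_mul, intervalIntegral.integral_div,
      intervalIntegral.integral_comp_sub_left (fun z => z ^ n) T, integral_pow,
      Nat.factorial_succ]
    push_cast
    simp only [sub_self, ne_eq, Nat.add_eq_zero_iff, one_ne_zero, and_false, not_false_eq_true,
      zero_pow, sub_zero]
    field_simp
  · exact ((Continuous.integrableOn_Icc (by fun_prop)).mono_set Ioc_subset_Icc_self)
  · refine (ae_restrict_iff' measurableSet_Ioc).2 (ae_of_all _ fun z hz => ?_)
    have : 0 ≤ T - z := by linarith [hz.2]
    simp only [Pi.zero_apply]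
    positivity

namespace Game

variable {S A B : Type*} [TopologicalSpace S] [MeasurableSpace S] [MeasurableEq S]
  [MeasurableSpace A] [MeasurableSpace B] {M : Game S A B}
  {π₁ : MarkovStrategy M.actA} {π₂ : MarkovStrategy M.actB}
  {T lam : ℝ} {V : S → ℝ} {κ k₀ k₁ : ℝ}

/-- The killing only helps; the discount is bounded because the cost rate is bounded on lines whose
endpoint has weight at most `N`. -/
theorem LineBounds.weight_le (h : M.LineBounds π₁ π₂ T V κ k₀ k₁) (hlam0 : 0 ≤ lam)
    (hlam1 : lam ≤ 1) {p : ℝ × S} (hp : 0 ≤ p.1) {z : ℝ} (hz : z ∈ Icc p.1 T) {N : ℝ}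
    (hN : V (M.endpoint T p) ≤ N) :
    M.discount π₁ π₂ lam p z * M.survival π₁ π₂ p z ≤
      ENNReal.ofReal (Real.exp ((k₀ + k₁ * Real.log N) * T)) := by
  obtain ⟨-, hk0, hk1⟩ := h.const_nonneg
  have hV1 := h.one_le (M.endpoint T p)
  have hlog : Real.log (V (M.endpoint T p)) ≤ Real.log N := Real.log_le_log (by linarith) hN
  have hC0 : 0 ≤ k₀ + k₁ * Real.log N := by
    have := Real.log_nonneg (hV1.trans hN)
    positivity
  rw [h.weight_eq lam hp hz]
  refine ENNReal.ofReal_le_ofReal (Real.exp_le_exp.2 ?_)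
  calc ∫ v in p.1..z, M.lineExponent π₁ π₂ lam p v
      ≤ ∫ v in p.1..z, (k₀ + k₁ * Real.log N) := by
        refine intervalIntegral.integral_mono_on hz.1
          (h.intervalIntegrable_lineExponent lam p hp hz.2 hz.1) intervalIntegrable_const
          fun v hv => ?_
        have h1 := h.abs_lineCost_le p (v := v) ⟨hp.trans hv.1, hv.2.trans hz.2⟩
        have h2 := M.lineRate_nonneg π₁ π₂ p v
        have h3 : lam * M.lineCost π₁ π₂ p v ≤ |M.lineCost π₁ π₂ p v| := by
          calc lam * M.lineCost π₁ π₂ p v ≤ lam * |M.lineCost π₁ π₂ p v| := by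
                gcongr; exact le_abs_self _
            _ ≤ 1 * |M.lineCost π₁ π₂ p v| := by gcongr
            _ = _ := one_mul _
        have h4 : k₁ * Real.log (V (M.endpoint T p)) ≤ k₁ * Real.log N := by gcongr
        rw [lineExponent]
        linarith
    _ = (k₀ + k₁ * Real.log N) * (z - p.1) := by
        rw [intervalIntegral.integral_const, smul_eq_mul, mul_comm]
    _ ≤ _ := by
        gcongr
        linarith [hz.2]

/-- Comparison principle: a subsolution of the homogeneous first-jump equation that is dominated at
infinity by a supersolution vanishes. -/
theorem LineBounds.eq_zero_of_le_jumpOp (h : M.LineBounds π₁ π₂ T V κ k₀ k₁) (hlam0 : 0 ≤ lam)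
    (hlam1 : lam ≤ 1) {w H : ℝ × S → ℝ≥0∞}
    (hw : ∀ p : ℝ × S, p.1 ∈ Icc 0 T → w p ≤ M.jumpOp π₁ π₂ T lam w p)
    (hHm : Measurable H)
    (hH : ∀ p : ℝ × S, p.1 ∈ Icc 0 T → M.jumpOp π₁ π₂ T lam H p ≤ H p)
    (hHfin : ∀ p, H p ≠ ∞)
    (hdom : ∀ ε : ℝ, 0 < ε → ∃ N : ℝ, ∀ p : ℝ × S, p.1 ∈ Icc 0 T → N ≤ V (M.endpoint T p) →
      w p ≤ ENNReal.ofReal ε * H p)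
    (hbdd : ∀ N : ℝ, ∃ C : ℝ, 0 ≤ C ∧ ∀ p : ℝ × S, p.1 ∈ Icc 0 T → V (M.endpoint T p) ≤ N →
      w p ≤ ENNReal.ofReal C)
    {p : ℝ × S} (hp : p.1 ∈ Icc 0 T) : w p = 0 := by
  have key : ∀ ε : ℝ, 0 < ε → ∀ p : ℝ × S, p.1 ∈ Icc 0 T → w p ≤ ENNReal.ofReal ε * H p := by
    intro ε hε
    obtain ⟨N, hN⟩ := hdom ε hε
    obtain ⟨C, hC0, hC⟩ := hbdd N
    -- The truncated difference is the positive part of `w - ε H`. It is again a subsolution, as `w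
    -- ≤ v + ε H` and `H` is a supersolution, and it vanishes on lines with `V ≥ N` at the endpoint.
    set v : ℝ × S → ℝ≥0∞ := fun q => w q - ENNReal.ofReal ε * H q with hv
    have hvG : ∀ p : ℝ × S, p.1 ∈ Icc 0 T → v p ≤ M.jumpOp π₁ π₂ T lam v p := by
      intro p hp
      have hm : Measurable fun q => ENNReal.ofReal ε * H q := hHm.const_mul _
      rw [hv]
      simp only
      refine tsub_le_iff_right.2 ?_
      calc w p ≤ M.jumpOp π₁ π₂ T lam w p := hw p hp
        _ ≤ M.jumpOp π₁ π₂ T lam (fun q => v q + ENNReal.ofReal ε * H q) p :=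
            M.jumpOp_mono π₁ π₂ fun z _ y => le_tsub_add
        _ = M.jumpOp π₁ π₂ T lam v p + ENNReal.ofReal ε * M.jumpOp π₁ π₂ T lam H p := by
            rw [M.jumpOp_add π₁ π₂ v hm, M.jumpOp_const_mul π₁ π₂ hHm]
        _ ≤ _ := by gcongr; exact hH p hp
    have hv0 : ∀ p : ℝ × S, p.1 ∈ Icc 0 T → N ≤ V (M.endpoint T p) → v p = 0 :=
      fun p hp hNp => tsub_eq_zero_of_le (hN p hp hNp)
    -- A bound for discount times jump rate on lines whose endpoint has weight at most `N`. The
    -- maximum with `0` keeps it nonnegative for any real `N`.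
    set K := Real.exp ((k₀ + k₁ * Real.log N) * T) * (κ * max N 0) with hK
    have hκ := h.const_nonneg.1
    have hK0 : 0 ≤ K := by positivity
    -- Each application of the jump operator gains a factor `K` and an integration over the
    -- remaining time. Starting points with large weight need no estimate, since `v` is zero there.
    have hiter : ∀ n : ℕ, ∀ p : ℝ × S, p.1 ∈ Icc 0 T →
        v p ≤ ENNReal.ofReal (C * K ^ n * ((T - p.1) ^ n / n.factorial)) := by
      intro n
      induction n with
      | zero =>
        intro p hp
        rcases le_total N (V (M.endpoint T p)) with hNp | hNp
        · rw [hv0 p hp hNp]; exact zero_le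
        · exact (tsub_le_self.trans (hC p hp hNp)).trans (by simp)
      | succ n ih =>
        intro p hp
        rcases le_total N (V (M.endpoint T p)) with hNp | hNp
        · rw [hv0 p hp hNp]; exact zero_le
        calc v p ≤ M.jumpOp π₁ π₂ T lam v p := hvG p hp
          _ ≤ ∫⁻ z in Ioc p.1 T,
              ENNReal.ofReal ((C * K ^ (n + 1)) * ((T - z) ^ n / n.factorial)) := by
              refine setLIntegral_mono' measurableSet_Ioc fun z hz => ?_
              have hz0 : z ∈ Icc 0 T := ⟨hp.1.trans hz.1.le, hz.2⟩
              have hTz : 0 ≤ T - z := by linarith [hz.2]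
              have h1 : M.lineJump π₁ π₂ v p z ≤
                  ENNReal.ofReal (C * K ^ n * ((T - z) ^ n / n.factorial)) *
                    ENNReal.ofReal (κ * max N 0) := by
                calc M.lineJump π₁ π₂ v p z ≤ ∫⁻ _,
                      ENNReal.ofReal (C * K ^ n * ((T - z) ^ n / n.factorial))
                        ∂(M.jumpKernel π₁ π₂ (z, M.flow p.2 (z - p.1))) :=
                      lintegral_mono fun y => ih (z, y) hz0
                  _ = ENNReal.ofReal (C * K ^ n * ((T - z) ^ n / n.factorial)) *
                      ENNReal.ofReal (M.lineRate π₁ π₂ p z) := by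
                      rw [lintegral_const, lineRate, ofReal_rate]
                  _ ≤ _ := by
                      gcongr
                      refine (h.lineRate_le p hz0).trans ?_
                      gcongr
                      exact hNp.trans (le_max_left _ _)
              calc _ ≤ ENNReal.ofReal (Real.exp ((k₀ + k₁ * Real.log N) * T)) *
                    (ENNReal.ofReal (C * K ^ n * ((T - z) ^ n / n.factorial)) *
                    ENNReal.ofReal (κ * max N 0)) := by
                    gcongr
                    exact h.weight_le hlam0 hlam1 hp.1 (Ioc_subset_Icc_self hz) hNp
                _ = _ := by
                    rw [← ENNReal.ofReal_mul (by positivity), ← ENNReal.ofReal_mul (by positivity),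
                      pow_succ]
                    congr 1
                    simp only [hK]
                    ring
          _ = _ := lintegral_Ioc_pow_div_factorial _ (by positivity) hp.2 n
    intro p hp
    have hlim : Tendsto (fun n : ℕ => ENNReal.ofReal (C * K ^ n * ((T - p.1) ^ n / n.factorial)))
        atTop (𝓝 0) := by
      have h1 := (FloorSemiring.tendsto_pow_div_factorial_atTop (K * (T - p.1))).const_mul C
      rw [mul_zero] at h1
      have h2 := ENNReal.tendsto_ofReal h1
      rw [ENNReal.ofReal_zero] at h2
      refine h2.congr fun n => ?_
      rw [mul_pow]
      congr 1
      ring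
    have hvp : v p ≤ 0 := ge_of_tendsto' hlim fun n => hiter n p hp
    exact tsub_eq_zero_iff_le.1 (le_antisymm hvp zero_le)
  -- Finiteness of `H p` is needed for the product to tend to zero as `ε` does.
  have hlim : Tendsto (fun ε : ℝ => ENNReal.ofReal ε * H p) (𝓝[>] 0) (𝓝 0) := by
    have h1 : Tendsto (fun ε : ℝ => ENNReal.ofReal ε * H p) (𝓝 0) (𝓝 (ENNReal.ofReal 0 * H p)) :=
      ENNReal.Tendsto.mul_const (ENNReal.tendsto_ofReal tendsto_id) (Or.inr (hHfin p))
    rw [ENNReal.ofReal_zero, zero_mul] at h1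
    exact h1.mono_left nhdsWithin_le_nhds
  refine le_antisymm (ge_of_tendsto hlim ?_) zero_le
  filter_upwards [self_mem_nhdsWithin] with ε hε
  exact key ε hε p hp

/-! ### Bounds from the standing assumptions -/

variable {V₁ : S → ℝ}

/-- Taking logarithms in the exponential bound on `c` gives growth `log V` with the factor `1 / (2
(T + 1))`. This value keeps the exponents of the barriers at most one on a horizon of length `T`. -/
theorem SecondDriftCondition.lineBounds (hV : M.DriftCondition T V)
    (hV₁ : M.SecondDriftCondition T V V₁) (hT : 0 < T) (π₁ : MarkovStrategy M.actA)
    (π₂ : MarkovStrategy M.actB) :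
    ∃ κ k₀, M.LineBounds π₁ π₂ T V κ k₀ (1 / (2 * (T + 1))) := by
  obtain ⟨κ, hκ, hrate⟩ := hV₁.rate_le
  obtain ⟨M₂, hM₂, hcost⟩ := hV.cost
  refine ⟨κ, 1 / (2 * (T + 1)) * Real.log M₂, hV.one_le, fun t ht x => ?_, fun t ht x => ?_,
    hκ.le, ?_, by positivity⟩
  · have h1 := M.jumpKernel_univ_le π₁ π₂ ht.1 x fun a b hk => hrate t x a b hk ht.2
    have h0 : 0 ≤ κ * V (M.flow x (T - t)) := by
      have := hV.one_le (M.flow x (T - t)); positivity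
    rw [← ofReal_rate] at h1
    exact (ENNReal.ofReal_le_ofReal_iff h0).1 h1
  · refine M.abs_stratCost_le π₁ π₂ ht.1 x fun a b hk => ?_
    have h1 := (hcost t x a b hk ht.2).1
    have hVp : 0 < V (M.flow x (T - t)) := by linarith [hV.one_le (M.flow x (T - t))]
    rw [← Real.le_log_iff_exp_le (by positivity), Real.log_mul (by positivity) hVp.ne'] at h1
    rw [← mul_add, one_div, ← div_eq_inv_mul, le_div_iff₀ (by positivity)]
    linarith
  · have := Real.log_nonneg hM₂
    positivity

/-- The drift condition is used with flow time `T - t`, so that the weight is evaluated at the end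
of the flow lines before and after the jump. -/
theorem DriftCondition.lintegral_le (hV : M.DriftCondition T V) (π₁ : MarkovStrategy M.actA)
    (π₂ : MarkovStrategy M.actB) : ∃ ρ b : ℝ, 0 ≤ ρ ∧ 0 ≤ b ∧ ∀ t ∈ Icc 0 T, ∀ x,
      ∫⁻ y, ENNReal.ofReal (V (M.flow y (T - t))) ∂(M.jumpKernel π₁ π₂ (t, x)) ≤
        ENNReal.ofReal (ρ * V (M.flow x (T - t)) + b) +
        M.jumpKernel π₁ π₂ (t, x) univ * ENNReal.ofReal (V (M.flow x (T - t))) := by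
  obtain ⟨ρ, b, hρ, hb, hd⟩ := hV.drift
  refine ⟨ρ, b, hρ, hb, fun t ht x => ?_⟩
  have hV0 : ∀ y, 0 ≤ V y := fun y => by linarith [hV.one_le y]
  refine M.lintegral_jumpKernel_le π₁ π₂ ht.1 x (u := fun y => V (M.flow y (T - t)))
    (hV.measurable.comp (M.measurable_flow.comp (g := fun p : S × ℝ => M.flow p.1 p.2)
        (f := fun y => (y, T - t)) (by fun_prop))) (fun y => hV0 _)
    (by have := hV0 (M.flow x (T - t)); positivity)
    fun a c hk => hd t x a c hk (T - t) (by linarith [ht.2])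

theorem SecondDriftCondition.lintegral_le (hV₁ : M.SecondDriftCondition T V V₁)
    (π₁ : MarkovStrategy M.actA) (π₂ : MarkovStrategy M.actB) :
    ∃ ρ b : ℝ, 0 ≤ ρ ∧ 0 ≤ b ∧ ∀ t ∈ Icc 0 T, ∀ x,
      ∫⁻ y, ENNReal.ofReal (V₁ (M.flow y (T - t)) ^ 2) ∂(M.jumpKernel π₁ π₂ (t, x)) ≤
        ENNReal.ofReal (ρ * V₁ (M.flow x (T - t)) ^ 2 + b) +
        M.jumpKernel π₁ π₂ (t, x) univ * ENNReal.ofReal (V₁ (M.flow x (T - t)) ^ 2) := by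
  obtain ⟨ρ, b, hρ, hb, hd⟩ := hV₁.drift
  refine ⟨ρ, b, hρ.le, hb.le, fun t ht x => ?_⟩
  refine M.lintegral_jumpKernel_le π₁ π₂ ht.1 x (u := fun y => V₁ (M.flow y (T - t)) ^ 2)
    ((hV₁.measurable.comp (M.measurable_flow.comp (g := fun p : S × ℝ => M.flow p.1 p.2)
        (f := fun y => (y, T - t)) (by fun_prop))).pow_const 2) (fun y => sq_nonneg _)
    (by positivity)
    fun a c hk => hd t x a c hk ht.2 (T - t) ⟨by linarith [ht.2], le_rfl⟩

end Game

end PDMG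

end

noncomputable section

namespace PDMG

/-! ### The Markov property of homogeneous chains -/

section Chain

variable {Z : Type*} [MeasurableSpace Z]

/-- The path that starts at `z` and then follows `ω`. -/
def consPath (z : Z) (ω : ℕ → Z) : ℕ → Z
  | 0 => z
  | n + 1 => ω n

theorem measurable_consPath (z : Z) : Measurable (consPath z) := by
  refine measurable_pi_iff.2 fun n => ?_
  cases n with
  | zero => exact measurable_const
  | succ n => exact measurable_pi_apply n

/-- The transition kernel `κ` as a function of the whole history. -/
def chainStep (κ : Kernel Z Z) (n : ℕ) : Kernel (Π _ : Finset.Iic n, Z) Z :=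
  κ.comap (fun h => h ⟨n, Finset.mem_Iic.2 le_rfl⟩) (measurable_pi_apply _)

variable (κ : Kernel Z Z) [IsMarkovKernel κ]

instance (n : ℕ) : IsMarkovKernel (chainStep κ n) := by
  unfold chainStep; infer_instance

/-- The law of the homogeneous Markov chain with transition kernel `κ`, as a function of the
starting point. -/
def chainLaw : Kernel Z (ℕ → Z) :=
  (Kernel.traj (X := fun _ => Z) (chainStep κ) 0).comap (fun z _ => z)
    (measurable_pi_iff.2 fun _ => measurable_id)

instance : IsMarkovKernel (chainLaw κ) := by
  unfold chainLaw; infer_instance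

theorem measurable_coordProd {f : ℕ → Z → ℝ≥0∞} (hf : ∀ i, Measurable (f i)) (s : Finset ℕ) :
    Measurable fun ω : ℕ → Z => ∏ i ∈ s, f i (ω i) :=
  Finset.measurable_prod _ fun i _ => (hf i).comp (measurable_pi_apply i)

/-- Condition on the first `n + 1` coordinates: the product is then a constant, and the next
coordinate has law `κ (ω n)`. -/
theorem lintegral_chainLaw_prod_succ {f : ℕ → Z → ℝ≥0∞} (hf : ∀ i, Measurable (f i)) (n : ℕ)
    {g : Z → ℝ≥0∞} (hg : Measurable g) (z : Z) :
    ∫⁻ ω, (∏ i ∈ Finset.range (n + 1), f i (ω i)) * g (ω (n + 1)) ∂(chainLaw κ z) =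
      ∫⁻ ω, (∏ i ∈ Finset.range (n + 1), f i (ω i)) * (∫⁻ y, g y ∂(κ (ω n)))
        ∂(chainLaw κ z) := by
  have hG : Measurable fun y => ∫⁻ y', g y' ∂(κ y) := hg.lintegral_kernel
  have hm1 : Measurable fun ω : ℕ → Z =>
      (∏ i ∈ Finset.range (n + 1), f i (ω i)) * g (ω (n + 1)) :=
    (measurable_coordProd hf _).mul (hg.comp (measurable_pi_apply _))
  have hm2 : Measurable fun ω : ℕ → Z =>
      (∏ i ∈ Finset.range (n + 1), f i (ω i)) * (∫⁻ y, g y ∂(κ (ω n))) :=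
    (measurable_coordProd hf _).mul (hG.comp (measurable_pi_apply _))
  rw [chainLaw, Kernel.comap_apply, ← Kernel.traj_comp_partialTraj (Nat.zero_le n),
    Kernel.lintegral_comp _ _ _ hm1, Kernel.lintegral_comp _ _ _ hm2]
  refine lintegral_congr fun h => ?_
  rw [Kernel.lintegral_traj h hm1, Kernel.lintegral_traj h hm2]
  have hlt : ∀ i ∈ Finset.range (n + 1), i ∈ Finset.Iic n := fun i hi =>
    Finset.mem_Iic.2 (Nat.lt_succ_iff.1 (Finset.mem_range.1 hi))
  have h1 : ∀ x : ℕ → Z, (∏ i ∈ Finset.range (n + 1),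
      f i (Function.updateFinset x (Finset.Iic n) h i)) =
        ∏ i ∈ (Finset.range (n + 1)).attach, f i (h ⟨i.1, hlt i.1 i.2⟩) := by
    intro x
    rw [← Finset.prod_attach]
    refine Finset.prod_congr rfl fun i _ => ?_
    rw [Function.updateFinset, dif_pos (hlt i.1 i.2)]
  have h2 : ∀ x : ℕ → Z, Function.updateFinset x (Finset.Iic n) h (n + 1) = x (n + 1) :=
    fun x => by rw [Function.updateFinset, dif_neg (by simp)]
  have h3 : ∀ x : ℕ → Z, Function.updateFinset x (Finset.Iic n) h n =
      h ⟨n, Finset.mem_Iic.2 le_rfl⟩ :=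
    fun x => by rw [Function.updateFinset, dif_pos (by simp)]
  simp only [h1, h2, h3]
  rw [lintegral_const_mul _ (f := fun x : ℕ → Z => g (x (n + 1)))
    (hg.comp (measurable_pi_apply _)), lintegral_const, measure_univ, mul_one]
  congr 1
  have h4 := congrArg (fun η : Kernel (Π _ : Finset.Iic n, Z) Z => ∫⁻ y, g y ∂(η h))
    (Kernel.map_traj_succ_self (X := fun _ => Z) (κ := chainStep κ) (a := n))
  rw [Kernel.map_apply _ (measurable_pi_apply _), lintegral_map hg (measurable_pi_apply _)] at h4
  rw [h4]
  rfl

theorem lintegral_chainLaw_zero {g : Z → ℝ≥0∞} (hg : Measurable g) (z : Z) :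
    ∫⁻ ω, g (ω 0) ∂(chainLaw κ z) = g z := by
  rw [chainLaw, Kernel.comap_apply,
    Kernel.lintegral_traj (X := fun _ => Z) _ (f := fun ω => g (ω 0)) (hg.comp (measurable_pi_apply 0))]
  simp [Function.updateFinset]

/-- The Markov property for product functions. The last factor is integrated out and absorbed into
the one before it, on both sides, which shortens the product by one. -/
theorem lintegral_chainLaw_prod_cons {f : ℕ → Z → ℝ≥0∞} (hf : ∀ i, Measurable (f i)) (n : ℕ)
    (z : Z) : ∫⁻ ω, ∏ i ∈ Finset.range (n + 2), f i (ω i) ∂(chainLaw κ z) =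
      f 0 z * ∫⁻ z', ∫⁻ ω, ∏ i ∈ Finset.range (n + 1), f (i + 1) (ω i) ∂(chainLaw κ z') ∂(κ z) := by
  induction n generalizing f z with
  | zero =>
    have h1 := lintegral_chainLaw_prod_succ κ hf 0 (hf 1) z
    simp only [zero_add, Finset.prod_range_succ, Finset.range_zero, Finset.prod_empty, one_mul]
      at h1 ⊢
    rw [h1, lintegral_chainLaw_zero κ (g := fun y => f 0 y * ∫⁻ y', f 1 y' ∂(κ y))
      ((hf 0).mul (hf 1).lintegral_kernel)]
    simp only [lintegral_chainLaw_zero κ (hf 1)]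
  | succ n ih =>
    set G : Z → ℝ≥0∞ := fun y => ∫⁻ y', f (n + 2) y' ∂(κ y) with hG
    have hGm : Measurable G := (hf (n + 2)).lintegral_kernel
    set f' : ℕ → Z → ℝ≥0∞ := Function.update f (n + 1) (fun y => f (n + 1) y * G y) with hf'
    have hf'm : ∀ i, Measurable (f' i) := by
      intro i
      by_cases hi : i = n + 1
      · subst hi; simpa [hf'] using! (hf (n + 1)).mul hGm
      · simpa [hf', Function.update_of_ne hi] using hf i
    have hne : ∀ i < n + 1, f' i = f i := fun i hi => Function.update_of_ne (by omega) _ _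
    have heq : f' (n + 1) = fun y => f (n + 1) y * G y := Function.update_self ..
    have h1 : ∀ ω : ℕ → Z, (∏ i ∈ Finset.range (n + 2), f i (ω i)) * G (ω (n + 1)) =
        ∏ i ∈ Finset.range (n + 2), f' i (ω i) := by
      intro ω
      rw [Finset.prod_range_succ, Finset.prod_range_succ _ (n + 1), heq, mul_assoc]
      congr 1
      exact Finset.prod_congr rfl fun i hi => by rw [hne i (Finset.mem_range.1 hi)]
    have h2 : ∀ ω : ℕ → Z, (∏ i ∈ Finset.range (n + 1), f (i + 1) (ω i)) * G (ω n) =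
        ∏ i ∈ Finset.range (n + 1), f' (i + 1) (ω i) := by
      intro ω
      rw [Finset.prod_range_succ, Finset.prod_range_succ _ n, heq, mul_assoc]
      congr 1
      exact Finset.prod_congr rfl fun i hi => by
        rw [hne (i + 1) (by have := Finset.mem_range.1 hi; omega)]
    calc ∫⁻ ω, ∏ i ∈ Finset.range (n + 1 + 2), f i (ω i) ∂(chainLaw κ z)
        = ∫⁻ ω, (∏ i ∈ Finset.range (n + 2), f i (ω i)) * f (n + 2) (ω (n + 2))
            ∂(chainLaw κ z) := by
          refine lintegral_congr fun ω => ?_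
          rw [Finset.prod_range_succ]
      _ = ∫⁻ ω, ∏ i ∈ Finset.range (n + 2), f' i (ω i) ∂(chainLaw κ z) := by
          rw [lintegral_chainLaw_prod_succ κ hf (n + 1) (hf (n + 2))]
          exact lintegral_congr h1
      _ = f' 0 z * ∫⁻ z', ∫⁻ ω, ∏ i ∈ Finset.range (n + 1), f' (i + 1) (ω i)
            ∂(chainLaw κ z') ∂(κ z) := ih hf'm z
      _ = _ := by
          rw [hne 0 (by omega)]
          congr 1
          refine lintegral_congr fun z' => ?_
          simp only [← h2]
          rw [← lintegral_chainLaw_prod_succ κ (f := fun i => f (i + 1)) (fun i => hf (i + 1)) n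
            (hf (n + 2))]
          refine lintegral_congr fun ω => ?_
          rw [Finset.prod_range_succ _ (n + 1)]

theorem measurable_map_consPath (z : Z) :
    Measurable fun z' => (chainLaw κ z').map (consPath z) :=
  (Measure.measurable_map _ (measurable_consPath z)).comp (chainLaw κ).measurable

/-- The Markov property at the first step. -/
theorem chainLaw_eq_bind (z : Z) :
    chainLaw κ z = (κ z).bind fun z' => (chainLaw κ z').map (consPath z) := by
  have hm := measurable_map_consPath κ z
  refine ext_of_generate_finite _ generateFrom_squareCylinders.symm
    (isPiSystem_squareCylinders (fun _ => MeasurableSpace.isPiSystem_measurableSet)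
      fun _ => MeasurableSet.univ) ?_ ?_
  · rintro - ⟨s, t, ht, rfl⟩
    have ht' : ∀ i, MeasurableSet (t i) := fun i => ht i (mem_univ i)
    classical
    -- The first `n + 2` coordinates contain all those constrained by the cylinder and have the
    -- length required by the product formula; unconstrained ones get the factor `1`.
    set n := s.sup id with hn
    set f : ℕ → Z → ℝ≥0∞ := fun i => (if i ∈ s then t i else univ).indicator 1 with hf
    have hfm : ∀ i, Measurable (f i) := fun i => by
      refine measurable_one.indicator ?_
      split_ifs
      · exact ht' i
      · exact MeasurableSet.univ
    have hms : MeasurableSet ((s : Set ℕ).pi t) :=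
      MeasurableSet.pi s.countable_toSet fun i _ => ht' i
    have hind : ∀ ω : ℕ → Z, ((s : Set ℕ).pi t).indicator (1 : (ℕ → Z) → ℝ≥0∞) ω =
        ∏ i ∈ Finset.range (n + 2), f i (ω i) := by
      intro ω
      by_cases hω : ω ∈ (s : Set ℕ).pi t
      · rw [indicator_of_mem hω, Finset.prod_eq_one]
        · rfl
        · intro i _
          rw [hf]
          simp only
          split_ifs with hi
          · rw [indicator_of_mem (hω i hi)]; rfl
          · simp
      · rw [indicator_of_notMem hω]
        simp only [Set.mem_pi, not_forall] at hω
        obtain ⟨i, hi, hit⟩ := hω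
        refine (Finset.prod_eq_zero (i := i) ?_ ?_).symm
        · have : i ≤ n := Finset.le_sup (f := id) hi
          exact Finset.mem_range.2 (by omega)
        · have hi' : i ∈ s := hi
          simp [hf, hi', hit]
    rw [Measure.bind_apply hms hm.aemeasurable, ← lintegral_indicator_one hms]
    simp only [hind]
    rw [lintegral_chainLaw_prod_cons κ hfm]
    have hmeas : Measurable fun z' => ∫⁻ ω, ∏ i ∈ Finset.range (n + 1), f (i + 1) (ω i)
        ∂(chainLaw κ z') :=
      (measurable_coordProd (f := fun i => f (i + 1)) (fun i => hfm (i + 1)) _).lintegral_kernel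
    rw [← lintegral_const_mul _ hmeas]
    refine lintegral_congr fun z' => ?_
    rw [Measure.map_apply (measurable_consPath z) hms,
      ← lintegral_indicator_one (measurable_consPath z hms),
      ← lintegral_const_mul _
        (measurable_coordProd (f := fun i => f (i + 1)) (fun i => hfm (i + 1)) _)]
    refine lintegral_congr fun ω => ?_
    change _ = ((s : Set ℕ).pi t).indicator (1 : (ℕ → Z) → ℝ≥0∞) (consPath z ω)
    rw [hind, Finset.prod_range_succ' _ (n + 1), mul_comm]
    rfl
  · rw [Measure.bind_apply MeasurableSet.univ hm.aemeasurable, measure_univ]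
    have : ∀ z', ((chainLaw κ z').map (consPath z)) univ = 1 := fun z' => by
      rw [Measure.map_apply (measurable_consPath z) MeasurableSet.univ, preimage_univ,
        measure_univ]
    simp [this]

theorem lintegral_chainLaw {F : (ℕ → Z) → ℝ≥0∞} (hF : Measurable F) (z : Z) :
    ∫⁻ ω, F ω ∂(chainLaw κ z) = ∫⁻ z', ∫⁻ ω, F (consPath z ω) ∂(chainLaw κ z') ∂(κ z) := by
  have hm := measurable_map_consPath κ z
  conv_lhs => rw [chainLaw_eq_bind]
  rw [Measure.lintegral_bind hm.aemeasurable hF.aemeasurable]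
  exact lintegral_congr fun z' => lintegral_map hF (measurable_consPath z)

theorem ae_chainLaw_zero {s : Set Z} (hs : MeasurableSet s) {z : Z} (hz : z ∈ s) :
    ∀ᵐ ω ∂(chainLaw κ z), ω 0 ∈ s := by
  have h := lintegral_chainLaw_zero κ (g := sᶜ.indicator 1) (measurable_one.indicator hs.compl) z
  rw [indicator_of_notMem (by simpa using hz), lintegral_eq_zero_iff
    (f := fun ω : ℕ → Z => sᶜ.indicator 1 (ω 0))
    ((measurable_one.indicator hs.compl).comp (measurable_pi_apply 0))] at h
  filter_upwards [h] with ω hω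
  by_contra hcon
  simp [hcon] at hω

end Chain

end PDMG

end

noncomputable section

namespace PDMG

/-! ### Discounted sums along a chain and their expectation -/

section PathSum

theorem measurable_of_sum_prod {α β γ δ : Type*} [MeasurableSpace α] [MeasurableSpace β]
    [MeasurableSpace γ] [MeasurableSpace δ] {f : (α ⊕ β) × γ → δ}
    (h1 : Measurable fun p : α × γ => f (Sum.inl p.1, p.2))
    (h2 : Measurable fun p : β × γ => f (Sum.inr p.1, p.2)) : Measurable f := by
  have h : f = Sum.elim (fun p : α × γ => f (Sum.inl p.1, p.2))
      (fun p : β × γ => f (Sum.inr p.1, p.2)) ∘ MeasurableEquiv.sumProdDistrib α β γ := by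
    ext ⟨z, c⟩
    cases z <;> rfl
  rw [h]
  exact (h1.sumElim h2).comp (MeasurableEquiv.measurable _)

theorem measurable_of_prod_sum {α β γ δ : Type*} [MeasurableSpace α] [MeasurableSpace β]
    [MeasurableSpace γ] [MeasurableSpace δ] {f : γ × (α ⊕ β) → δ}
    (h1 : Measurable fun p : γ × α => f (p.1, Sum.inl p.2))
    (h2 : Measurable fun p : γ × β => f (p.1, Sum.inr p.2)) : Measurable f := by
  have h : Measurable fun q : (α ⊕ β) × γ => f (q.2, q.1) :=
    measurable_of_sum_prod (h1.comp measurable_swap) (h2.comp measurable_swap)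
  exact h.comp measurable_swap

variable {Z : Type*}

/-- The sum of the rewards `A(ω_k, ω_{k+1})` over `k < n`, discounted by the product of the factors
`D(ω_j, ω_{j+1})` over `j < k`. -/
def pathSum (A D : Z × Z → ℝ≥0∞) : ℕ → (ℕ → Z) → ℝ≥0∞
  | 0, _ => 0
  | n + 1, ω => A (ω 0, ω 1) + D (ω 0, ω 1) * pathSum A D n fun k => ω (k + 1)

variable {A D : Z × Z → ℝ≥0∞}

theorem pathSum_le_succ (n : ℕ) (ω : ℕ → Z) : pathSum A D n ω ≤ pathSum A D (n + 1) ω := by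
  induction n generalizing ω with
  | zero => exact zero_le
  | succ n ih =>
    rw [pathSum, pathSum]
    gcongr
    exact ih _

theorem monotone_pathSum (ω : ℕ → Z) : Monotone fun n => pathSum A D n ω :=
  monotone_nat_of_le_succ fun n => pathSum_le_succ n ω

variable [MeasurableSpace Z]

theorem measurable_pathSum (hA : Measurable A) (hD : Measurable D) (n : ℕ) :
    Measurable (pathSum A D n) := by
  induction n with
  | zero => exact measurable_const
  | succ n ih =>
    have h0 : Measurable fun ω : ℕ → Z => (ω 0, ω 1) := by fun_prop
    have h1 : Measurable fun (ω : ℕ → Z) k => ω (k + 1) := by fun_prop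
    exact (hA.comp h0).add ((hD.comp h0).mul (ih.comp h1))

variable (κ : Kernel Z Z) [IsMarkovKernel κ]

/-- The expectation of the limit of the discounted sums. -/
def pathValue (A D : Z × Z → ℝ≥0∞) (z : Z) : ℝ≥0∞ :=
  ∫⁻ ω, ⨆ n, pathSum A D n ω ∂(chainLaw κ z)

theorem pathValue_eq_iSup (hA : Measurable A) (hD : Measurable D) (z : Z) :
    pathValue κ A D z = ⨆ n, ∫⁻ ω, pathSum A D n ω ∂(chainLaw κ z) :=
  lintegral_iSup (fun n => measurable_pathSum hA hD n)
    fun _ _ hmn ω => monotone_pathSum ω hmn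

theorem measurable_pathValue (hA : Measurable A) (hD : Measurable D) :
    Measurable (pathValue κ A D) :=
  (Measurable.iSup fun n => measurable_pathSum hA hD n).lintegral_kernel

variable [MeasurableSingletonClass Z]

/-- The Markov property at the first step; the shifted chain starts almost surely at `z'`, so the
first reward and discount are functions of `(z, z')`. -/
theorem lintegral_pathSum_succ (hA : Measurable A) (hD : Measurable D) (n : ℕ) (z : Z) :
    ∫⁻ ω, pathSum A D (n + 1) ω ∂(chainLaw κ z) =
      ∫⁻ z', (A (z, z') + D (z, z') * ∫⁻ ω, pathSum A D n ω ∂(chainLaw κ z')) ∂(κ z) := by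
  rw [lintegral_chainLaw κ (measurable_pathSum hA hD _)]
  refine lintegral_congr fun z' => ?_
  have h0 := ae_chainLaw_zero κ (measurableSet_singleton z') (mem_singleton z')
  calc ∫⁻ ω, pathSum A D (n + 1) (consPath z ω) ∂(chainLaw κ z')
      = ∫⁻ ω, (A (z, z') + D (z, z') * pathSum A D n ω) ∂(chainLaw κ z') := by
        refine lintegral_congr_ae ?_
        filter_upwards [h0] with ω hω
        have hω' : ω 0 = z' := hω
        rw [← hω']
        rfl
    _ = _ := by
        rw [lintegral_add_left measurable_const, lintegral_const, measure_univ, mul_one,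
          lintegral_const_mul _ (measurable_pathSum hA hD n)]

/-- The value is the limit of the truncated expectations, and a supersolution dominates these by
induction on the number of steps. The predicate `P` restricts this to starting points where the
inequality is available; `H` need not be measurable. -/
theorem pathValue_le (hA : Measurable A) (hD : Measurable D) {P : Z → Prop} {H : Z → ℝ≥0∞}
    (h : ∀ u : Z → ℝ≥0∞, Measurable u → (∀ z, P z → u z ≤ H z) → ∀ z, P z →
      ∫⁻ z', (A (z, z') + D (z, z') * u z') ∂(κ z) ≤ H z) {z : Z} (hz : P z) :
    pathValue κ A D z ≤ H z := by
  rw [pathValue_eq_iSup κ hA hD]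
  refine iSup_le fun n => ?_
  induction n generalizing z with
  | zero => simp [pathSum]
  | succ n ih =>
    rw [lintegral_pathSum_succ κ hA hD]
    exact h _ (measurable_pathSum hA hD n).lintegral_kernel (fun z hz => ih hz) z hz

/-- Monotone convergence in the first-step equation of the truncated sums. -/
theorem pathValue_eq (hA : Measurable A) (hD : Measurable D) (z : Z) :
    pathValue κ A D z = ∫⁻ z', (A (z, z') + D (z, z') * pathValue κ A D z') ∂(κ z) := by
  have hAz : Measurable fun z' => A (z, z') := hA.comp measurable_prodMk_left
  have hDz : Measurable fun z' => D (z, z') := hD.comp measurable_prodMk_left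
  have hm : ∀ n, Measurable fun z' => ∫⁻ ω, pathSum A D n ω ∂(chainLaw κ z') := fun n =>
    (measurable_pathSum hA hD n).lintegral_kernel
  have hmono : Monotone fun n z' => A (z, z') +
      D (z, z') * ∫⁻ ω, pathSum A D n ω ∂(chainLaw κ z') := fun m n hmn z' => by
    have := lintegral_mono (μ := chainLaw κ z') fun ω => monotone_pathSum (A := A) (D := D) ω hmn
    simp only
    gcongr
  have h1 : ∀ z', A (z, z') + D (z, z') * pathValue κ A D z' =
      ⨆ n, (A (z, z') + D (z, z') * ∫⁻ ω, pathSum A D n ω ∂(chainLaw κ z')) := by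
    intro z'
    rw [pathValue_eq_iSup κ hA hD, ENNReal.mul_iSup, ENNReal.add_iSup]
  simp only [h1]
  rw [lintegral_iSup (f := fun n z' => A (z, z') + D (z, z') *
    ∫⁻ ω, pathSum A D n ω ∂(chainLaw κ z')) (fun n => hAz.add (hDz.mul (hm n))) hmono,
    pathValue_eq_iSup κ hA hD]
  have h2 : Monotone fun n => ∫⁻ ω, pathSum A D n ω ∂(chainLaw κ z) := fun m n hmn =>
    lintegral_mono fun ω => monotone_pathSum ω hmn
  rw [← h2.iSup_nat_add 1]
  simp only [lintegral_pathSum_succ κ hA hD]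

end PathSum

/-! ### Rewards and discounts attached to one jump -/

namespace Game

/-- The reward `σ(p)`, received if the next jump from `p` does not happen up to time `T`. -/
def stayReward {S : Type*} (T : ℝ) (σ : ℝ × S → ℝ≥0∞) :
    ((ℝ × S) ⊕ Unit) × ((ℝ × S) ⊕ Unit) → ℝ≥0∞
  | (Sum.inl p, Sum.inl w) => if T < w.1 then σ p else 0
  | (Sum.inl p, Sum.inr _) => σ p
  | (Sum.inr _, _) => 0

theorem measurable_stayReward {S : Type*} [MeasurableSpace S] (T : ℝ)
    {σ : ℝ × S → ℝ≥0∞} (hσ : Measurable σ) : Measurable (stayReward T σ) := by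
  refine measurable_of_sum_prod (measurable_of_prod_sum ?_ ?_) measurable_const
  · exact Measurable.ite (measurableSet_lt (f := fun _ => T)
      (g := fun q : (ℝ × S) × (ℝ × S) => q.2.1) (by fun_prop) (by fun_prop))
      (hσ.comp measurable_fst) measurable_const
  · exact hσ.comp measurable_fst

variable {S A B : Type*} [TopologicalSpace S] [MeasurableSpace S]
  [MeasurableSpace A] [MeasurableSpace B] (M : Game S A B)
  (π₁ : MarkovStrategy M.actA) (π₂ : MarkovStrategy M.actB)

/-- The discount factor until the next jump, on the event that it happens up to time `T`. -/
def jumpDiscount (T lam : ℝ) : ((ℝ × S) ⊕ Unit) × ((ℝ × S) ⊕ Unit) → ℝ≥0∞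
  | (Sum.inl p, Sum.inl w) =>
    if p.1 < w.1 ∧ w.1 ≤ T then M.discount π₁ π₂ lam p w.1 else 0
  | (Sum.inl _, Sum.inr _) => 0
  | (Sum.inr _, _) => 0

theorem measurable_jumpDiscount (T lam : ℝ) : Measurable (M.jumpDiscount π₁ π₂ T lam) := by
  refine measurable_of_sum_prod (measurable_of_prod_sum ?_ measurable_const) measurable_const
  refine Measurable.ite (MeasurableSet.inter
    (measurableSet_lt (f := fun q : (ℝ × S) × (ℝ × S) => q.1.1) (g := fun q => q.2.1)
      (by fun_prop) (by fun_prop))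
    (measurableSet_le (f := fun q : (ℝ × S) × (ℝ × S) => q.2.1) (g := fun _ => T)
      (by fun_prop) (by fun_prop))) ?_ measurable_const
  simpa only [Function.comp_def] using (M.measurable_discount π₁ π₂ lam).comp
    (f := fun q : (ℝ × S) × (ℝ × S) => (q.1, q.2.1)) (by fun_prop)

variable [MeasurableEq S]

theorem lintegral_nextJump (p : ℝ × S) {F : ℝ × S → ℝ≥0∞} (hF : Measurable F) :
    ∫⁻ w, F w ∂(M.nextJump π₁ π₂ p) =
      ∫⁻ z in Ioi p.1, M.survival π₁ π₂ p z * M.lineJump π₁ π₂ F p z := by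
  have hd : Measurable fun w : ℝ × S => (Ioi p.1).indicator (M.survival π₁ π₂ p) w.1 :=
    (M.measurable_nextJump_density π₁ π₂).comp measurable_prodMk_left
  rw [nextJump, Kernel.lintegral_withDensity _ (M.measurable_nextJump_density π₁ π₂) _ hF,
    Kernel.lintegral_compProd _ _ _
      (f := fun w => (Ioi p.1).indicator (M.survival π₁ π₂ p) w.1 * F w) (hd.mul hF),
    ← lintegral_indicator measurableSet_Ioi]
  simp only [Kernel.const_apply, Kernel.comap_apply]
  refine lintegral_congr fun z => ?_
  rw [lintegral_const_mul _ (f := fun y => F (z, y)) (hF.comp measurable_prodMk_left)]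
  by_cases hz : z ∈ Ioi p.1 <;> simp [hz, lineJump]

theorem lintegral_step (p : ℝ × S) {F : (ℝ × S) ⊕ Unit → ℝ≥0∞} (hF : Measurable F) :
    ∫⁻ z, F z ∂(M.step π₁ π₂ (Sum.inl p)) = ∫⁻ w, F (Sum.inl w) ∂(M.nextJump π₁ π₂ p) +
      (1 - M.nextJump π₁ π₂ p univ) * F (Sum.inr ()) := by
  change ∫⁻ z, F z ∂((M.nextJump π₁ π₂ p).map Sum.inl +
    (1 - M.nextJump π₁ π₂ p univ) • Measure.dirac (Sum.inr ())) = _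
  rw [lintegral_add_measure, lintegral_map hF measurable_inl, lintegral_smul_measure,
    lintegral_dirac' _ hF, smul_eq_mul]

end Game

end PDMG

end

noncomputable section

namespace PDMG

instance measurableSingletonClass_sum {α β : Type*} [MeasurableSpace α] [MeasurableSpace β]
    [MeasurableSingletonClass α] [MeasurableSingletonClass β] :
    MeasurableSingletonClass (α ⊕ β) where
  measurableSet_singleton z := by
    cases z with
    | inl a =>
      rw [← image_singleton]
      exact measurableSet_inl_image.2 (measurableSet_singleton a)
    | inr b =>
      rw [← image_singleton]
      exact measurableSet_inr_image.2 (measurableSet_singleton b)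

namespace Game

section Discount

variable {S A B : Type*} [TopologicalSpace S] [MeasurableSpace S]
  [MeasurableSpace A] [MeasurableSpace B] (M : Game S A B) (π₁ : MarkovStrategy M.actA)
  (π₂ : MarkovStrategy M.actB)

theorem measurable_discount_right (lam : ℝ) (p : ℝ × S) :
    Measurable (M.discount π₁ π₂ lam p) := by
  simpa only [Function.comp_def] using
    (M.measurable_discount π₁ π₂ lam).comp (measurable_prodMk_left (x := p))

theorem discount_zero (p : ℝ × S) (z : ℝ) : M.discount π₁ π₂ 0 p z = 1 := by
  simp [discount]

end Discount

variable {S A B : Type*} [TopologicalSpace S] [MeasurableSpace S] [MeasurableEq S]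
  [MeasurableSpace A] [MeasurableSpace B]

/-! ### One step of the embedded chain as a first-jump equation -/

section FirstStep

variable (M : Game S A B) (π₁ : MarkovStrategy M.actA) (π₂ : MarkovStrategy M.actB)

theorem lintegral_nextJump_mul (p : ℝ × S) {f : ℝ → ℝ≥0∞} (hf : Measurable f)
    {u : ℝ × S → ℝ≥0∞} (hu : Measurable u) :
    ∫⁻ w, f w.1 * u w ∂(M.nextJump π₁ π₂ p) =
      ∫⁻ z in Ioi p.1, f z * M.survival π₁ π₂ p z * M.lineJump π₁ π₂ u p z := by
  rw [M.lintegral_nextJump π₁ π₂ p (F := fun w => f w.1 * u w) ((hf.comp measurable_fst).mul hu)]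
  refine lintegral_congr fun z => ?_
  simp only [lineJump]
  rw [lintegral_const_mul _ (f := fun y => u (z, y)) (hu.comp measurable_prodMk_left)]
  ring

theorem setLIntegral_Ioi_ite {s T : ℝ} {P : ℝ → Prop} [DecidablePred P] {f g : ℝ → ℝ≥0∞}
    (hP : ∀ z, s < z → (P z ↔ z ≤ T)) :
    ∫⁻ z in Ioi s, (if P z then f z else 0) * g z = ∫⁻ z in Ioc s T, f z * g z := by
  have h1 : ∀ z ∈ Ioi s, (if P z then f z else 0) * g z =
      (Iic T).indicator (fun z => f z * g z) z := by
    intro z hz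
    by_cases h : z ≤ T
    · rw [if_pos ((hP z hz).2 h), indicator_of_mem (by exact h)]
    · rw [if_neg (fun h' => h ((hP z hz).1 h')), indicator_of_notMem (by simpa using h), zero_mul]
  rw [setLIntegral_congr_fun measurableSet_Ioi h1, lintegral_indicator measurableSet_Iic,
    Measure.restrict_restrict measurableSet_Iic, inter_comm]
  rfl

variable {M π₁ π₂} {T lam : ℝ} {V : S → ℝ} {κ k₀ k₁ : ℝ}

/-- The density of the first jump time is minus the derivative of the survival probability. -/
theorem LineBounds.jumpOp_one_add_survival (h : M.LineBounds π₁ π₂ T V κ k₀ k₁) {p : ℝ × S}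
    (hp : p.1 ∈ Icc 0 T) :
    M.jumpOp π₁ π₂ T 0 (fun _ => 1) p + M.survival π₁ π₂ p T = 1 := by
  have hTm : T ∈ Icc p.1 T := ⟨hp.2, le_rfl⟩
  have hβ := h.intervalIntegrable_lineExponent 0 p hp.1 le_rfl hp.2
  have hs : M.survival π₁ π₂ p T =
      ENNReal.ofReal (expInt (M.lineExponent π₁ π₂ 0 p) p.1 T) := by
    rw [← h.weight_eq 0 hp.1 hTm, M.discount_zero π₁ π₂, one_mul]
  have hint : ∫ z in Ioc p.1 T,
      expInt (M.lineExponent π₁ π₂ 0 p) p.1 z * M.lineRate π₁ π₂ p z =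
        1 - expInt (M.lineExponent π₁ π₂ 0 p) p.1 T := by
    have h1 := integral_mul_expInt hβ
    rw [← intervalIntegral.integral_of_le hp.2]
    have h2 : ∀ z, expInt (M.lineExponent π₁ π₂ 0 p) p.1 z * M.lineRate π₁ π₂ p z =
        - (M.lineExponent π₁ π₂ 0 p z * expInt (M.lineExponent π₁ π₂ 0 p) p.1 z) := by
      intro z
      have : M.lineExponent π₁ π₂ 0 p z = - M.lineRate π₁ π₂ p z := by simp [lineExponent]
      rw [this]
      ring
    simp only [h2, intervalIntegral.integral_neg, h1]
    ring
  have hnn : ∀ z, 0 ≤ expInt (M.lineExponent π₁ π₂ 0 p) p.1 z * M.lineRate π₁ π₂ p z := fun z =>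
    mul_nonneg (expInt_pos _ _ _).le (M.lineRate_nonneg π₁ π₂ p z)
  have hj : M.jumpOp π₁ π₂ T 0 (fun _ => 1) p =
      ENNReal.ofReal (1 - expInt (M.lineExponent π₁ π₂ 0 p) p.1 T) := by
    rw [← hint, ofReal_integral_eq_lintegral_ofReal
      ((intervalIntegrable_iff_integrableOn_Ioc_of_le hp.2).1
        (intervalIntegrable_expInt_mul hβ (h.intervalIntegrable_lineRate p hp.1 le_rfl hp.2)))
      (ae_of_all _ hnn)]
    refine setLIntegral_congr_fun measurableSet_Ioc fun z hz => ?_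
    rw [h.weight_eq 0 hp.1 (Ioc_subset_Icc_self hz), ENNReal.ofReal_mul (expInt_pos _ _ _).le,
      lineJump, lintegral_one, lineRate, ofReal_rate]
  have h1 : 0 ≤ 1 - expInt (M.lineExponent π₁ π₂ 0 p) p.1 T := by
    rw [← hint]
    exact setIntegral_nonneg measurableSet_Ioc fun z _ => hnn z
  rw [hj, hs, ← ENNReal.ofReal_add h1 (expInt_pos _ _ _).le]
  simp

/-- The probability of no jump up to time `T`. -/
theorem LineBounds.nextJump_gt_add (h : M.LineBounds π₁ π₂ T V κ k₀ k₁) {p : ℝ × S}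
    (hp : p.1 ∈ Icc 0 T) :
    M.nextJump π₁ π₂ p {w | T < w.1} + (1 - M.nextJump π₁ π₂ p univ) = M.survival π₁ π₂ p T := by
  have hs : MeasurableSet {w : ℝ × S | w.1 ≤ T} := measurableSet_le measurable_fst measurable_const
  have hle : M.nextJump π₁ π₂ p {w | w.1 ≤ T} = M.jumpOp π₁ π₂ T 0 (fun _ => 1) p := by
    have h1 := M.lintegral_nextJump_mul π₁ π₂ p (f := fun z => if z ≤ T then 1 else 0)
      (Measurable.ite measurableSet_Iic measurable_const measurable_const)
      (u := fun _ => 1) measurable_const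
    have h2 : ∀ w : ℝ × S, (if w.1 ≤ T then (1 : ℝ≥0∞) else 0) * 1 =
        {w : ℝ × S | w.1 ≤ T}.indicator 1 w := by
      intro w; by_cases hw : w.1 ≤ T <;> simp [hw]
    simp only [h2, lintegral_indicator_one hs, mul_assoc] at h1
    rw [h1, setLIntegral_Ioi_ite (T := T) fun z _ => Iff.rfl, jumpOp]
    simp only [M.discount_zero π₁ π₂, mul_assoc]
  have hcompl : {w : ℝ × S | T < w.1} = {w : ℝ × S | w.1 ≤ T}ᶜ := by ext; simp
  have hadd : M.nextJump π₁ π₂ p {w | w.1 ≤ T} + M.nextJump π₁ π₂ p {w | T < w.1} =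
      M.nextJump π₁ π₂ p univ := by
    rw [hcompl, measure_add_measure_compl hs]
  have hone := h.jumpOp_one_add_survival hp
  rw [← hle] at hone
  -- Finite mass is needed to cancel it in `ℝ≥0∞`.
  have hfin : M.nextJump π₁ π₂ p {w | w.1 ≤ T} ≠ ∞ := fun hcon => by
    rw [hcon] at hone; simp at hone
  refine (ENNReal.add_right_inj hfin).1 ?_
  rw [hone, ← add_assoc, hadd]
  exact add_tsub_cancel_of_le (M.nextJump_le_one π₁ π₂ p)

/-- A jump after `T` and no jump at all are rewarded alike, with joint probability `survival`; a
jump up to `T` contributes the jump operator. -/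
theorem LineBounds.lintegral_step_eq (h : M.LineBounds π₁ π₂ T V κ k₀ k₁) (lam : ℝ)
    {σ : ℝ × S → ℝ≥0∞} (hσ : Measurable σ) {u : (ℝ × S) ⊕ Unit → ℝ≥0∞} (hu : Measurable u)
    {p : ℝ × S} (hp : p.1 ∈ Icc 0 T) :
    ∫⁻ z', (stayReward T σ (Sum.inl p, z') + M.jumpDiscount π₁ π₂ T lam (Sum.inl p, z') * u z')
        ∂(M.step π₁ π₂ (Sum.inl p)) =
      σ p * M.survival π₁ π₂ p T + M.jumpOp π₁ π₂ T lam (fun w => u (Sum.inl w)) p := by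
  have hA : Measurable fun z' => stayReward T σ (Sum.inl p, z') :=
    (measurable_stayReward T hσ).comp measurable_prodMk_left
  have hD : Measurable fun z' => M.jumpDiscount π₁ π₂ T lam (Sum.inl p, z') :=
    (M.measurable_jumpDiscount π₁ π₂ T lam).comp measurable_prodMk_left
  have hs : MeasurableSet {w : ℝ × S | T < w.1} := measurableSet_lt measurable_const measurable_fst
  rw [M.lintegral_step π₁ π₂ p (F := fun z' => stayReward T σ (Sum.inl p, z') +
      M.jumpDiscount π₁ π₂ T lam (Sum.inl p, z') * u z') (hA.add (hD.mul hu)),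
    lintegral_add_left (f := fun w => stayReward T σ (Sum.inl p, Sum.inl w))
      (hA.comp measurable_inl)]
  have h1 : ∫⁻ w, stayReward T σ (Sum.inl p, Sum.inl w) ∂(M.nextJump π₁ π₂ p) =
      σ p * M.nextJump π₁ π₂ p {w | T < w.1} := by
    rw [← lintegral_indicator_const hs]
    refine lintegral_congr fun w => ?_
    by_cases hw : T < w.1 <;> simp [stayReward, hw]
  have h2 : ∫⁻ w, M.jumpDiscount π₁ π₂ T lam (Sum.inl p, Sum.inl w) * u (Sum.inl w)
      ∂(M.nextJump π₁ π₂ p) = M.jumpOp π₁ π₂ T lam (fun w => u (Sum.inl w)) p := by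
    have hf : Measurable fun z => if p.1 < z ∧ z ≤ T then M.discount π₁ π₂ lam p z else 0 :=
      Measurable.ite measurableSet_Ioc (M.measurable_discount_right π₁ π₂ lam p) measurable_const
    have h3 := M.lintegral_nextJump_mul π₁ π₂ p hf (hu.comp measurable_inl)
    simp only [mul_assoc] at h3
    rw [setLIntegral_Ioi_ite (T := T) fun z hz => and_iff_right hz] at h3
    refine h3.trans ?_
    simp only [jumpOp, mul_assoc]
    rfl
  rw [h1, h2, ← h.nextJump_gt_add hp, mul_add]
  simp only [stayReward, jumpDiscount, zero_mul]
  ring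

end FirstStep

/-! ### The value of the chain and non-explosion -/

section Value

variable (M : Game S A B) (π₁ : MarkovStrategy M.actA) (π₂ : MarkovStrategy M.actB)

/-- The expectation of `σ`, evaluated at the last jump before `T`, discounted by the factors
`exp (λ ∫ c)` of the previous sojourns. -/
def chainValue (T lam : ℝ) (σ : ℝ × S → ℝ≥0∞) (p : ℝ × S) : ℝ≥0∞ :=
  pathValue (M.step π₁ π₂) (stayReward T σ) (M.jumpDiscount π₁ π₂ T lam) (Sum.inl p)

theorem measurable_chainValue (T lam : ℝ) {σ : ℝ × S → ℝ≥0∞} (hσ : Measurable σ) :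
    Measurable (M.chainValue π₁ π₂ T lam σ) :=
  (measurable_pathValue _ (measurable_stayReward T hσ)
    (M.measurable_jumpDiscount π₁ π₂ T lam)).comp measurable_inl

variable {M π₁ π₂} {T lam : ℝ} {V : S → ℝ} {κ k₀ k₁ : ℝ}

theorem LineBounds.chainValue_eq (h : M.LineBounds π₁ π₂ T V κ k₀ k₁) (lam : ℝ)
    {σ : ℝ × S → ℝ≥0∞} (hσ : Measurable σ) {p : ℝ × S} (hp : p.1 ∈ Icc 0 T) :
    M.chainValue π₁ π₂ T lam σ p = σ p * M.survival π₁ π₂ p T +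
      M.jumpOp π₁ π₂ T lam (M.chainValue π₁ π₂ T lam σ) p := by
  have hA := measurable_stayReward T hσ
  have hD := M.measurable_jumpDiscount π₁ π₂ T lam
  rw [chainValue, pathValue_eq _ hA hD,
    h.lintegral_step_eq lam hσ (measurable_pathValue _ hA hD) hp]
  rfl

/-- The inequality for `H` is required for times in `[0, T]` only; it propagates because later jumps
count only up to time `T`. -/
theorem LineBounds.chainValue_le (h : M.LineBounds π₁ π₂ T V κ k₀ k₁) {σ H : ℝ × S → ℝ≥0∞}
    (hσ : Measurable σ) (hH : ∀ p : ℝ × S, p.1 ∈ Icc 0 T →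
      σ p * M.survival π₁ π₂ p T + M.jumpOp π₁ π₂ T lam H p ≤ H p)
    {p : ℝ × S} (hp : p.1 ∈ Icc 0 T) : M.chainValue π₁ π₂ T lam σ p ≤ H p := by
  refine pathValue_le (M.step π₁ π₂) (measurable_stayReward T hσ)
    (M.measurable_jumpDiscount π₁ π₂ T lam)
    (P := Sum.elim (fun p => p.1 ∈ Icc 0 T) fun _ => False) (H := Sum.elim H 0)
    (fun u hum hu z hz => ?_) (z := Sum.inl p) hp
  cases z with
  | inr _ => exact hz.elim
  | inl q =>
    have hq : q.1 ∈ Icc 0 T := hz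
    rw [h.lintegral_step_eq lam hσ hum hq]
    refine le_trans ?_ (hH q hq)
    gcongr
    exact M.jumpOp_mono π₁ π₂ fun z hz y => hu (Sum.inl (z, y)) ⟨hq.1.trans hz.1.le, hz.2⟩

/-- Under the drift condition the process almost surely reaches time `T` by finitely many jumps. -/
theorem LineBounds.chainValue_one (h : M.LineBounds π₁ π₂ T V κ k₀ k₁)
    (hV : M.DriftCondition T V) {p : ℝ × S} (hp : p.1 ∈ Icc 0 T) :
    M.chainValue π₁ π₂ T 0 (fun _ => 1) p = 1 := by
  obtain ⟨ρ, b, hρ, hb, hd⟩ := hV.lintegral_le (T := T) π₁ π₂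
  have hone : ∀ p : ℝ × S, p.1 ∈ Icc 0 T →
      1 * M.survival π₁ π₂ p T + M.jumpOp π₁ π₂ T 0 (fun _ => 1) p = 1 := fun p hp => by
    rw [one_mul, add_comm, h.jumpOp_one_add_survival hp]
  -- With `λ = 0` and `σ = 1` the chain value is the probability of passing time `T` after finitely
  -- many jumps; the constant `1` solves the same equation. The defect `1 - chainValue` is thus a
  -- bounded subsolution of the homogeneous equation.
  have hm := M.measurable_chainValue π₁ π₂ T 0 (σ := fun _ => 1) measurable_const
  have hle : ∀ p : ℝ × S, p.1 ∈ Icc 0 T → M.chainValue π₁ π₂ T 0 (fun _ => 1) p ≤ 1 :=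
    fun p hp => h.chainValue_le measurable_const (H := fun _ => 1) (fun q hq => (hone q hq).le) hp
  -- With `p₀ = 1` and `c₁ = 0` the barrier is `V` up to an exponential factor, hence at least `1 /
  -- ε` when `V` is.
  have hbar : ∀ p : ℝ × S, M.barrier T V (ρ + b + 0) 1 0 p =
      ENNReal.ofReal (Real.exp ((ρ + b) * (T - p.1)) * V (M.endpoint T p)) := fun p => by
    simp [barrier]
  have hsuper : ∀ p : ℝ × S, p.1 ∈ Icc 0 T →
      M.jumpOp π₁ π₂ T 0 (M.barrier T V (ρ + b + 0) 1 0) p ≤ M.barrier T V (ρ + b + 0) 1 0 p :=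
    fun p hp => le_add_self.trans (h.barrier_supersolution (lam := 0) hV.measurable hV.one_le hρ hb
      le_rfl zero_le_one (by simp) hd (by simp) hp)
  have hzero := h.eq_zero_of_le_jumpOp (lam := 0) le_rfl zero_le_one
    (w := fun q => 1 - M.chainValue π₁ π₂ T 0 (fun _ => 1) q)
    (H := M.barrier T V (ρ + b + 0) 1 0) ?_ (M.measurable_barrier T hV.measurable _ _ _) hsuper
    (fun p => ENNReal.ofReal_ne_top) ?_ ?_ hp
  · exact le_antisymm (hle p hp) (tsub_eq_zero_iff_le.1 hzero)
  · intro p hp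
    refine tsub_le_iff_right.2 ?_
    calc (1 : ℝ≥0∞) = 1 * M.survival π₁ π₂ p T + M.jumpOp π₁ π₂ T 0 (fun _ => 1) p :=
          (hone p hp).symm
      _ ≤ 1 * M.survival π₁ π₂ p T +
          M.jumpOp π₁ π₂ T 0 (fun q => (1 - M.chainValue π₁ π₂ T 0 (fun _ => 1) q) +
            M.chainValue π₁ π₂ T 0 (fun _ => 1) q) p := by
          gcongr
          exact M.jumpOp_mono π₁ π₂ fun z _ y => le_tsub_add
      _ = _ := by
          rw [M.jumpOp_add π₁ π₂ _ hm]
          conv_rhs => rw [h.chainValue_eq 0 measurable_const hp]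
          ring
  · intro ε hε
    refine ⟨1 / ε, fun p hp hN => tsub_le_self.trans ?_⟩
    rw [hbar, ← ENNReal.ofReal_mul hε.le, ← ENNReal.ofReal_one]
    refine ENNReal.ofReal_le_ofReal ?_
    have h1 : 1 ≤ Real.exp ((ρ + b) * (T - p.1)) :=
      Real.one_le_exp (mul_nonneg (by positivity) (by linarith [hp.2]))
    have h2 : 1 ≤ ε * V (M.endpoint T p) := by
      rwa [div_le_iff₀ hε, mul_comm] at hN
    have h3 := hV.one_le (M.endpoint T p)
    calc (1 : ℝ) ≤ ε * (1 * V (M.endpoint T p)) := by rwa [one_mul]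
      _ ≤ _ := by gcongr
  · exact fun N => ⟨1, zero_le_one, fun p _ _ => tsub_le_self.trans (by simp)⟩

end Value

end Game

end PDMG

end

noncomputable section

namespace PDMG


namespace Game

/-! ### Paths of the process and discounted sums -/

section Paths

variable {S A B : Type*} [TopologicalSpace S] [MeasurableSpace S]
  [MeasurableSpace A] [MeasurableSpace B] (M : Game S A B)

theorem state_of_lt_jumpTime {ω : ℕ → (ℝ × S) ⊕ Unit} {p : ℝ × S} (h0 : ω 0 = Sum.inl p) {t : ℝ}
    (hp : p.1 ≤ t) (ht : (t : WithTop ℝ) < jumpTime ω 1) :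
    M.state ω t = some (M.flow p.2 (t - p.1)) := by
  have h : jumpTime ω 0 ≤ t ∧ (t : WithTop ℝ) < jumpTime ω (0 + 1) :=
    ⟨by simpa [jumpTime, h0] using hp, ht⟩
  rw [state, dif_pos ⟨0, h⟩, (Nat.find_eq_zero _).2 h, h0]
  rfl

theorem state_of_jumpTime_le {ω : ℕ → (ℝ × S) ⊕ Unit} {t : ℝ} (ht : jumpTime ω 1 ≤ t) :
    M.state ω t = M.state (fun k => ω (k + 1)) t := by
  have h0 : ¬ (jumpTime ω 0 ≤ t ∧ (t : WithTop ℝ) < jumpTime ω (0 + 1)) :=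
    fun h => absurd h.2 (not_lt.2 ht)
  by_cases h : ∃ n, jumpTime (fun k => ω (k + 1)) n ≤ t ∧
      (t : WithTop ℝ) < jumpTime (fun k => ω (k + 1)) (n + 1)
  · have h' : ∃ n, jumpTime ω n ≤ t ∧ (t : WithTop ℝ) < jumpTime ω (n + 1) := by
      obtain ⟨n, hn⟩ := h
      exact ⟨n + 1, hn⟩
    rw [state, dif_pos h', state, dif_pos h, Nat.find_comp_succ h' h h0]
    rfl
  · have h' : ¬ ∃ n, jumpTime ω n ≤ t ∧ (t : WithTop ℝ) < jumpTime ω (n + 1) := by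
      rintro ⟨n, hn⟩
      cases n with
      | zero => exact h0 hn
      | succ n => exact h ⟨n, hn⟩
    rw [state, dif_neg h', state, dif_neg h]

variable (π₁ : MarkovStrategy M.actA) (π₂ : MarkovStrategy M.actB)

/-- The exponential cost collected from `p` on if no further jump occurs up to time `T`. -/
def stayCost (T lam : ℝ) (p : ℝ × S) : ℝ≥0∞ :=
  M.discount π₁ π₂ lam p T * ENNReal.ofReal (Real.exp (lam * M.g T (M.endpoint T p)))

theorem measurable_stayCost {T : ℝ} (hT : 0 ≤ T) (lam : ℝ) :
    Measurable (M.stayCost π₁ π₂ T lam) := by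
  have h1 : Measurable fun p => M.discount π₁ π₂ lam p T := by
    simpa only [Function.comp_def] using
      (M.measurable_discount π₁ π₂ lam).comp (measurable_prodMk_right (y := T))
  have h2 : Measurable fun p => M.g T (M.endpoint T p) :=
    (M.measurable_terminal hT).comp (M.measurable_endpoint T)
  exact h1.mul (Real.measurable_exp.comp (h2.const_mul lam)).ennreal_ofReal

variable {M π₁ π₂} {T lam : ℝ} {V : S → ℝ} {κ k₀ k₁ : ℝ}

theorem pathSum_of_lt_jumpTime {ω : ℕ → (ℝ × S) ⊕ Unit} {p : ℝ × S} (h0 : ω 0 = Sum.inl p)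
    (hT : (T : WithTop ℝ) < jumpTime ω 1) (σ : ℝ × S → ℝ≥0∞) (n : ℕ) :
    pathSum (stayReward T σ) (M.jumpDiscount π₁ π₂ T lam) (n + 1) ω = σ p := by
  rw [pathSum, h0]
  rcases h1 : ω 1 with w | _
  · have hw : T < w.1 := by simpa [jumpTime, h1] using hT
    simp [stayReward, jumpDiscount, hw, not_le.2 hw]
  · simp [stayReward, jumpDiscount]

theorem pathSum_of_le {ω : ℕ → (ℝ × S) ⊕ Unit} {p w : ℝ × S} (h0 : ω 0 = Sum.inl p)
    (h1 : ω 1 = Sum.inl w) (hw : w.1 ≤ T) (σ : ℝ × S → ℝ≥0∞) (n : ℕ) :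
    pathSum (stayReward T σ) (M.jumpDiscount π₁ π₂ T lam) (n + 1) ω =
      (if p.1 < w.1 then M.discount π₁ π₂ lam p w.1 else 0) *
        pathSum (stayReward T σ) (M.jumpDiscount π₁ π₂ T lam) n fun k => ω (k + 1) := by
  rw [pathSum, h0, h1]
  simp [stayReward, jumpDiscount, not_lt.2 hw, hw]

/-- Without discount the reward `1` is collected at most once, at the sojourn that reaches beyond
`T`. -/
theorem pathSum_one_le_one (n : ℕ) (ω : ℕ → (ℝ × S) ⊕ Unit) :
    pathSum (stayReward T fun _ => 1) (M.jumpDiscount π₁ π₂ T 0) n ω ≤ 1 := by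
  induction n generalizing ω with
  | zero => exact zero_le
  | succ n ih =>
    rcases h0 : ω 0 with p | _
    · by_cases hT : (T : WithTop ℝ) < jumpTime ω 1
      · rw [pathSum_of_lt_jumpTime h0 hT]
      · rcases h1 : ω 1 with w | _
        · have hw : w.1 ≤ T := by simpa [jumpTime, h1] using hT
          rw [pathSum_of_le h0 h1 hw]
          refine mul_le_one' ?_ (ih _)
          split_ifs
          · rw [M.discount_zero π₁ π₂]
          · exact zero_le
        · simp [jumpTime, h1] at hT
    · simp [pathSum, h0, stayReward, jumpDiscount]

theorem expCost_pos (s : ℝ) (ω : ℕ → (ℝ × S) ⊕ Unit) : 0 < M.expCost π₁ π₂ T lam s ω :=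
  Real.exp_pos _

/-- Since `λ ≤ 1 ≤ T + 1`, the square of `exp (λ g)` is at most `M₂ V`. The strategies supply the
admissible actions under which the assumption speaks about `g`. -/
theorem DriftCondition.exp_terminal_le (hV : M.DriftCondition T V) (hT : 0 ≤ T)
    (π₁ : MarkovStrategy M.actA) (π₂ : MarkovStrategy M.actB) (hlam : 0 ≤ lam) (hlam1 : lam ≤ 1) :
    ∃ C : ℝ, 0 ≤ C ∧ ∀ x, Real.exp (lam * M.g T x) ≤ C * V x ^ (1 / 2 : ℝ) := by
  obtain ⟨M₂, hM₂, hc⟩ := hV.cost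
  refine ⟨√M₂, Real.sqrt_nonneg _, fun x => ?_⟩
  obtain ⟨a, b, hab⟩ := M.exists_mem_K π₁ π₂ hT x
  have h1 := (hc T x a b hab le_rfl).2
  rw [sub_self, M.flow_zero] at h1
  rw [← Real.sqrt_eq_rpow, ← Real.sqrt_mul (by linarith)]
  refine Real.le_sqrt_of_sq_le (le_trans ?_ h1)
  rw [← Real.exp_nat_mul, Real.exp_le_exp]
  have h2 : lam * M.g T x ≤ |M.g T x| := by
    calc lam * M.g T x ≤ lam * |M.g T x| := by gcongr; exact le_abs_self _
      _ ≤ 1 * |M.g T x| := by gcongr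
      _ = _ := one_mul _
  push_cast
  nlinarith [abs_nonneg (M.g T x)]

variable [MeasurableEq S]

/-- A nonzero undiscounted sum certifies that the jump times increase until the path passes `T`
within `n` jumps. On such a path the cost integral splits over the sojourns, just as the discounted
sum multiplies their factors. -/
theorem LineBounds.path_of_pathSum_ne_zero (h : M.LineBounds π₁ π₂ T V κ k₀ k₁) (lam : ℝ) {n : ℕ}
    {ω : ℕ → (ℝ × S) ⊕ Unit} {p : ℝ × S} (h0 : ω 0 = Sum.inl p) (hp : p.1 ∈ Icc 0 T)
    (hn : pathSum (stayReward T fun _ => 1) (M.jumpDiscount π₁ π₂ T 0) n ω ≠ 0) :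
    (∀ t ∈ Icc p.1 T, (M.state ω t).isSome) ∧
    IntervalIntegrable (M.pathCost π₁ π₂ ω) volume p.1 T ∧
    pathSum (stayReward T (M.stayCost π₁ π₂ T lam)) (M.jumpDiscount π₁ π₂ T lam) n ω =
      ENNReal.ofReal (M.expCost π₁ π₂ T lam p.1 ω) := by
  induction n generalizing ω p with
  | zero => exact absurd rfl hn
  | succ n ih =>
    by_cases hT : (T : WithTop ℝ) < jumpTime ω 1
    · have hs : ∀ t ∈ Icc p.1 T, M.state ω t = some (M.flow p.2 (t - p.1)) := fun t ht =>
        M.state_of_lt_jumpTime h0 ht.1 (lt_of_le_of_lt (by exact_mod_cast ht.2) hT)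
      have hc : ∀ t ∈ Icc p.1 T, M.pathCost π₁ π₂ ω t = M.lineCost π₁ π₂ p t := fun t ht => by
        simp [pathCost, hs t ht, lineCost]
      refine ⟨fun t ht => by simp [hs t ht], ?_, ?_⟩
      · refine (h.intervalIntegrable_lineCost p hp.1 le_rfl hp.2).congr fun t ht => ?_
        rw [uIoc_of_le hp.2] at ht
        exact (hc t (Ioc_subset_Icc_self ht)).symm
      · rw [pathSum_of_lt_jumpTime h0 hT, stayCost, discount,
          ← ENNReal.ofReal_mul (Real.exp_pos _).le, ← Real.exp_add, expCost,
          hs T ⟨hp.2, le_rfl⟩, intervalIntegral.integral_of_le hp.2,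
          setIntegral_congr_fun measurableSet_Ioc fun t ht => hc t (Ioc_subset_Icc_self ht)]
        rfl
    · rcases h1 : ω 1 with w | _
      swap
      · simp [jumpTime, h1] at hT
      have hw : w.1 ≤ T := by simpa [jumpTime, h1] using hT
      rw [pathSum_of_le h0 h1 hw] at hn ⊢
      -- A jump that does not move forward in time has discount zero.
      have hpw : p.1 < w.1 := by
        by_contra hcon
        simp [hcon] at hn
      rw [if_pos hpw] at hn ⊢
      obtain ⟨ih1, ih2, ih3⟩ := ih (ω := fun k => ω (k + 1)) (p := w) h1
        ⟨hp.1.trans hpw.le, hw⟩ (right_ne_zero_of_mul hn)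
      have hj : jumpTime ω 1 = w.1 := by simp [jumpTime, h1]
      have hs1 : ∀ t ∈ Ico p.1 w.1, M.state ω t = some (M.flow p.2 (t - p.1)) := fun t ht =>
        M.state_of_lt_jumpTime h0 ht.1 (by rw [hj]; exact_mod_cast ht.2)
      have hs2 : ∀ t, w.1 ≤ t → M.state ω t = M.state (fun k => ω (k + 1)) t := fun t ht =>
        M.state_of_jumpTime_le (by rw [hj]; exact_mod_cast ht)
      have hc1 : ∀ t ∈ Ico p.1 w.1, M.lineCost π₁ π₂ p t = M.pathCost π₁ π₂ ω t := fun t ht => by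
        simp [pathCost, hs1 t ht, lineCost]
      -- At the jump time itself the path may already have left the flow line; a single instant does
      -- not affect the integral.
      have hc1' : ∀ᵐ t, t ∈ uIoc p.1 w.1 → M.lineCost π₁ π₂ p t = M.pathCost π₁ π₂ ω t := by
        filter_upwards [volume.ae_ne w.1] with t ht hmem
        rw [uIoc_of_le hpw.le] at hmem
        exact hc1 t ⟨hmem.1.le, lt_of_le_of_ne hmem.2 ht⟩
      have hc2 : ∀ t, w.1 ≤ t →
          M.pathCost π₁ π₂ (fun k => ω (k + 1)) t = M.pathCost π₁ π₂ ω t := fun t ht => by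
        simp only [pathCost, hs2 t ht]
      have hi1 : IntervalIntegrable (M.pathCost π₁ π₂ ω) volume p.1 w.1 :=
        (h.intervalIntegrable_lineCost p hp.1 hw hpw.le).congr_ae
          ((ae_restrict_iff' measurableSet_uIoc).2 hc1')
      have hi2 : IntervalIntegrable (M.pathCost π₁ π₂ ω) volume w.1 T := by
        refine ih2.congr fun t ht => hc2 t ?_
        rw [uIoc_of_le hw] at ht
        exact ht.1.le
      refine ⟨fun t ht => ?_, hi1.trans hi2, ?_⟩
      · rcases lt_or_ge t w.1 with htw | htw
        · simp [hs1 t ⟨ht.1, htw⟩]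
        · rw [hs2 t htw]
          exact ih1 t ⟨htw, ht.2⟩
      · rw [ih3, discount, ← ENNReal.ofReal_mul (Real.exp_pos _).le, expCost, ← Real.exp_add,
          expCost, hs2 T hw, ← intervalIntegral.integral_add_adjacent_intervals hi1 hi2,
          ← intervalIntegral.integral_congr_ae hc1', intervalIntegral.integral_of_le hpw.le,
          intervalIntegral.integral_congr (g := M.pathCost π₁ π₂ ω) (a := w.1) (b := T)
            fun t ht => hc2 t (by rw [uIcc_of_le hw] at ht; exact ht.1)]
        congr 2
        ring

end Paths

/-! ### The risk-sensitive cost as a chain value -/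

section RiskCost

variable {S A B : Type*} [TopologicalSpace S] [MeasurableSpace S] [MeasurableEq S]
  [MeasurableSpace A] [MeasurableSpace B] {M : Game S A B}
  {π₁ : MarkovStrategy M.actA} {π₂ : MarkovStrategy M.actB}
  {T lam : ℝ} {V V₁ : S → ℝ} {κ k₀ k₁ : ℝ}

theorem law_eq_chainLaw (M : Game S A B) (π₁ : MarkovStrategy M.actA)
    (π₂ : MarkovStrategy M.actB) (s : ℝ) (x : S) :
    M.law π₁ π₂ s x = chainLaw (M.step π₁ π₂) (Sum.inl (s, x)) := rfl

theorem LineBounds.ae_pathSum_ne_zero (h : M.LineBounds π₁ π₂ T V κ k₀ k₁)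
    (hV : M.DriftCondition T V) {s : ℝ} (hs : s ∈ Icc 0 T) (x : S) :
    ∀ᵐ ω ∂(M.law π₁ π₂ s x), ω 0 = Sum.inl (s, x) ∧
      ∃ n, pathSum (stayReward T fun _ => 1) (M.jumpDiscount π₁ π₂ T 0) n ω ≠ 0 := by
  rw [law_eq_chainLaw]
  have h0 := ae_chainLaw_zero (M.step π₁ π₂) (measurableSet_singleton (Sum.inl (s, x)))
    (mem_singleton _)
  have hm : ∫⁻ ω, (⨆ n, pathSum (stayReward T fun _ => 1) (M.jumpDiscount π₁ π₂ T 0) n ω)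
      ∂(chainLaw (M.step π₁ π₂) (Sum.inl (s, x))) = 1 :=
    h.chainValue_one hV (p := (s, x)) hs
  have h1 := ae_eq_of_ae_le_of_lintegral_le (g := fun _ => 1)
    (μ := chainLaw (M.step π₁ π₂) (Sum.inl (s, x)))
    (ae_of_all _ fun ω => iSup_le fun n => pathSum_one_le_one (M := M) (π₁ := π₁) (π₂ := π₂)
      (T := T) n ω) (by rw [hm]; exact ENNReal.one_ne_top) aemeasurable_const (by rw [hm]; simp)
  filter_upwards [h0, h1] with ω hω0 hω1
  refine ⟨hω0, ?_⟩
  by_contra! hcon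
  simp only [hcon] at hω1
  simp at hω1

theorem LineBounds.ae_iSup_pathSum (h : M.LineBounds π₁ π₂ T V κ k₀ k₁)
    (hV : M.DriftCondition T V) (lam : ℝ) {s : ℝ} (hs : s ∈ Icc 0 T) (x : S) :
    ∀ᵐ ω ∂(M.law π₁ π₂ s x), (∀ t ∈ Icc s T, (M.state ω t).isSome) ∧
      IntervalIntegrable (M.pathCost π₁ π₂ ω) volume s T ∧
      ⨆ n, pathSum (stayReward T (M.stayCost π₁ π₂ T lam)) (M.jumpDiscount π₁ π₂ T lam) n ω =
        ENNReal.ofReal (M.expCost π₁ π₂ T lam s ω) := by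
  filter_upwards [h.ae_pathSum_ne_zero hV hs x] with ω ⟨h0, n, hn⟩
  have hn' : ∀ m, n ≤ m →
      pathSum (stayReward T fun _ => 1) (M.jumpDiscount π₁ π₂ T 0) m ω ≠ 0 := fun m hm =>
    ((pos_iff_ne_zero.2 hn).trans_le (monotone_pathSum ω hm)).ne'
  obtain ⟨h1, h2, h3⟩ := h.path_of_pathSum_ne_zero lam h0 hs hn
  refine ⟨h1, h2, le_antisymm (iSup_le fun m => ?_) (h3 ▸ le_iSup_of_le n le_rfl)⟩
  -- The sums increase in `m`, and from index `n` on they are equal to the exponential cost.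
  rw [← (h.path_of_pathSum_ne_zero lam h0 hs (hn' (max m n) (le_max_right _ _))).2.2]
  exact monotone_pathSum ω (le_max_left m n)

/-- Measurability of the path functionals is avoided: the cost agrees almost surely with a supremum
of measurable sums. -/
theorem LineBounds.aemeasurable_expCost (h : M.LineBounds π₁ π₂ T V κ k₀ k₁)
    (hV : M.DriftCondition T V) (hT : 0 ≤ T) (lam : ℝ) {s : ℝ} (hs : s ∈ Icc 0 T) (x : S) :
    AEMeasurable (M.expCost π₁ π₂ T lam s) (M.law π₁ π₂ s x) := by
  refine ⟨fun ω => (⨆ n, pathSum (stayReward T (M.stayCost π₁ π₂ T lam))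
    (M.jumpDiscount π₁ π₂ T lam) n ω).toReal, (Measurable.iSup fun n => measurable_pathSum
      (measurable_stayReward T (M.measurable_stayCost π₁ π₂ hT lam))
      (M.measurable_jumpDiscount π₁ π₂ T lam) n).ennreal_toReal, ?_⟩
  filter_upwards [h.ae_iSup_pathSum hV lam hs x] with ω hω
  rw [hω.2.2, ENNReal.toReal_ofReal (expCost_pos s ω).le]

theorem LineBounds.lintegral_expCost (h : M.LineBounds π₁ π₂ T V κ k₀ k₁)
    (hV : M.DriftCondition T V) (lam : ℝ) {s : ℝ} (hs : s ∈ Icc 0 T) (x : S) :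
    ∫⁻ ω, ENNReal.ofReal (M.expCost π₁ π₂ T lam s ω) ∂(M.law π₁ π₂ s x) =
      M.chainValue π₁ π₂ T lam (M.stayCost π₁ π₂ T lam) (s, x) := by
  rw [chainValue, pathValue, ← law_eq_chainLaw]
  refine lintegral_congr_ae ?_
  filter_upwards [h.ae_iSup_pathSum hV lam hs x] with ω hω
  exact hω.2.2.symm

theorem LineBounds.riskCost_eq (h : M.LineBounds π₁ π₂ T V κ k₀ k₁)
    (hV : M.DriftCondition T V) (hT : 0 ≤ T) (lam : ℝ) {s : ℝ} (hs : s ∈ Icc 0 T) (x : S) :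
    M.riskCost π₁ π₂ T lam s x =
      (M.chainValue π₁ π₂ T lam (M.stayCost π₁ π₂ T lam) (s, x)).toReal := by
  rw [riskCost, integral_eq_lintegral_of_nonneg_ae (ae_of_all _ fun ω => (expCost_pos s ω).le)
    (h.aemeasurable_expCost hV hT lam hs x).aestronglyMeasurable, h.lintegral_expCost hV lam hs]

/-- A multiple of the barrier with `p₀ = 1/2` dominates the terminal cost, hence the chain value;
its exponent never exceeds one, so it is at most a multiple of `V`. -/
theorem LineBounds.exists_chainValue_le (hV : M.DriftCondition T V) (hT : 0 < T)
    (h : M.LineBounds π₁ π₂ T V κ k₀ (1 / (2 * (T + 1)))) (hlam : 0 ≤ lam) (hlam1 : lam ≤ 1) :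
    ∃ C : ℝ, 0 ≤ C ∧ ∀ p : ℝ × S, p.1 ∈ Icc 0 T →
      M.chainValue π₁ π₂ T lam (M.stayCost π₁ π₂ T lam) p ≤
        ENNReal.ofReal (C * V (M.endpoint T p)) := by
  obtain ⟨ρ, b, hρ, hb, hd⟩ := hV.lintegral_le (T := T) π₁ π₂
  obtain ⟨C, hC, hg⟩ := hV.exp_terminal_le hT.le π₁ π₂ hlam hlam1
  have hk₀ := h.const_nonneg.2.1
  have hc₁ : 0 ≤ 1 / (2 * (T + 1)) := by positivity
  have hp₁ : 1 / 2 + 1 / (2 * (T + 1)) * T ≤ 1 := by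
    have : 1 / (2 * (T + 1)) * T ≤ 1 / 2 := by
      rw [div_mul_eq_mul_div, div_le_div_iff₀ (by positivity) (by norm_num)]
      linarith
    linarith
  set H := M.barrier T V (ρ + b + k₀) (1 / 2) (1 / (2 * (T + 1))) with hH
  have hcost : ∀ t ∈ Icc 0 T, ∀ x, lam * M.stratCost π₁ π₂ t x ≤
      k₀ + 1 / (2 * (T + 1)) * Real.log (V (M.flow x (T - t))) := fun t ht x => by
    calc lam * M.stratCost π₁ π₂ t x ≤ lam * |M.stratCost π₁ π₂ t x| := by
          gcongr; exact le_abs_self _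
      _ ≤ 1 * |M.stratCost π₁ π₂ t x| := by gcongr
      _ ≤ _ := by rw [one_mul]; exact h.cost_le t ht x
  have hsuper : ∀ p : ℝ × S, p.1 ∈ Icc 0 T →
      M.stayCost π₁ π₂ T lam p * M.survival π₁ π₂ p T +
        M.jumpOp π₁ π₂ T lam (fun q => ENNReal.ofReal C * H q) p ≤ ENNReal.ofReal C * H p := by
    intro p hp
    rw [M.jumpOp_const_mul π₁ π₂ (M.measurable_barrier T hV.measurable _ _ _)]
    have hbar := h.barrier_supersolution hV.measurable hV.one_le hρ hb hc₁ (by norm_num) hp₁ hd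
      hcost hp
    refine le_trans ?_ (mul_le_mul_of_nonneg_left hbar (zero_le (a := ENNReal.ofReal C)))
    rw [mul_add (ENNReal.ofReal C)]
    gcongr ?_ + _
    calc M.stayCost π₁ π₂ T lam p * M.survival π₁ π₂ p T
        ≤ M.discount π₁ π₂ lam p T *
          ENNReal.ofReal (C * V (M.endpoint T p) ^ (1 / 2 : ℝ)) * M.survival π₁ π₂ p T := by
          rw [stayCost]
          gcongr
          exact hg _
      _ = _ := by
          rw [ENNReal.ofReal_mul hC]
          ring
  refine ⟨C * Real.exp ((ρ + b + k₀) * T), by positivity, fun p hp => ?_⟩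
  refine (h.chainValue_le (M.measurable_stayCost π₁ π₂ hT.le lam) hsuper hp).trans ?_
  rw [hH, barrier, ← ENNReal.ofReal_mul hC, mul_assoc]
  refine ENNReal.ofReal_le_ofReal ?_
  have h1 := hV.one_le (M.endpoint T p)
  gcongr
  · linarith [hp.1]
  · refine (Real.rpow_le_rpow_of_exponent_le h1 (le_trans ?_ hp₁)).trans_eq (Real.rpow_one _)
    gcongr
    linarith [hp.1]

end RiskCost

end Game

end PDMG

end

noncomputable section

namespace PDMG


namespace Game

/-! ### The derivative along the flow as a derivative on a line -/

section FlowDerivative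

variable {S A B : Type*} [TopologicalSpace S] [MeasurableSpace S]
  [MeasurableSpace A] [MeasurableSpace B] (M : Game S A B)

theorem flow_line (p : ℝ × S) (t v : ℝ) :
    M.flow (M.flow p.2 (t - p.1)) (v - t) = M.flow p.2 (v - p.1) := by
  rw [← M.flow_add]
  congr 1
  ring

/-- Translation of time by `s`: absolute time is the natural parameter for the equations on a line.
-/
theorem aeFlow_iff {T : ℝ} {P : ℝ → S → Prop} : M.AEFlow T P ↔ ∀ s ∈ Icc 0 T, ∀ x,
    ∀ᵐ v, v ∈ Icc s T → P v (M.flow x (v - s)) := by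
  refine forall₂_congr fun s hs => forall_congr' fun x => ?_
  rw [ae_restrict_iff' measurableSet_Icc]
  constructor
  · intro h
    filter_upwards [(measurePreserving_add_left volume (-s)).quasiMeasurePreserving.ae h]
      with v hv hmem
    have h1 := hv ⟨by linarith [hmem.1], by linarith [hmem.2]⟩
    rw [show s + (-s + v) = v by ring, show -s + v = v - s by ring] at h1
    exact h1
  · intro h
    filter_upwards [(measurePreserving_add_left volume s).quasiMeasurePreserving.ae h]
      with v hv hmem
    have h1 := hv ⟨by linarith [hmem.1], by linarith [hmem.2]⟩
    rw [add_sub_cancel_left] at h1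
    exact h1

theorem Lflow_line (u : ℝ → S → ℝ) (s t : ℝ) (x : S) :
    M.Lflow u t (M.flow x (t - s)) = deriv (fun v => u v (M.flow x (v - s))) t := by
  have h : (fun h => u (t + h) (M.flow (M.flow x (t - s)) h)) =
      fun h => (fun v => u v (M.flow x (v - s))) (t + h) := by
    ext h
    simp only
    rw [← M.flow_add]
    congr 2
    ring
  rw [Lflow, h, deriv_comp_const_add (fun v => u v (M.flow x (v - s))), add_zero]

theorem absCont_line_iff (u : ℝ → S → ℝ) (s T : ℝ) (x : S) :
    AbsolutelyContinuousOnInterval (fun t => u (s + t) (M.flow x t)) 0 (T - s) ↔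
      AbsolutelyContinuousOnInterval (fun v => u v (M.flow x (v - s))) s T := by
  constructor
  · intro h
    have h1 := absolutelyContinuousOnInterval_comp_add h (-s)
    simp only [sub_neg_eq_add, zero_add, sub_add_cancel] at h1
    refine absolutelyContinuousOnInterval_congr h1 fun t _ => ?_
    rw [show s + (-s + t) = t by ring, show -s + t = t - s by ring]
  · intro h
    have h1 := absolutelyContinuousOnInterval_comp_add h s
    rw [sub_self] at h1
    refine absolutelyContinuousOnInterval_congr h1 fun t _ => ?_
    rw [add_sub_cancel_left]

/-- Measurable functions on `[0, T] × S` that are bounded by the weight `V` at the end of the flow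
line. -/
structure WeightBounded (T : ℝ) (V : S → ℝ) (w : ℝ × S → ℝ) : Prop where
  measurable : Measurable w
  bounded : ∃ C : ℝ, 0 ≤ C ∧ ∀ p : ℝ × S, p.1 ∈ Icc 0 T → |w p| ≤ C * V (M.endpoint T p)

end FlowDerivative

/-! ### Equivalence of the differential and the integrated equation -/

section Mild

variable {S A B : Type*} [TopologicalSpace S] [MeasurableSpace S] [MeasurableEq S]
  [MeasurableSpace A] [MeasurableSpace B] (M : Game S A B)
  (π₁ : MarkovStrategy M.actA) (π₂ : MarkovStrategy M.actB)

/-- Integration of `w(v, ·)` against the jump kernel at time `v` on the flow line through `p`. -/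
def lineIntegral (w : ℝ × S → ℝ) (p : ℝ × S) (v : ℝ) : ℝ :=
  ∫ y, w (v, y) ∂(M.jumpKernel π₁ π₂ (v, M.flow p.2 (v - p.1)))

theorem measurable_lineIntegral {w : ℝ × S → ℝ} (hw : Measurable w) (p : ℝ × S) :
    Measurable (M.lineIntegral π₁ π₂ w p) := by
  have hl : Measurable fun v : ℝ => (v, M.flow p.2 (v - p.1)) :=
    M.measurable_jumpPoint.comp (measurable_prodMk_left (x := p))
  have h : StronglyMeasurable fun q : ℝ × S => w (q.1, q.2) := hw.stronglyMeasurable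
  have := (h.integral_kernel_prod_right' (f := fun q : ℝ × S => w (q.1, q.2))
    (κ := (M.jumpKernel π₁ π₂).comap _ hl)).measurable
  simpa only [Kernel.comap_apply] using! this

theorem lineExponent_line (lam : ℝ) (p : ℝ × S) (t : ℝ) :
    M.lineExponent π₁ π₂ lam (t, M.flow p.2 (t - p.1)) = M.lineExponent π₁ π₂ lam p := by
  ext v
  simp only [lineExponent, lineCost, lineRate, M.flow_line]

theorem lineIntegral_line (w : ℝ × S → ℝ) (p : ℝ × S) (t : ℝ) :
    M.lineIntegral π₁ π₂ w (t, M.flow p.2 (t - p.1)) = M.lineIntegral π₁ π₂ w p := by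
  ext v
  simp only [lineIntegral, M.flow_line]

/-- Solutions of the equation of variation of constants along the flow lines. -/
structure IsMild (T lam : ℝ) (V : S → ℝ) (w : ℝ × S → ℝ) : Prop
    extends M.WeightBounded T V w where
  eq : ∀ p : ℝ × S, p.1 ∈ Icc 0 T → w p =
    expInt (M.lineExponent π₁ π₂ lam p) p.1 T * Real.exp (lam * M.g T (M.endpoint T p)) +
      ∫ v in p.1..T, expInt (M.lineExponent π₁ π₂ lam p) p.1 v * M.lineIntegral π₁ π₂ w p v

variable {M π₁ π₂} {T lam : ℝ} {V V₁ : S → ℝ} {κ k₀ k₁ : ℝ} {w : ℝ × S → ℝ}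

/-- The square appears because the drift inequality contains jump rate times `V`, and the rate
itself may grow like `V`. -/
theorem LineBounds.exists_lintegral_le (h : M.LineBounds π₁ π₂ T V κ k₀ k₁)
    (hV : M.DriftCondition T V) (hw : M.WeightBounded T V w) : ∃ C : ℝ, 0 ≤ C ∧
      ∀ t ∈ Icc 0 T, ∀ x, ∫⁻ y, ‖w (t, y)‖ₑ ∂(M.jumpKernel π₁ π₂ (t, x)) ≤
        ENNReal.ofReal (C * V (M.flow x (T - t)) ^ 2) := by
  obtain ⟨ρ, b, hρ, hb, hd⟩ := hV.lintegral_le (T := T) π₁ π₂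
  obtain ⟨C, hC, hwC⟩ := hw.bounded
  have hκ := h.const_nonneg.1
  refine ⟨C * (ρ + b + κ), by positivity, fun t ht x => ?_⟩
  set W := V (M.flow x (T - t)) with hW
  have hW1 : 1 ≤ W := hV.one_le _
  have hm : Measurable fun y => ENNReal.ofReal (V (M.flow y (T - t))) :=
    (hV.measurable.comp (M.measurable_flow.comp (g := fun p : S × ℝ => M.flow p.1 p.2)
      (f := fun y => (y, T - t)) (by fun_prop))).ennreal_ofReal
  calc ∫⁻ y, ‖w (t, y)‖ₑ ∂(M.jumpKernel π₁ π₂ (t, x))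
      ≤ ∫⁻ y, ENNReal.ofReal C * ENNReal.ofReal (V (M.flow y (T - t)))
          ∂(M.jumpKernel π₁ π₂ (t, x)) := by
        refine lintegral_mono fun y => ?_
        rw [← ENNReal.ofReal_mul hC, Real.enorm_eq_ofReal_abs]
        exact ENNReal.ofReal_le_ofReal (hwC (t, y) ht)
    _ ≤ ENNReal.ofReal C * (ENNReal.ofReal (ρ * W + b) +
          ENNReal.ofReal (M.rate π₁ π₂ t x) * ENNReal.ofReal W) := by
        rw [lintegral_const_mul _ hm, ofReal_rate]
        gcongr
        exact hd t ht x
    _ = ENNReal.ofReal (C * ((ρ * W + b) + M.rate π₁ π₂ t x * W)) := by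
        have := M.rate_nonneg π₁ π₂ t x
        rw [← ENNReal.ofReal_mul this, ← ENNReal.ofReal_add (by positivity) (by positivity),
          ← ENNReal.ofReal_mul hC]
    _ ≤ _ := by
        refine ENNReal.ofReal_le_ofReal ?_
        rw [mul_assoc]
        gcongr
        have h1 : M.rate π₁ π₂ t x * W ≤ κ * W * W := by
          gcongr
          exact h.rate_le t ht x
        have h2 : ρ * W ≤ ρ * W ^ 2 := by gcongr; nlinarith
        have h3 : b ≤ b * W ^ 2 := le_mul_of_one_le_right hb (one_le_pow₀ hW1)
        linarith

theorem LineBounds.integrable_jumpKernel (h : M.LineBounds π₁ π₂ T V κ k₀ k₁)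
    (hV : M.DriftCondition T V) (hw : M.WeightBounded T V w) {t : ℝ} (ht : t ∈ Icc 0 T) (x : S) :
    Integrable (fun y => w (t, y)) (M.jumpKernel π₁ π₂ (t, x)) := by
  obtain ⟨C, -, hC⟩ := h.exists_lintegral_le hV hw
  refine ⟨(hw.measurable.comp measurable_prodMk_left).aestronglyMeasurable, ?_⟩
  exact (hC t ht x).trans_lt ENNReal.ofReal_lt_top

theorem LineBounds.exists_abs_integral_le (h : M.LineBounds π₁ π₂ T V κ k₀ k₁)
    (hV : M.DriftCondition T V) (hw : M.WeightBounded T V w) : ∃ C : ℝ, 0 ≤ C ∧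
      ∀ t ∈ Icc 0 T, ∀ x, |∫ y, w (t, y) ∂(M.jumpKernel π₁ π₂ (t, x))| ≤
        C * V (M.flow x (T - t)) ^ 2 := by
  obtain ⟨C, hC0, hC⟩ := h.exists_lintegral_le hV hw
  refine ⟨C, hC0, fun t ht x => ?_⟩
  have h1 := (enorm_integral_le_lintegral_enorm (μ := M.jumpKernel π₁ π₂ (t, x))
    fun y => w (t, y)).trans (hC t ht x)
  rw [Real.enorm_eq_ofReal_abs] at h1
  exact (ENNReal.ofReal_le_ofReal_iff (by positivity)).1 h1

theorem LineBounds.intervalIntegrable_lineIntegral (h : M.LineBounds π₁ π₂ T V κ k₀ k₁)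
    (hV : M.DriftCondition T V) (hw : M.WeightBounded T V w) (p : ℝ × S) {a b : ℝ} (ha : 0 ≤ a)
    (hb : b ≤ T) (hab : a ≤ b) :
    IntervalIntegrable (M.lineIntegral π₁ π₂ w p) volume a b := by
  obtain ⟨C, hC0, hC⟩ := h.exists_abs_integral_le hV hw
  refine LineBounds.intervalIntegrable_of_bounded (M.measurable_lineIntegral π₁ π₂ hw.measurable p)
    (C := C * V (M.endpoint T p) ^ 2) (fun v hv => ?_) hab
  have h1 := hC v ⟨ha.trans hv.1, hv.2.trans hb⟩ (M.flow p.2 (v - p.1))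
  have h2 : M.flow (M.flow p.2 (v - p.1)) (T - v) = M.endpoint T p := M.endpoint_line T p v
  rwa [h2] at h1

/-- The mild equations at all points of one line, multiplied by the exponential from the start of
the line, become a single integrated equation, because `expInt` is multiplicative over adjacent
intervals. -/
theorem IsMild.flow_equation (h : M.LineBounds π₁ π₂ T V κ k₀ k₁) (hV : M.DriftCondition T V)
    (hw : M.IsMild π₁ π₂ T lam V w) {u : ℝ → S → ℝ} (hu : ∀ t ∈ Icc 0 T, ∀ x, u t x = w (t, x))
    {s : ℝ} (hs : s ∈ Icc 0 T) (x : S) :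
    AbsolutelyContinuousOnInterval (fun v => u v (M.flow x (v - s))) s T ∧
      ∀ᵐ v, v ∈ Icc s T → M.Lflow u v (M.flow x (v - s)) =
        - (M.lineExponent π₁ π₂ lam (s, x) v * u v (M.flow x (v - s)) +
          M.lineIntegral π₁ π₂ w (s, x) v) := by
  have hβ := h.intervalIntegrable_lineExponent lam (s, x) hs.1 le_rfl hs.2
  have hk := h.intervalIntegrable_lineIntegral hV hw.toWeightBounded (s, x) hs.1 le_rfl hs.2
  obtain ⟨h1, h2⟩ := absolutelyContinuousOnInterval_of_duhamel hβ hk hs.2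
    (f := fun v => u v (M.flow x (v - s)))
    (c := expInt (M.lineExponent π₁ π₂ lam (s, x)) s T *
      Real.exp (lam * M.g T (M.endpoint T (s, x)))) fun t ht => by
    have ht0 : t ∈ Icc 0 T := ⟨hs.1.trans ht.1, ht.2⟩
    have h3 := hw.eq (t, M.flow x (t - s)) ht0
    have h4 := M.lineExponent_line π₁ π₂ lam (s, x) t
    have h5 := M.lineIntegral_line π₁ π₂ w (s, x) t
    have h6 := M.endpoint_line T (s, x) t
    simp only at h3 h4 h5 h6
    rw [h4, h5, h6] at h3
    rw [hu t ht0, h3, mul_add, ← mul_assoc,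
      expInt_mul_expInt hβ (by rw [uIcc_of_le hs.2]; exact ht),
      ← intervalIntegral.integral_const_mul]
    congr 1
    refine intervalIntegral.integral_congr fun v hv => ?_
    rw [uIcc_of_le ht.2] at hv
    rw [← mul_assoc, expInt_mul_expInt
      (h.intervalIntegrable_lineExponent lam (s, x) hs.1 hv.2 (ht.1.trans hv.1))
      (by rw [uIcc_of_le (ht.1.trans hv.1)]; exact ⟨ht.1, hv.1⟩)]
  refine ⟨h1, ?_⟩
  filter_upwards [h2] with v hv hmem
  rw [M.Lflow_line, (hv hmem).deriv]

/-- The killing part of the signed rate joins the cost in the exponent, leaving the positive jump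
integral as inhomogeneity. -/
theorem LineBounds.generator_eq (h : M.LineBounds π₁ π₂ T V κ k₀ k₁) (hV : M.DriftCondition T V)
    (hw : M.WeightBounded T V w) {u : ℝ → S → ℝ} (hu : ∀ t ∈ Icc 0 T, ∀ x, u t x = w (t, x))
    (p : ℝ × S) {v : ℝ} (hv : v ∈ Icc 0 T) :
    lam * M.stratCost π₁ π₂ v (M.flow p.2 (v - p.1)) * u v (M.flow p.2 (v - p.1)) +
        ∫ᵛ y, u v y ∂<•(M.stratRate π₁ π₂ v (M.flow p.2 (v - p.1))) =
      M.lineExponent π₁ π₂ lam p v * u v (M.flow p.2 (v - p.1)) +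
        M.lineIntegral π₁ π₂ w p v := by
  have h1 := h.integrable_jumpKernel hV hw hv (M.flow p.2 (v - p.1))
  have h2 : (fun y => u v y) = fun y => w (v, y) := funext fun y => hu v hv y
  rw [M.integral_stratRate π₁ π₂ (u := fun y => u v y) (by rw [h2]; exact h1), h2]
  simp only [lineExponent, lineCost, lineRate, lineIntegral]
  ring

theorem IsMild.isSolution (h : M.LineBounds π₁ π₂ T V κ k₀ k₁) (hV : M.DriftCondition T V)
    (hT : 0 ≤ T) (hw : M.IsMild π₁ π₂ T lam V w) {u : ℝ → S → ℝ}
    (hu : ∀ t ∈ Icc 0 T, ∀ x, u t x = w (t, x)) : M.IsSolution π₁ π₂ T lam u := by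
  refine ⟨M.aeFlow_iff.2 fun s hs x => ?_, fun x => ?_⟩
  · filter_upwards [(hw.flow_equation h hV hu hs x).2] with v hv hmem
    have h1 := h.generator_eq hV hw.toWeightBounded (lam := lam) hu (s, x)
      (v := v) ⟨hs.1.trans hmem.1, hmem.2⟩
    simp only at h1
    rw [add_assoc, h1, hv hmem]
    ring
  · rw [hu T ⟨hT, le_rfl⟩, hw.eq (T, x) ⟨hT, le_rfl⟩]
    simp [expInt_self, endpoint, M.flow_zero]

theorem IsMild.memBac₂ (h : M.LineBounds π₁ π₂ T V κ k₀ k₁) (hV : M.DriftCondition T V)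
    (hV₁ : M.SecondDriftCondition T V V₁) (hw : M.IsMild π₁ π₂ T lam V w) {u : ℝ → S → ℝ}
    (hu : ∀ t ∈ Icc 0 T, ∀ x, u t x = w (t, x)) : M.MemBac₂ T V V₁ u := by
  obtain ⟨C, hC, hwC⟩ := hw.bounded
  refine ⟨⟨?_, ⟨C, fun t ht x => ?_⟩, fun s hs x => ?_⟩, ?_⟩
  · have : (fun p : Icc (0 : ℝ) T × S => u p.1 p.2) = fun p => w (p.1, p.2) :=
      funext fun p => hu p.1 p.1.2 p.2
    rw [this]
    exact hw.measurable.comp (by fun_prop)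
  · rw [hu t ht]
    exact hwC (t, x) ht
  · exact (M.absCont_line_iff u s T x).2 (hw.flow_equation h hV hu hs x).1
  · obtain ⟨D, hD, hwD⟩ := h.exists_abs_integral_le hV hw.toWeightBounded
    obtain ⟨M₃, hM₃, hsq⟩ := hV₁.sq_le
    obtain ⟨hκ, hk₀, hk₁⟩ := h.const_nonneg
    -- Both exponent times `u` and the jump integral are of order `V²`, and `V² ≤ M₃ V₁`.
    refine ⟨((|lam| * (k₀ + k₁) + κ) * C + D) * M₃, M.aeFlow_iff.2 fun s hs x => ?_⟩
    filter_upwards [(hw.flow_equation h hV hu hs x).2] with v hv hmem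
    have hv0 : v ∈ Icc 0 T := ⟨hs.1.trans hmem.1, hmem.2⟩
    rw [hv hmem, abs_neg]
    have hE : M.flow (M.flow x (v - s)) (T - v) = M.endpoint T (s, x) :=
      M.endpoint_line T (s, x) v
    have h1 := hwD v hv0 (M.flow x (v - s))
    have h2 := hwC (v, M.flow x (v - s)) hv0
    have h2' : M.endpoint T (v, M.flow x (v - s)) = M.endpoint T (s, x) := hE
    have h3 := h.lineRate_le (s, x) hv0
    have h4 := h.abs_lineCost_le (s, x) hv0
    have h5 := M.lineRate_nonneg π₁ π₂ (s, x) v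
    rw [h2'] at h2
    rw [hE] at h1 ⊢
    set W := V (M.endpoint T (s, x)) with hW
    have hW1 : 1 ≤ W := hV.one_le _
    have hlog : Real.log W ≤ W := (Real.log_le_sub_one_of_pos (by linarith)).trans (by linarith)
    have h6 : |M.lineExponent π₁ π₂ lam (s, x) v| ≤ (|lam| * (k₀ + k₁) + κ) * W := by
      calc |M.lineExponent π₁ π₂ lam (s, x) v|
          ≤ |lam * M.lineCost π₁ π₂ (s, x) v| + |M.lineRate π₁ π₂ (s, x) v| := abs_sub _ _
        _ ≤ |lam| * (k₀ * W + k₁ * W) + κ * W := by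
          rw [abs_mul, abs_of_nonneg h5]
          gcongr
          refine h4.trans ?_
          gcongr
          nlinarith
        _ = _ := by ring
    have h7 : |M.lineIntegral π₁ π₂ w (s, x) v| ≤ D * W ^ 2 := h1
    calc _ ≤ |M.lineExponent π₁ π₂ lam (s, x) v| * |u v (M.flow x (v - s))| +
          |M.lineIntegral π₁ π₂ w (s, x) v| := by
          rw [← abs_mul]
          exact abs_add_le _ _
      _ ≤ (|lam| * (k₀ + k₁) + κ) * W * (C * W) + D * W ^ 2 := by
          rw [hu v hv0]
          gcongr
      _ = ((|lam| * (k₀ + k₁) + κ) * C + D) * W ^ 2 := by ring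
      _ ≤ ((|lam| * (k₀ + k₁) + κ) * C + D) * (M₃ * V₁ (M.endpoint T (s, x))) := by
          gcongr
          exact hsq _
      _ = _ := by ring

/-- Solutions of the differential equation solve the equation of variation of constants. -/
theorem IsSolution.isMild (h : M.LineBounds π₁ π₂ T V κ k₀ k₁) (hV : M.DriftCondition T V)
    (hw : M.WeightBounded T V w) {u : ℝ → S → ℝ} (hu : ∀ t ∈ Icc 0 T, ∀ x, u t x = w (t, x))
    (hac : M.MemBac T V u) (hsol : M.IsSolution π₁ π₂ T lam u) :
    M.IsMild π₁ π₂ T lam V w := by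
  refine ⟨hw, fun p hp => ?_⟩
  have hβ := h.intervalIntegrable_lineExponent lam p hp.1 le_rfl hp.2
  have h1 := duhamel_of_ae_deriv hβ ((M.absCont_line_iff u p.1 T p.2).1 (hac.absCont p.1 hp p.2))
    (k := M.lineIntegral π₁ π₂ w p) (by
      filter_upwards [M.aeFlow_iff.1 hsol.1 p.1 hp p.2] with v hv hmem
      rw [uIcc_of_le hp.2] at hmem
      have h2 := hv hmem
      rw [add_assoc, h.generator_eq hV hw hu p ⟨hp.1.trans hmem.1, hmem.2⟩, M.Lflow_line] at h2
      linarith)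
  simp only [sub_self, M.flow_zero] at h1
  rw [hu p.1 hp, hsol.2] at h1
  exact h1

end Mild

end Game

end PDMG

end

noncomputable section

namespace PDMG


/-! ### Existence and uniqueness of mild solutions -/

namespace Game

variable {S A B : Type*} [TopologicalSpace S] [MeasurableSpace S]
  [MeasurableSpace A] [MeasurableSpace B] {M : Game S A B}
  {π₁ : MarkovStrategy M.actA} {π₂ : MarkovStrategy M.actB}
  {T lam : ℝ} {V V₁ : S → ℝ} {κ k₀ k₁ : ℝ} {w w₁ w₂ : ℝ × S → ℝ}

theorem WeightBounded.sub (h₁ : M.WeightBounded T V w₁) (h₂ : M.WeightBounded T V w₂) :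
    M.WeightBounded T V fun p => w₁ p - w₂ p := by
  obtain ⟨C₁, hC₁, hw₁⟩ := h₁.bounded
  obtain ⟨C₂, hC₂, hw₂⟩ := h₂.bounded
  refine ⟨h₁.measurable.sub h₂.measurable, C₁ + C₂, by positivity, fun p hp => ?_⟩
  rw [add_mul]
  exact (abs_sub _ _).trans (add_le_add (hw₁ p hp) (hw₂ p hp))

/-- Extension by zero outside `[0, T]` gives a function measurable on all of `ℝ × S`, as needed for
the kernel integrals. -/
theorem MemBac.exists_weightBounded {u : ℝ → S → ℝ} (hV : ∀ x, 0 ≤ V x)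
    (hu : M.MemBac T V u) :
    ∃ w : ℝ × S → ℝ, M.WeightBounded T V w ∧ ∀ t ∈ Icc 0 T, ∀ x, u t x = w (t, x) := by
  have hs : MeasurableSet {p : ℝ × S | p.1 ∈ Icc 0 T} := measurable_fst measurableSet_Icc
  refine ⟨{p : ℝ × S | p.1 ∈ Icc 0 T}.indicator fun p => u p.1 p.2, ⟨?_, ?_⟩, fun t ht x => ?_⟩
  · refine measurable_of_restrict_of_restrict_compl hs ?_ ?_
    · have : {p : ℝ × S | p.1 ∈ Icc 0 T}.domRestrict
          ({p : ℝ × S | p.1 ∈ Icc 0 T}.indicator fun p => u p.1 p.2) =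
          fun q => u q.1.1 q.1.2 := by
        ext q
        exact indicator_of_mem q.2 _
      rw [this]
      exact hu.measurable.comp (g := fun p : Icc (0 : ℝ) T × S => u p.1 p.2)
        (f := fun q : {p : ℝ × S | p.1 ∈ Icc 0 T} => ((⟨q.1.1, q.2⟩ : Icc (0 : ℝ) T), q.1.2))
        (by fun_prop)
    · have : {p : ℝ × S | p.1 ∈ Icc 0 T}ᶜ.domRestrict
          ({p : ℝ × S | p.1 ∈ Icc 0 T}.indicator fun p => u p.1 p.2) = fun _ => 0 := by
        ext q
        exact indicator_of_notMem q.2 _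
      rw [this]
      exact measurable_const
  · obtain ⟨C, hC⟩ := hu.bounded
    refine ⟨|C|, abs_nonneg C, fun p hp => ?_⟩
    rw [indicator_of_mem (show p ∈ {p : ℝ × S | p.1 ∈ Icc 0 T} from hp)]
    refine (hC p.1 hp p.2).trans ?_
    exact mul_le_mul_of_nonneg_right (le_abs_self C) (hV _)
  · exact (indicator_of_mem (show (t, x) ∈ {p : ℝ × S | p.1 ∈ Icc 0 T} from ht)
      fun p : ℝ × S => u p.1 p.2).symm

variable [MeasurableEq S]

/-- The first-jump equation in `ℝ≥0∞` becomes a real equation, since the bound by `V` makes all its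
terms finite. -/
theorem LineBounds.isMild_chainValue (h : M.LineBounds π₁ π₂ T V κ k₀ (1 / (2 * (T + 1))))
    (hV : M.DriftCondition T V) (hT : 0 < T) (hlam : 0 ≤ lam) (hlam1 : lam ≤ 1) :
    M.IsMild π₁ π₂ T lam V
      fun p => (M.chainValue π₁ π₂ T lam (M.stayCost π₁ π₂ T lam) p).toReal := by
  obtain ⟨C, hC, hUC⟩ := h.exists_chainValue_le hV hT hlam hlam1
  set U := M.chainValue π₁ π₂ T lam (M.stayCost π₁ π₂ T lam) with hU
  have hσ := M.measurable_stayCost π₁ π₂ hT.le lam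
  have hfin : ∀ p : ℝ × S, p.1 ∈ Icc 0 T → U p ≠ ∞ := fun p hp =>
    ((hUC p hp).trans_lt ENNReal.ofReal_lt_top).ne
  have hw : M.WeightBounded T V fun p => (U p).toReal := by
    refine ⟨(M.measurable_chainValue π₁ π₂ T lam hσ).ennreal_toReal, C, hC, fun p hp => ?_⟩
    rw [abs_of_nonneg ENNReal.toReal_nonneg]
    exact ENNReal.toReal_le_of_le_ofReal
      (mul_nonneg hC (by linarith [hV.one_le (M.endpoint T p)])) (hUC p hp)
  refine ⟨hw, fun p hp => ?_⟩
  have hβ := h.intervalIntegrable_lineExponent lam p hp.1 le_rfl hp.2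
  have hk := h.intervalIntegrable_lineIntegral hV hw p hp.1 le_rfl hp.2
  have hnn : ∀ v, 0 ≤ M.lineIntegral π₁ π₂ (fun p => (U p).toReal) p v := fun v =>
    integral_nonneg fun y => ENNReal.toReal_nonneg
  have hlj : ∀ v ∈ Ioc p.1 T, M.lineJump π₁ π₂ U p v =
      ENNReal.ofReal (M.lineIntegral π₁ π₂ (fun p => (U p).toReal) p v) := fun v hv => by
    have hv0 : v ∈ Icc 0 T := ⟨hp.1.trans hv.1.le, hv.2⟩
    rw [lineIntegral, ofReal_integral_eq_lintegral_ofReal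
      (h.integrable_jumpKernel hV hw hv0 _) (ae_of_all _ fun y => ENNReal.toReal_nonneg), lineJump]
    exact lintegral_congr fun y => (ENNReal.ofReal_toReal (hfin (v, y) hv0)).symm
  have hnn' : ∀ v, 0 ≤ expInt (M.lineExponent π₁ π₂ lam p) p.1 v *
      M.lineIntegral π₁ π₂ (fun p => (U p).toReal) p v := fun v =>
    mul_nonneg (expInt_pos _ _ _).le (hnn v)
  have hint : M.jumpOp π₁ π₂ T lam U p =
      ENNReal.ofReal (∫ v in p.1..T, expInt (M.lineExponent π₁ π₂ lam p) p.1 v *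
        M.lineIntegral π₁ π₂ (fun p => (U p).toReal) p v) := by
    rw [intervalIntegral.integral_of_le hp.2, ofReal_integral_eq_lintegral_ofReal
      ((intervalIntegrable_iff_integrableOn_Ioc_of_le hp.2).1
        (intervalIntegrable_expInt_mul hβ hk)) (ae_of_all _ hnn')]
    refine setLIntegral_congr_fun measurableSet_Ioc fun v hv => ?_
    rw [h.weight_eq lam hp.1 (Ioc_subset_Icc_self hv), hlj v hv,
      ENNReal.ofReal_mul (expInt_pos _ _ _).le]
  have hstay : M.stayCost π₁ π₂ T lam p * M.survival π₁ π₂ p T =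
      ENNReal.ofReal (expInt (M.lineExponent π₁ π₂ lam p) p.1 T *
        Real.exp (lam * M.g T (M.endpoint T p))) := by
    rw [ENNReal.ofReal_mul (expInt_pos _ _ _).le, ← h.weight_eq lam hp.1 ⟨hp.2, le_rfl⟩, stayCost]
    ring
  have hE : 0 ≤ expInt (M.lineExponent π₁ π₂ lam p) p.1 T *
        Real.exp (lam * M.g T (M.endpoint T p)) :=
    mul_nonneg (expInt_pos _ _ _).le (Real.exp_pos _).le
  have hI := intervalIntegral.integral_nonneg (μ := volume) hp.2 fun v _ => hnn' v
  rw [hU, h.chainValue_eq lam hσ hp, ← hU, hstay, hint, ← ENNReal.ofReal_add hE hI,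
    ENNReal.toReal_ofReal (add_nonneg hE hI)]

/-- The terminal terms cancel, so the absolute difference is a subsolution of the homogeneous
equation. -/
theorem IsMild.enorm_sub_le (h : M.LineBounds π₁ π₂ T V κ k₀ k₁) (hV : M.DriftCondition T V)
    (h₁ : M.IsMild π₁ π₂ T lam V w₁) (h₂ : M.IsMild π₁ π₂ T lam V w₂) {p : ℝ × S}
    (hp : p.1 ∈ Icc 0 T) :
    ‖w₁ p - w₂ p‖ₑ ≤ M.jumpOp π₁ π₂ T lam (fun q => ‖w₁ q - w₂ q‖ₑ) p := by
  have hβ := h.intervalIntegrable_lineExponent lam p hp.1 le_rfl hp.2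
  have hk₁ := h.intervalIntegrable_lineIntegral hV h₁.toWeightBounded p hp.1 le_rfl hp.2
  have hk₂ := h.intervalIntegrable_lineIntegral hV h₂.toWeightBounded p hp.1 le_rfl hp.2
  have hsub : w₁ p - w₂ p = ∫ v in Ioc p.1 T, expInt (M.lineExponent π₁ π₂ lam p) p.1 v *
      (M.lineIntegral π₁ π₂ w₁ p v - M.lineIntegral π₁ π₂ w₂ p v) := by
    rw [h₁.eq p hp, h₂.eq p hp, add_sub_add_left_eq_sub, ← intervalIntegral.integral_sub
      (intervalIntegrable_expInt_mul hβ hk₁) (intervalIntegrable_expInt_mul hβ hk₂),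
      intervalIntegral.integral_of_le hp.2]
    simp only [mul_sub]
  rw [hsub]
  refine (enorm_integral_le_lintegral_enorm _).trans ?_
  refine setLIntegral_mono' measurableSet_Ioc fun v hv => ?_
  have hv0 : v ∈ Icc 0 T := ⟨hp.1.trans hv.1.le, hv.2⟩
  rw [h.weight_eq lam hp.1 (Ioc_subset_Icc_self hv), enorm_mul,
    Real.enorm_of_nonneg (expInt_pos _ _ _).le]
  gcongr
  rw [lineIntegral, lineIntegral, ← integral_sub
    (h.integrable_jumpKernel hV h₁.toWeightBounded hv0 _)
    (h.integrable_jumpKernel hV h₂.toWeightBounded hv0 _)]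
  exact enorm_integral_le_lintegral_enorm _

/-- The running cost is controlled by the second weight. -/
theorem LineBounds.stratCost_le_log_sq (h : M.LineBounds π₁ π₂ T V κ k₀ k₁) (hlam : 0 ≤ lam)
    (hlam1 : lam ≤ 1) (hV₁ : ∀ x, 1 ≤ V₁ x) {C : ℝ} (hC : 1 ≤ C)
    (hsq : ∀ x, V x ^ 2 ≤ C * V₁ x) {t : ℝ} (ht : t ∈ Icc 0 T) (x : S) :
    lam * M.stratCost π₁ π₂ t x ≤ (k₀ + k₁ / 2 * Real.log C) +
      k₁ / 4 * Real.log (V₁ (M.flow x (T - t)) ^ 2) := by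
  obtain ⟨-, -, hk₁⟩ := h.const_nonneg
  have h1 := h.one_le (M.flow x (T - t))
  have h2 := hV₁ (M.flow x (T - t))
  have h3 := Real.log_le_log (by positivity) (hsq (M.flow x (T - t)))
  rw [Real.log_pow, Real.log_mul (by positivity) (by positivity)] at h3
  rw [Real.log_pow]
  push_cast at h3 ⊢
  calc lam * M.stratCost π₁ π₂ t x ≤ lam * |M.stratCost π₁ π₂ t x| := by
        gcongr; exact le_abs_self _
    _ ≤ 1 * |M.stratCost π₁ π₂ t x| := by gcongr
    _ ≤ k₀ + k₁ * Real.log (V (M.flow x (T - t))) := by rw [one_mul]; exact h.cost_le t ht x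
    _ ≤ k₀ + k₁ * ((Real.log C + Real.log (V₁ (M.flow x (T - t)))) / 2) := by
        gcongr
        linarith
    _ = _ := by ring

/-- The barrier is built on `V₁ ^ 2` with initial exponent `1/2`: it is at least `V₁`, and the
running cost may raise the exponent without leaving the range allowed by the drift of `V₁ ^ 2`. -/
theorem IsMild.unique (h : M.LineBounds π₁ π₂ T V κ k₀ (1 / (2 * (T + 1))))
    (hV : M.DriftCondition T V) (hV₁ : M.SecondDriftCondition T V V₁) (hT : 0 < T)
    (hlam : 0 ≤ lam) (hlam1 : lam ≤ 1) (h₁ : M.IsMild π₁ π₂ T lam V w₁)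
    (h₂ : M.IsMild π₁ π₂ T lam V w₂) {p : ℝ × S} (hp : p.1 ∈ Icc 0 T) : w₁ p = w₂ p := by
  obtain ⟨ρ, b, hρ, hb, hd⟩ := hV₁.lintegral_le (T := T) π₁ π₂
  obtain ⟨M₃, hM₃, hsq⟩ := hV₁.sq_le
  obtain ⟨C, hC, hdC⟩ := (h₁.toWeightBounded.sub h₂.toWeightBounded).bounded
  obtain ⟨-, hk₀, hk₁⟩ := h.const_nonneg
  have hWm : Measurable fun x => V₁ x ^ 2 := hV₁.measurable.pow_const 2
  have hW1 : ∀ x, 1 ≤ V₁ x ^ 2 := fun x => one_le_pow₀ (hV₁.one_le x)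
  have hc₁ : (0 : ℝ) ≤ 1 / (2 * (T + 1)) / 4 := by positivity
  have hp₁ : 1 / 2 + 1 / (2 * (T + 1)) / 4 * T ≤ 1 := by
    have : 1 / (2 * (T + 1)) / 4 * T ≤ 1 / 2 := by
      rw [div_div, div_mul_eq_mul_div, div_le_div_iff₀ (by positivity) (by norm_num)]
      linarith
    linarith
  set a := ρ + b + (k₀ + 1 / (2 * (T + 1)) / 2 * Real.log M₃) with ha
  have ha0 : 0 ≤ a := by have := Real.log_nonneg hM₃; positivity
  set H := M.barrier T (fun x => V₁ x ^ 2) a (1 / 2) (1 / (2 * (T + 1)) / 4) with hH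
  have hHle : ∀ p : ℝ × S, p.1 ∈ Icc 0 T → ENNReal.ofReal (V₁ (M.endpoint T p)) ≤ H p := by
    intro p hp
    refine ENNReal.ofReal_le_ofReal ?_
    have hpT : 0 ≤ T - p.1 := by linarith [hp.2]
    have h3 := hV₁.one_le (M.endpoint T p)
    calc V₁ (M.endpoint T p) = 1 * (V₁ (M.endpoint T p) ^ 2) ^ (1 / 2 : ℝ) := by
          rw [← Real.sqrt_eq_rpow, Real.sqrt_sq (by linarith), one_mul]
      _ ≤ Real.exp (a * (T - p.1)) *
          (V₁ (M.endpoint T p) ^ 2) ^ (1 / 2 + 1 / (2 * (T + 1)) / 4 * (T - p.1)) := by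
          gcongr
          · exact Real.one_le_exp (by positivity)
          · exact hW1 _
          · have : 0 ≤ 1 / (2 * (T + 1)) / 4 * (T - p.1) := by positivity
            linarith
  have hzero := h.eq_zero_of_le_jumpOp hlam hlam1 (w := fun p => ‖w₁ p - w₂ p‖ₑ) (H := H)
    (fun q hq => h₁.enorm_sub_le h hV h₂ hq) (M.measurable_barrier T hWm _ _ _)
    (fun q hq => le_add_self.trans (h.barrier_supersolution hWm hW1 hρ hb hc₁ (by norm_num) hp₁ hd
      (fun t ht x => h.stratCost_le_log_sq hlam hlam1 hV₁.one_le hM₃ hsq ht x) hq))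
    -- The threshold `C M₃ / ε` makes `C V ≤ ε V² / M₃ ≤ ε V₁`, which the barrier dominates.
    (fun q => ENNReal.ofReal_ne_top) (fun ε hε => ⟨C * M₃ / ε, fun q hq hN => ?_⟩)
    (fun N => ⟨C * |N|, by positivity, fun q hq hN => ?_⟩) hp
  · simpa [sub_eq_zero] using hzero
  · refine le_trans ?_ (mul_le_mul_of_nonneg_left (hHle q hq) zero_le)
    rw [Real.enorm_eq_ofReal_abs, ← ENNReal.ofReal_mul hε.le]
    refine ENNReal.ofReal_le_ofReal ((hdC q hq).trans ?_)
    have h3 := hV.one_le (M.endpoint T q)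
    have h4 := hsq (M.endpoint T q)
    rw [div_le_iff₀ hε] at hN
    refine le_of_mul_le_mul_left ?_ (by linarith : 0 < M₃)
    calc M₃ * (C * V (M.endpoint T q)) = C * M₃ * V (M.endpoint T q) := by ring
      _ ≤ V (M.endpoint T q) * ε * V (M.endpoint T q) := by gcongr
      _ = ε * V (M.endpoint T q) ^ 2 := by ring
      _ ≤ ε * (M₃ * V₁ (M.endpoint T q)) := by gcongr
      _ = _ := by ring
  · rw [Real.enorm_eq_ofReal_abs]
    refine ENNReal.ofReal_le_ofReal ((hdC q hq).trans ?_)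
    gcongr
    exact hN.trans (le_abs_self N)

end Game

end PDMG

end

theorem theorem3p2 {S A B : Type*}
    [TopologicalSpace S] [TopologicalSpace.MetrizableSpace S] [SecondCountableTopology S]
    [MeasurableSpace S] [BorelSpace S] [StandardBorelSpace S]
    [MeasurableSpace A] [StandardBorelSpace A] [MeasurableSpace B] [StandardBorelSpace B]
    (M : PDMG.Game S A B) (T lam : ℝ) (hT : 0 < T) (hlam : 0 < lam) (hlam1 : lam ≤ 1)
    (V V₁ : S → ℝ) (hV : M.DriftCondition T V) (hV₁ : M.SecondDriftCondition T V V₁)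
    (π₁ : PDMG.MarkovStrategy M.actA) (π₂ : PDMG.MarkovStrategy M.actB) :
    (∀ s ∈ Set.Icc 0 T, ∀ x, M.CostWellDefined π₁ π₂ T lam s x) ∧
    M.MemBac₂ T V V₁ (M.riskCost π₁ π₂ T lam) ∧
    M.IsSolution π₁ π₂ T lam (M.riskCost π₁ π₂ T lam) ∧
    ∀ u : ℝ → S → ℝ, M.MemBac₂ T V V₁ u → M.IsSolution π₁ π₂ T lam u →
      ∀ t ∈ Set.Icc 0 T, ∀ x, u t x = M.riskCost π₁ π₂ T lam t x := by
  obtain ⟨κ, k₀, h⟩ := PDMG.Game.SecondDriftCondition.lineBounds hV hV₁ hT π₁ π₂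
  have hmild := h.isMild_chainValue hV hT hlam.le hlam1
  -- The cost and the chain value are identified on `[0, T]` only; the lemmas on mild solutions
  -- require no more.
  have hJ : ∀ t ∈ Set.Icc 0 T, ∀ x, M.riskCost π₁ π₂ T lam t x =
      (M.chainValue π₁ π₂ T lam (M.stayCost π₁ π₂ T lam) (t, x)).toReal := fun t ht x =>
    h.riskCost_eq hV hT.le lam ht x
  refine ⟨fun s hs x => ⟨?_, ?_⟩, hmild.memBac₂ h hV hV₁ hJ, hmild.isSolution h hV hT.le hJ,
    fun u hu hsol t ht x => ?_⟩
  · filter_upwards [h.ae_iSup_pathSum hV lam hs x] with ω hω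
    exact ⟨hω.1, hω.2.1⟩
  · obtain ⟨C, -, hC⟩ := h.exists_chainValue_le hV hT hlam.le hlam1
    refine ⟨(h.aemeasurable_expCost hV hT.le lam hs x).aestronglyMeasurable, ?_⟩
    rw [MeasureTheory.hasFiniteIntegral_iff_ofReal
      (Filter.Eventually.of_forall fun ω => (PDMG.Game.expCost_pos s ω).le),
      h.lintegral_expCost hV lam hs]
    exact (hC (s, x) hs).trans_lt ENNReal.ofReal_lt_top
  · obtain ⟨w, hw, huw⟩ := hu.toMemBac.exists_weightBounded
      fun x => by linarith [hV.one_le x]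
    rw [huw t ht, hJ t ht]
    exact (hsol.isMild h hV hw huw hu.toMemBac).unique h hV hV₁ hT hlam.le hlam1 hmild
      (p := (t, x)) ht
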